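/- **Open books.** An open book $\mathcal L$ consists of countable families of bindings $B_j$ and pages $P_k$. A binding has a length in $(0,\infty]$ and is a copy of $[0,\ell]$ (of $[0,\infty)$ if $\ell=\infty$); a page is a copy of a rectangle $[0,a]\times[0,b]$ with $a,b\in(0,\infty]$ (infinite intervals being read as $[0,\infty)$). Each side of a page ($4$, $3$ or $2$ sides, according to whether none, one or both of $a,b$ are infinite) is identified isometrically with a binding of the same length, and different sides of one page are identified with different bindings; we write $P\sim B$ if some side of $P$ is identified with $B$. The points of $\mathcal L$ are those of the space obtained by gluing the pages along the bindings, with the quotient topology. The book is *connected* if it has at least one page, each binding has an incident page, and any two pages are joined by a finite chain of pages in which consecutive pages share a binding. It is *finite* if it has finitely many pages and bindings. It is *periodic* if for some $n$ the group $\mathbb Z^n$ acts on it, mapping pages isometrically onto pages and bindings isometrically onto bindings, such that the action is free ($g.x=x$ for some $x$ implies $g=0$), discrete (each $x$ has a neighbourhood that contains no $g.x$ with $g\neq0$) and co-compact ($\mathcal L=\bigcup_g g.\mathcal Q$ for some compact set $\mathcal Q\subset\mathcal L$). **Function spaces and functionals.** A function $u:\mathcal L\to\mathbb C$ is a family $(u_k)$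 of functions on the pages; $L^q(\mathcal L)=\bigoplus_kL^q(P_k)$, $H^1(\mathcal L)=\bigoplus_kH^1(P_k)$, and $H^1_D(\mathcal L)$ is the space of $u\in H^1(\mathcal L)$ such that for each binding $B$ the traces on $B$ of $u$ from all pages $P\sim B$ coincide. Let $p>1$ and $\omega\in\mathbb R$, and for $u\in H^1_D(\mathcal L)$ put $$S_\omega(u)=\tfrac12\|\nabla u\|_{L^2}^2+\tfrac\omega2\|u\|_{L^2}^2-\tfrac1{p+1}\|u\|_{L^{p+1}}^{p+1},\qquad I_\omega(u)=\|\nabla u\|_{L^2}^2+\omega\|u\|_{L^2}^2-\|u\|_{L^{p+1}}^{p+1},$$ all norms being taken over $\mathcal L$. Let $c_p=\frac{p-1}{2(p+1)}$ and $$\omega_{\mathcal L}=\inf_{u\in H^1_D(\mathcal L)\setminus\{0\}}\frac{\|\nabla u\|_{L^2}^2}{\|u\|_{L^2}^2},\qquad s_\omega=\inf\bigl\{c_p\|u\|_{L^{p+1}}^{p+1}:u\in H^1_D(\mathcal L)\setminus\{0\},\ I_\omega(u)\le0\bigr\},$$ $$s_\omega^\infty=\inf\Bigl\{\liminf_{n\to\infty}c_p\|u_n\|_{L^{p+1}}^{p+1}:u_n\in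 H^1_D(\mathcal L)\setminus\{0\},\ I_\omega(u_n)\le0,\ u_n\rightharpoonup0\text{ weakly in }H^1(\mathcal L)\Bigr\},$$ with $\inf\emptyset=+\infty$. **Theorem 1.** Let $\mathcal L$ be a connected open book, either finite or periodic, let $p>1$ and let $\omega>-\omega_{\mathcal L}$. If $\mathcal L$ is finite, assume in addition that $s_\omega<s_\omega^\infty$. Then $s_\omega>0$ and there is an action ground state, that is, some $u\in H^1_D(\mathcal L)\setminus\{0\}$ with $I_\omega(u)=0$ and $S_\omega(u)\le S_\omega(v)$ for all $v\in H^1_D(\mathcal L)\setminus\{0\}$ with $I_\omega(v)=0$. Moreover $S_\omega(u)=c_p\|u\|_{L^{p+1}}^{p+1}=s_\omega$, so that $u$ is also a minimizer for $s_\omega$. -/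

import Mathlib

open MeasureTheory Filter Topology
open scoped ENNReal ComplexConjugate

noncomputable section

/-- The closed interval `[0, ℓ]`, read as `[0, ∞)` if `ℓ = ∞`. -/
def closedSeg (ℓ : ℝ≥0∞) : Set ℝ := {t | 0 ≤ t ∧ ENNReal.ofReal t ≤ ℓ}

/-- The open interval `(0, ℓ)`. -/
def openSeg (ℓ : ℝ≥0∞) : Set ℝ := {t | 0 < t ∧ ENNReal.ofReal t < ℓ}

/-- The closed rectangle `[0, a] × [0, b]`, whose sides may be infinite. -/
def closedRect (a b : ℝ≥0∞) : Set (ℝ × ℝ) := closedSeg a ×ˢ closedSeg b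

/-- The open rectangle `(0, a) × (0, b)`. -/
def openRect (a b : ℝ≥0∞) : Set (ℝ × ℝ) := openSeg a ×ˢ openSeg b

/-- The four possible sides of a rectangle `[0, a] × [0, b]`. -/
inductive PageSide
  | west
  | east
  | south
  | north

namespace PageSide

/-- The side `x = a` (resp. `y = b`) is present only if `a < ∞` (resp. `b < ∞`). -/
def Present (a b : ℝ≥0∞) : PageSide → Prop
  | west => True
  | east => a ≠ ⊤
  | south => True
  | north => b ≠ ⊤

/-- The length of a side of `[0, a] × [0, b]`. -/
def length (a b : ℝ≥0∞) : PageSide → ℝ≥0∞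
  | west => b
  | east => b
  | south => a
  | north => a

/-- Arc length parametrization of a (present) side, by increasing coordinate. -/
def point (a b : ℝ≥0∞) : PageSide → ℝ → ℝ × ℝ
  | west, t => (0, t)
  | east, t => (a.toReal, t)
  | south, t => (t, 0)
  | north, t => (t, b.toReal)

/-- The outer unit normal along a side. -/
def normal : PageSide → ℝ × ℝ
  | west => (-1, 0)
  | east => (1, 0)
  | south => (0, -1)
  | north => (0, 1)

end PageSide

/-- An open book: countably many bindings (intervals) and pages (rectangles). Each side of a page
is identified isometrically with a binding of the same length, and different sides of one page are
identified with different bindings. An isometry between two intervals either preserves or, if the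
length is finite, reverses the arc length parameter; `reversed` says which. -/
structure OpenBook where
  Page : Type
  Binding : Type
  countable_page : Countable Page
  countable_binding : Countable Binding
  bindingLength : Binding → ℝ≥0∞
  bindingLength_pos : ∀ j, 0 < bindingLength j
  width : Page → ℝ≥0∞
  height : Page → ℝ≥0∞
  width_pos : ∀ k, 0 < width k
  height_pos : ∀ k, 0 < height k
  attach : (k : Page) → {s : PageSide // s.Present (width k) (height k)} → Binding
  attach_injective : ∀ k, Function.Injective (attach k)
  attach_length : ∀ k s, bindingLength (attach k s) = s.1.length (width k) (height k)
  reversed : (k : Page) → {s : PageSide // s.Present (width k) (height k)} → Bool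
  reversed_finite : ∀ k s, reversed k s = true → bindingLength (attach k s) ≠ ⊤

namespace OpenBook

/-- The sides of the page `k`. -/
abbrev Sides (L : OpenBook) (k : L.Page) : Type :=
  {s : PageSide // s.Present (L.width k) (L.height k)}

/-- The coordinate, on the binding attached to the side `s` of the page `k`, of the point with
parameter `t` on that side. -/
def coord (L : OpenBook) (k : L.Page) (s : L.Sides k) (t : ℝ) : ℝ :=
  if L.reversed k s = true then (L.bindingLength (L.attach k s)).toReal - t else t

/-- The interior of the page `k`. -/
def rect (L : OpenBook) (k : L.Page) : Set (ℝ × ℝ) := openRect (L.width k) (L.height k)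

/-! ### Connected, finite and periodic books -/

/-- A (nonempty) book is connected if each binding has an incident page and any two pages are
joined by a chain of pages in which consecutive pages share a binding. -/
def IsConnected (L : OpenBook) : Prop :=
  Nonempty L.Page ∧
  (∀ j : L.Binding, ∃ (k : L.Page) (s : L.Sides k), L.attach k s = j) ∧
  ∀ k k' : L.Page, Relation.ReflTransGen
    (fun P P' : L.Page => ∃ (s : L.Sides P) (s' : L.Sides P'), L.attach P s = L.attach P' s') k k'

/-- A book is finite if it has finitely many pages and bindings. -/
def IsFinite (L : OpenBook) : Prop := Finite L.Page ∧ Finite L.Binding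

/-- The disjoint union of the closed pages and the closed bindings. -/
abbrev PrePoint (L : OpenBook) : Type :=
  (Σ k : L.Page, closedRect (L.width k) (L.height k)) ⊕
    (Σ j : L.Binding, closedSeg (L.bindingLength j))

/-- Each point on a side of a page is glued to the corresponding point of the binding. -/
inductive Glue (L : OpenBook) : L.PrePoint → L.PrePoint → Prop
  | mk (k : L.Page) (s : L.Sides k) (t : ℝ)
      (hz : s.1.point (L.width k) (L.height k) t ∈ closedRect (L.width k) (L.height k))
      (ht : L.coord k s t ∈ closedSeg (L.bindingLength (L.attach k s))) :
      Glue L (Sum.inl ⟨k, ⟨s.1.point (L.width k) (L.height k) t, hz⟩⟩)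
        (Sum.inr ⟨L.attach k s, ⟨L.coord k s t, ht⟩⟩)

/-- The points of the book: pages glued along their bindings. -/
def Point (L : OpenBook) : Type := Quot L.Glue

instance (L : OpenBook) : TopologicalSpace L.Point :=
  inferInstanceAs (TopologicalSpace (Quot L.Glue))

/-- A point of a closed page, as a point of the book. -/
def ofPage (L : OpenBook) (k : L.Page) (z : closedRect (L.width k) (L.height k)) : L.Point :=
  Quot.mk L.Glue (Sum.inl ⟨k, z⟩)

/-- A point of a binding, as a point of the book. -/
def ofBinding (L : OpenBook) (j : L.Binding) (t : closedSeg (L.bindingLength j)) : L.Point :=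
  Quot.mk L.Glue (Sum.inr ⟨j, t⟩)

/-- The square of the Euclidean distance in the plane (the metric that Lean puts on `ℝ × ℝ` is
the maximum metric). -/
def euclSq (z w : ℝ × ℝ) : ℝ := (z.1 - w.1) ^ 2 + (z.2 - w.2) ^ 2

/-- A book is periodic if some `ℤⁿ` acts on it, mapping pages isometrically onto pages and bindings
isometrically onto bindings, such that the action is free, discrete and co-compact. (Such maps
preserve the lengths of paths, hence the path distance of the book.) -/
def IsPeriodic (L : OpenBook) : Prop :=
  ∃ (n : ℕ) (_ : AddAction (Fin n → ℤ) L.Point),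
    (∀ (g : Fin n → ℤ) (k : L.Page), ∃ (k' : L.Page)
      (φ : closedRect (L.width k) (L.height k) ≃ closedRect (L.width k') (L.height k')),
      (∀ z w, euclSq (φ z) (φ w) = euclSq z w) ∧
      ∀ z, g +ᵥ L.ofPage k z = L.ofPage k' (φ z)) ∧
    (∀ (g : Fin n → ℤ) (j : L.Binding), ∃ (j' : L.Binding)
      (ψ : closedSeg (L.bindingLength j) ≃ᵢ closedSeg (L.bindingLength j')),
      ∀ t, g +ᵥ L.ofBinding j t = L.ofBinding j' (ψ t)) ∧
    (∀ (g : Fin n → ℤ) (x : L.Point), g +ᵥ x = x → g = 0) ∧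
    (∀ x : L.Point, ∃ U ∈ 𝓝 x, ∀ g : Fin n → ℤ, g ≠ 0 → g +ᵥ x ∉ U) ∧
    ∃ Q : Set L.Point, IsCompact Q ∧ ∀ x : L.Point, ∃ g : Fin n → ℤ, ∃ y ∈ Q, g +ᵥ y = x

/-! ### Function spaces -/

/-- `‖u‖_{L^q}^q` on the book, for a function `u` given by its components on the pages. -/
def lpPow (L : OpenBook) (q : ℝ) (u : L.Page → ℝ × ℝ → ℂ) : ℝ≥0∞ :=
  ∑' k, ∫⁻ z in L.rect k, ‖u k z‖ₑ ^ q

end OpenBook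

/-- `v` is the weak derivative of `u` in the direction `e` on the open set `Ω`. -/
def IsWeakDeriv (Ω : Set (ℝ × ℝ)) (e : ℝ × ℝ) (u v : ℝ × ℝ → ℂ) : Prop :=
  ∀ φ : ℝ × ℝ → ℝ, ContDiff ℝ (⊤ : ℕ∞) φ → HasCompactSupport φ → tsupport φ ⊆ Ω →
    ∫ z in Ω, fderiv ℝ φ z e • u z = - ∫ z in Ω, φ z • v z

/-- `g`, in `L²`, is the trace on the side `s` of `(0, a) × (0, b)` of the function `u` with weak
gradient `(ux, uy)`. It is characterized by Green's formula, tested with the smooth compactly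
supported functions on the plane that vanish near the other sides. -/
def IsTrace (a b : ℝ≥0∞) (u ux uy : ℝ × ℝ → ℂ) (s : PageSide) (g : ℝ → ℂ) : Prop :=
  MemLp g 2 (volume.restrict (openSeg (s.length a b))) ∧
  ∀ φ : ℝ × ℝ → ℝ, ContDiff ℝ (⊤ : ℕ∞) φ → HasCompactSupport φ →
    (∀ s' : PageSide, s'.Present a b → s' ≠ s →
      ∀ t ∈ closedSeg (s'.length a b), s'.point a b t ∉ tsupport φ) →
    (∫ z in openRect a b, (fderiv ℝ φ z (1, 0) • u z + φ z • ux z)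
      = s.normal.1 • ∫ t in openSeg (s.length a b), φ (s.point a b t) • g t) ∧
    (∫ z in openRect a b, (fderiv ℝ φ z (0, 1) • u z + φ z • uy z)
      = s.normal.2 • ∫ t in openSeg (s.length a b), φ (s.point a b t) • g t)

/-- A function in `H¹` of the book, together with its weak gradient: square integrable, with square
integrable weak first derivatives on each page, and with finite total norm. -/
structure OpenBook.H1 (L : OpenBook) where
  toFun : L.Page → ℝ × ℝ → ℂ
  dx : L.Page → ℝ × ℝ → ℂ
  dy : L.Page → ℝ × ℝ → ℂ
  memLp : ∀ k, MemLp (toFun k) 2 (volume.restrict (L.rect k))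
  memLp_dx : ∀ k, MemLp (dx k) 2 (volume.restrict (L.rect k))
  memLp_dy : ∀ k, MemLp (dy k) 2 (volume.restrict (L.rect k))
  weak_dx : ∀ k, IsWeakDeriv (L.rect k) (1, 0) (toFun k) (dx k)
  weak_dy : ∀ k, IsWeakDeriv (L.rect k) (0, 1) (toFun k) (dy k)
  lpPow_lt : L.lpPow 2 toFun < ⊤
  lpPow_dx_lt : L.lpPow 2 dx < ⊤
  lpPow_dy_lt : L.lpPow 2 dy < ⊤

namespace OpenBook

/-- Membership in `H¹_D`: on each binding, the traces from all incident pages coincide. -/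
def MemH1D {L : OpenBook} (u : L.H1) : Prop :=
  ∀ j : L.Binding, ∃ g : ℝ → ℂ, ∀ (k : L.Page) (s : L.Sides k), L.attach k s = j →
    IsTrace (L.width k) (L.height k) (u.toFun k) (u.dx k) (u.dy k) s.1 (fun t => g (L.coord k s t))

/-- `u` is not (almost everywhere) zero. -/
def Nontriv {L : OpenBook} (u : L.H1) : Prop := L.lpPow 2 u.toFun ≠ 0

/-- `‖∇u‖²` in `L²`. -/
def gradSq {L : OpenBook} (u : L.H1) : ℝ := (L.lpPow 2 u.dx + L.lpPow 2 u.dy).toReal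

/-- `‖u‖²` in `L²`. -/
def massSq {L : OpenBook} (u : L.H1) : ℝ := (L.lpPow 2 u.toFun).toReal

/-- The inner product of `H¹`. -/
def h1Inner {L : OpenBook} (u v : L.H1) : ℂ :=
  ∑' k, ∫ z in L.rect k,
    (u.toFun k z * conj (v.toFun k z) + u.dx k z * conj (v.dx k z) + u.dy k z * conj (v.dy k z))

/-- Weak convergence to `0` in the Hilbert space `H¹`. -/
def WeaklyNull {L : OpenBook} (u : ℕ → L.H1) : Prop :=
  ∀ v : L.H1, Tendsto (fun n => h1Inner (u n) v) atTop (𝓝 0)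

/-! ### Action, Nehari functional and levels -/

/-- The action `S_ω`. -/
def action {L : OpenBook} (p ω : ℝ) (u : L.H1) : ℝ :=
  1 / 2 * gradSq u + ω / 2 * massSq u - 1 / (p + 1) * (L.lpPow (p + 1) u.toFun).toReal

/-- The Nehari functional `I_ω`. -/
def nehari {L : OpenBook} (p ω : ℝ) (u : L.H1) : ℝ :=
  gradSq u + ω * massSq u - (L.lpPow (p + 1) u.toFun).toReal

/-- The bottom `ω_𝓛` of the spectrum of the Laplacian. -/
def spectralBottom (L : OpenBook) : ℝ :=
  sInf {r : ℝ | ∃ u : L.H1, MemH1D u ∧ Nontriv u ∧ r = gradSq u / massSq u}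

/-- `c_p ‖u‖_{L^{p+1}}^{p+1}` with `c_p = (p - 1) / (2 (p + 1))`. -/
def potential {L : OpenBook} (p : ℝ) (u : L.H1) : ℝ≥0∞ :=
  ENNReal.ofReal ((p - 1) / (2 * (p + 1))) * L.lpPow (p + 1) u.toFun

/-- The action level `s_ω`. -/
def level (L : OpenBook) (p ω : ℝ) : ℝ≥0∞ :=
  ⨅ (u : L.H1) (_ : MemH1D u ∧ Nontriv u ∧ nehari p ω u ≤ 0), potential p u

/-- The action level at infinity `s_ω^∞`; it is `∞` if there are no admissible sequences. -/
def levelAtInfinity (L : OpenBook) (p ω : ℝ) : ℝ≥0∞ :=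
  ⨅ (u : ℕ → L.H1) (_ : WeaklyNull u ∧ ∀ n, MemH1D (u n) ∧ Nontriv (u n) ∧ nehari p ω (u n) ≤ 0),
    liminf (fun n => potential p (u n)) atTop

/-- An action ground state: a nontrivial minimizer of the action on the Nehari manifold. -/
def IsGroundState {L : OpenBook} (p ω : ℝ) (u : L.H1) : Prop :=
  MemH1D u ∧ Nontriv u ∧ nehari p ω u = 0 ∧
  ∀ v : L.H1, MemH1D v → Nontriv v → nehari p ω v = 0 → action p ω u ≤ action p ω v

end OpenBook

end

noncomputable section

/-! ### Inequalities for smooth functions on rectangles -/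

/-! The proof is the direct method, with loss of compactness at infinity as the only danger. Take a
minimizing sequence `u n` for the level `s_ω`. Since `ω` lies above minus the spectral bottom, the
quadratic part of the Nehari functional is coercive on `H¹_D` (`exists_coercive`). With `I_ω ≤ 0`
this bounds the sequence in `H¹`, and with a Sobolev inequality it keeps `‖u‖_{p+1}` away from zero
(`exists_le_powNorm`), which is the positivity of the level.

Let `v` be a weak limit along a subsequence. It lies in `H¹_D`, because Green's formula, which
characterizes traces, passes to weak limits (`memH1D_of_weakConv`). The quadratic part splits into
the parts of `v` and of `u n - v` by Hilbert space geometry. The `L^{p+1}` part splits by the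
Brezis-Lieb lemma, with almost everywhere convergence supplied by Rellich's theorem. If `v ≠ 0` and
`I_ω(v) > 0`, then `u n - v` would eventually be admissible, while its `L^{p+1}` norm tends to
something strictly below the infimum. Hence `I_ω(v) ≤ 0` and `v` minimizes
(`IsMinimizing.weakConv`). If `I_ω(v) < 0`, a multiple `t v` with `t < 1` would do better, so
`I_ω(v) = 0`, where the action equals `c_p ‖v‖_{p+1}^{p+1}`. It remains to arrange that `v ≠ 0`.

On a finite book, a minimizing sequence with weak limit zero competes for `s_ω^∞`, contrary to `s_ω
< s_ω^∞`.

On a periodic book, vanishing is excluded as in concentration compactness. The Gagliardo-Nirenberg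
inequality on a page has a constant that depends only on a lower bound for the sides. Summed over
the pages, it bounds `‖u‖_{p+1}^{p+1}` by a small multiple of the energy plus a term proportional to
the largest mass on a page (`exists_toReal_lpPow_le`). So every member of the minimizing sequence
carries a fixed amount of mass on some page. The group moves that page into a finite set without
changing any functional. On a subsequence the page is always the same, and Rellich's theorem on this
bounded page prevents a zero limit.

Periodicity is given on the glued space and must be turned into analysis. Isometries of rectangles
are classified as compositions of reflections and the exchange of coordinates
(`IsRectIso.exists_pageSym`), so each group element acts on `H¹_D` (`exists_sym_describes`,
`Sym.pull`). Co-compactness is exploited by testing the compact set with continuous functions that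
vanish on the bindings (`bump`). This shows that the pages are bounded and finite in number up to
symmetry. -/

/-- The Cauchy-Schwarz inequality for the Lebesgue integral. -/
theorem lintegral_mul_sq_le {α : Type*} [MeasurableSpace α] {μ : Measure α} {f g : α → ℝ≥0∞}
    (hf : AEMeasurable f μ) (hg : AEMeasurable g μ) :
    (∫⁻ z, f z * g z ∂μ) ^ 2 ≤ (∫⁻ z, f z ^ 2 ∂μ) * ∫⁻ z, g z ^ 2 ∂μ := by
  have h := ENNReal.lintegral_mul_le_Lp_mul_Lq μ (Real.HolderConjugate.two_two) hf hg
  simp only [Pi.mul_apply, ENNReal.rpow_ofNat] at h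
  calc (∫⁻ z, f z * g z ∂μ) ^ 2
      ≤ ((∫⁻ z, f z ^ 2 ∂μ) ^ (1 / 2 : ℝ) * (∫⁻ z, g z ^ 2 ∂μ) ^ (1 / 2 : ℝ)) ^ 2 := by gcongr
    _ = _ := by
      rw [mul_pow, ← ENNReal.rpow_natCast, ← ENNReal.rpow_natCast, ← ENNReal.rpow_mul,
        ← ENNReal.rpow_mul]
      norm_num

theorem sq_lintegral_le_measure_mul {α : Type*} [MeasurableSpace α] {μ : Measure α} {f : α → ℝ≥0∞}
    (hf : AEMeasurable f μ) :
    (∫⁻ z, f z ∂μ) ^ 2 ≤ μ Set.univ * ∫⁻ z, f z ^ 2 ∂μ := by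
  simpa using lintegral_mul_sq_le (f := fun _ => (1 : ℝ≥0∞)) aemeasurable_const hf

theorem ennreal_add_sq_le (a b : ℝ≥0∞) : (a + b) ^ 2 ≤ 2 * (a ^ 2 + b ^ 2) := by
  have := ENNReal.rpow_add_le_mul_rpow_add_rpow a b (p := 2) (by norm_num)
  norm_num at this
  exact this

theorem ennreal_add_add_sq_le (a b c : ℝ≥0∞) :
    (a + b + c) ^ 2 ≤ 4 * (a ^ 2 + b ^ 2 + c ^ 2) := by
  calc (a + b + c) ^ 2 ≤ 2 * ((a + b) ^ 2 + c ^ 2) := ennreal_add_sq_le _ _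
    _ ≤ 2 * (2 * (a ^ 2 + b ^ 2) + 2 * c ^ 2) := by
      gcongr
      · exact ennreal_add_sq_le _ _
      · exact le_mul_of_one_le_left (by simp) (by norm_num)
    _ = _ := by ring

theorem enorm_sub_le_lintegral_deriv {f : ℝ → ℂ} (hf : ContDiff ℝ 1 f) {a b x t : ℝ}
    (hx : x ∈ Set.Icc a b) (ht : t ∈ Set.Icc a b) :
    ‖f x - f t‖ₑ ≤ ∫⁻ s in Set.Icc a b, ‖deriv f s‖ₑ := by
  have hd : Continuous (deriv f) := hf.continuous_deriv le_rfl
  rw [← intervalIntegral.integral_eq_sub_of_hasDerivAt (f := f) (f' := deriv f) (a := t) (b := x)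
    (fun s _ => (hf.differentiable one_ne_zero s).hasDerivAt) (hd.intervalIntegrable _ _)]
  rw [← ofReal_norm, intervalIntegral.norm_integral_eq_norm_integral_uIoc, ofReal_norm]
  refine (enorm_integral_le_lintegral_enorm _).trans (lintegral_mono_set ?_)
  intro s hs
  rcases Set.mem_uIoc.1 hs with h | h
  · exact ⟨ht.1.trans h.1.le, h.2.trans hx.2⟩
  · exact ⟨hx.1.trans h.1.le, h.2.trans ht.2⟩

/-- The value at `x` differs from the value at `t` by at most the integral of the derivative;
average over `t`. Only the lower bound `h` for the length enters, so the constant serves arbitrarily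
long intervals. -/
theorem enorm_le_lintegral_add_deriv {f : ℝ → ℂ} (hf : ContDiff ℝ 1 f) {a b h x : ℝ} (hh : 0 < h)
    (hab : a + h ≤ b) (hx : x ∈ Set.Icc a b) :
    ‖f x‖ₑ ≤ ∫⁻ s in Set.Icc a b, ((ENNReal.ofReal h)⁻¹ * ‖f s‖ₑ + ‖deriv f s‖ₑ) := by
  have hc : Continuous f := hf.continuous
  have hd : Continuous (deriv f) := hf.continuous_deriv le_rfl
  set D := ∫⁻ s in Set.Icc a b, ‖deriv f s‖ₑ
  have h1 : ENNReal.ofReal (b - a) * ‖f x‖ₑ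
      ≤ (∫⁻ t in Set.Icc a b, ‖f t‖ₑ) + ENNReal.ofReal (b - a) * D := by
    have e : ∀ c : ℝ≥0∞, ENNReal.ofReal (b - a) * c = ∫⁻ _ in Set.Icc a b, c := by
      intro c
      simp [mul_comm]
    rw [e, e, ← lintegral_add_left (by fun_prop)]
    refine setLIntegral_mono' measurableSet_Icc fun t ht => ?_
    calc ‖f x‖ₑ = ‖f t + (f x - f t)‖ₑ := by ring_nf
      _ ≤ ‖f t‖ₑ + ‖f x - f t‖ₑ := enorm_add_le _ _
      _ ≤ _ := by gcongr; exact enorm_sub_le_lintegral_deriv hf hx ht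
  have hpos : ENNReal.ofReal (b - a) ≠ 0 := by simp; linarith
  have htop : ENNReal.ofReal (b - a) ≠ ⊤ := by simp
  rw [lintegral_add_left (by fun_prop), lintegral_const_mul _ (by fun_prop)]
  calc ‖f x‖ₑ = (ENNReal.ofReal (b - a))⁻¹ * (ENNReal.ofReal (b - a) * ‖f x‖ₑ) := by
        rw [← mul_assoc, ENNReal.inv_mul_cancel hpos htop, one_mul]
    _ ≤ (ENNReal.ofReal (b - a))⁻¹ *
          ((∫⁻ t in Set.Icc a b, ‖f t‖ₑ) + ENNReal.ofReal (b - a) * D) := by gcongr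
    _ = (ENNReal.ofReal (b - a))⁻¹ * (∫⁻ t in Set.Icc a b, ‖f t‖ₑ) + D := by
        rw [mul_add, ← mul_assoc, ENNReal.inv_mul_cancel hpos htop, one_mul]
    _ ≤ _ := by
        gcongr
        linarith

/-- The closed box `[x₀, x₁] × [y₀, y₁]`. -/
abbrev closedBox (x₀ x₁ y₀ y₁ : ℝ) : Set (ℝ × ℝ) := Set.Icc x₀ x₁ ×ˢ Set.Icc y₀ y₁

theorem setLIntegral_box (s t : Set ℝ) {F : ℝ × ℝ → ℝ≥0∞} (hF : Measurable F) :
    ∫⁻ z in s ×ˢ t, F z = ∫⁻ x in s, ∫⁻ y in t, F (x, y) := by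
  rw [Measure.volume_eq_prod, ← Measure.prod_restrict, lintegral_prod _ hF.aemeasurable]

theorem setLIntegral_box_symm (s t : Set ℝ) {F : ℝ × ℝ → ℝ≥0∞}
    (hF : Measurable F) :
    ∫⁻ z in s ×ˢ t, F z = ∫⁻ y in t, ∫⁻ x in s, F (x, y) := by
  rw [Measure.volume_eq_prod, ← Measure.prod_restrict, lintegral_prod_symm _ hF.aemeasurable]

theorem deriv_fst_slice {v : ℝ × ℝ → ℂ} (hv : ContDiff ℝ 1 v) (x y : ℝ) :
    deriv (fun t => v (t, y)) x = fderiv ℝ v (x, y) (1, 0) := by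
  have h1 : HasFDerivAt v (fderiv ℝ v (x, y)) (x, y) :=
    (hv.differentiable one_ne_zero _).hasFDerivAt
  have h2 : HasDerivAt (fun t : ℝ => (t, y)) ((1 : ℝ), (0 : ℝ)) x :=
    (hasDerivAt_id x).prodMk (hasDerivAt_const x y)
  exact (h1.comp_hasDerivAt x h2).deriv

theorem deriv_snd_slice {v : ℝ × ℝ → ℂ} (hv : ContDiff ℝ 1 v) (x y : ℝ) :
    deriv (fun t => v (x, t)) y = fderiv ℝ v (x, y) (0, 1) := by
  have h1 : HasFDerivAt v (fderiv ℝ v (x, y)) (x, y) :=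
    (hv.differentiable one_ne_zero _).hasFDerivAt
  have h2 : HasDerivAt (fun t : ℝ => (x, t)) ((0 : ℝ), (1 : ℝ)) y :=
    (hasDerivAt_const y x).prodMk (hasDerivAt_id y)
  exact (h1.comp_hasDerivAt y h2).deriv

theorem measurable_fderiv_apply_enorm {v : ℝ × ℝ → ℂ} (hv : ContDiff ℝ 1 v) (e : ℝ × ℝ) :
    Measurable fun z => ‖fderiv ℝ v z e‖ₑ :=
  ((hv.continuous_fderiv one_ne_zero).clm_apply continuous_const).enorm.measurable

/-- The two dimensional Gagliardo inequality on a box. -/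
theorem lintegral_sq_le_sq_lintegral_grad {v : ℝ × ℝ → ℂ} (hv : ContDiff ℝ 1 v)
    {x₀ x₁ y₀ y₁ h : ℝ} (hh : 0 < h) (hx : x₀ + h ≤ x₁) (hy : y₀ + h ≤ y₁) :
    ∫⁻ z in closedBox x₀ x₁ y₀ y₁, ‖v z‖ₑ ^ 2 ≤
      (∫⁻ z in closedBox x₀ x₁ y₀ y₁, ((ENNReal.ofReal h)⁻¹ * ‖v z‖ₑ +
        ‖fderiv ℝ v z (1, 0)‖ₑ + ‖fderiv ℝ v z (0, 1)‖ₑ)) ^ 2 := by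
  set c := (ENNReal.ofReal h)⁻¹
  have hvc := hv.continuous
  have m0 : Measurable fun z => ‖v z‖ₑ := hvc.enorm.measurable
  have m1 := measurable_fderiv_apply_enorm hv (1, 0)
  have m2 := measurable_fderiv_apply_enorm hv (0, 1)
  set A : ℝ × ℝ → ℝ≥0∞ := fun z => c * ‖v z‖ₑ + ‖fderiv ℝ v z (1, 0)‖ₑ
  set B : ℝ × ℝ → ℝ≥0∞ := fun z => c * ‖v z‖ₑ + ‖fderiv ℝ v z (0, 1)‖ₑ
  have mA : Measurable A := (m0.const_mul c).add m1
  have mB : Measurable B := (m0.const_mul c).add m2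
  set F : ℝ → ℝ≥0∞ := fun y => ∫⁻ x in Set.Icc x₀ x₁, A (x, y)
  set G : ℝ → ℝ≥0∞ := fun x => ∫⁻ y in Set.Icc y₀ y₁, B (x, y)
  have mF : Measurable F := Measurable.lintegral_prod_left' mA
  have mG : Measurable G := Measurable.lintegral_prod_right' mB
  have hF : ∀ x ∈ Set.Icc x₀ x₁, ∀ y, ‖v (x, y)‖ₑ ≤ F y := by
    intro x hx' y
    have hs : ContDiff ℝ 1 fun t => v (t, y) := hv.comp (contDiff_id.prodMk contDiff_const)
    simpa only [deriv_fst_slice hv] using enorm_le_lintegral_add_deriv hs hh hx hx'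
  have hG : ∀ y ∈ Set.Icc y₀ y₁, ∀ x, ‖v (x, y)‖ₑ ≤ G x := by
    intro y hy' x
    have hs : ContDiff ℝ 1 fun t => v (x, t) := hv.comp (contDiff_const.prodMk contDiff_id)
    simpa only [deriv_snd_slice hv] using enorm_le_lintegral_add_deriv hs hh hy hy'
  -- One factor `‖v‖` is bounded by an integral over the vertical line, a function of `x` only, the
  -- other by an integral over the horizontal line. The integral of the product then factorizes.
  calc ∫⁻ z in closedBox x₀ x₁ y₀ y₁, ‖v z‖ₑ ^ 2
      ≤ ∫⁻ z in closedBox x₀ x₁ y₀ y₁, G z.1 * F z.2 := by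
        refine setLIntegral_mono' (measurableSet_Icc.prod measurableSet_Icc) fun z hz => ?_
        rw [sq]
        exact mul_le_mul' (hG z.2 hz.2 z.1) (hF z.1 hz.1 z.2)
    _ = (∫⁻ x in Set.Icc x₀ x₁, G x) * ∫⁻ y in Set.Icc y₀ y₁, F y := by
        rw [Measure.volume_eq_prod, ← Measure.prod_restrict,
          lintegral_prod_mul mG.aemeasurable mF.aemeasurable]
    _ = (∫⁻ z in closedBox x₀ x₁ y₀ y₁, B z) * ∫⁻ z in closedBox x₀ x₁ y₀ y₁, A z := by
        rw [setLIntegral_box _ _ mB, setLIntegral_box_symm _ _ mA]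
    _ ≤ _ := by
        rw [sq]
        refine mul_le_mul' (lintegral_mono fun z => ?_) (lintegral_mono fun z => ?_)
        · exact add_le_add_left le_self_add _
        · exact le_self_add

/-- One step of the iteration that gives the Gagliardo-Nirenberg inequalities. -/
theorem lintegral_pow_succ_le {u : ℝ × ℝ → ℂ} (hu : ContDiff ℝ 1 u) {x₀ x₁ y₀ y₁ h : ℝ}
    (hh : 0 < h) (hx : x₀ + h ≤ x₁) (hy : y₀ + h ≤ y₁) (n : ℕ) :
    ∫⁻ z in closedBox x₀ x₁ y₀ y₁, ‖u z‖ₑ ^ (2 * (n + 1)) ≤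
      4 * ((ENNReal.ofReal h)⁻¹ + (n + 1)) ^ 2 *
      (∫⁻ z in closedBox x₀ x₁ y₀ y₁, ‖u z‖ₑ ^ (2 * n)) *
      ∫⁻ z in closedBox x₀ x₁ y₀ y₁,
        (‖u z‖ₑ ^ 2 + ‖fderiv ℝ u z (1, 0)‖ₑ ^ 2 + ‖fderiv ℝ u z (0, 1)‖ₑ ^ 2) := by
  set c := (ENNReal.ofReal h)⁻¹
  have m0 : Measurable fun z => ‖u z‖ₑ := hu.continuous.enorm.measurable
  have m1 := measurable_fderiv_apply_enorm hu (1, 0)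
  have m2 := measurable_fderiv_apply_enorm hu (0, 1)
  set K : ℝ≥0∞ := c + (n + 1)
  have hd : ∀ z e, ‖fderiv ℝ (fun z => u z ^ (n + 1)) z e‖ₑ
      = (n + 1) * ‖u z‖ₑ ^ n * ‖fderiv ℝ u z e‖ₑ := by
    intro z e
    have := ((hu.differentiable one_ne_zero z).hasFDerivAt.pow (n + 1)).fderiv
    rw [this]
    have h : ‖((n + 1 : ℕ) : ℂ)‖ₑ = n + 1 := by
      rw [← ofReal_norm, Complex.norm_natCast, ENNReal.ofReal_natCast]
      simp
    push_cast at h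
    simp [enorm_mul, enorm_pow, mul_assoc, h]
  -- The Gagliardo inequality is applied to the power `u ^ (n + 1)`, whose derivative carries the
  -- factor `u ^ n`. Cauchy-Schwarz then separates `‖u‖ ^ n` from the first order terms, and `K`
  -- dominates both coefficients that occur.
  have hv : ContDiff ℝ 1 fun z => u z ^ (n + 1) := hu.pow _
  have h := lintegral_sq_le_sq_lintegral_grad hv hh hx hy
  simp only [hd, enorm_pow] at h
  calc ∫⁻ z in closedBox x₀ x₁ y₀ y₁, ‖u z‖ₑ ^ (2 * (n + 1))
      = ∫⁻ z in closedBox x₀ x₁ y₀ y₁, (‖u z‖ₑ ^ (n + 1)) ^ 2 := by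
        simp only [← pow_mul, mul_comm]
    _ ≤ _ := h
    _ ≤ (∫⁻ z in closedBox x₀ x₁ y₀ y₁, ‖u z‖ₑ ^ n * (K * (‖u z‖ₑ +
          ‖fderiv ℝ u z (1, 0)‖ₑ + ‖fderiv ℝ u z (0, 1)‖ₑ))) ^ 2 := by
        gcongr with z
        have e : ∀ a : ℝ≥0∞, ‖u z‖ₑ ^ n * (K * a) = ‖u z‖ₑ ^ n * K * a := fun a => by ring
        rw [e, mul_add, mul_add]
        refine add_le_add (add_le_add ?_ ?_) ?_
        · rw [pow_succ]
          calc c * (‖u z‖ₑ ^ n * ‖u z‖ₑ) = ‖u z‖ₑ ^ n * c * ‖u z‖ₑ := by ring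
            _ ≤ _ := by gcongr; exact le_self_add
        · rw [mul_comm (_ + _)]; gcongr; exact le_add_self
        · rw [mul_comm (_ + _)]; gcongr; exact le_add_self
    _ ≤ (∫⁻ z in closedBox x₀ x₁ y₀ y₁, (‖u z‖ₑ ^ n) ^ 2) *
          ∫⁻ z in closedBox x₀ x₁ y₀ y₁, (K * (‖u z‖ₑ +
          ‖fderiv ℝ u z (1, 0)‖ₑ + ‖fderiv ℝ u z (0, 1)‖ₑ)) ^ 2 :=
        lintegral_mul_sq_le (m0.pow_const n).aemeasurable
          (((m0.add m1).add m2).const_mul K).aemeasurable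
    _ ≤ (∫⁻ z in closedBox x₀ x₁ y₀ y₁, (‖u z‖ₑ ^ n) ^ 2) *
          ∫⁻ z in closedBox x₀ x₁ y₀ y₁, (4 * K ^ 2) * (‖u z‖ₑ ^ 2 +
          ‖fderiv ℝ u z (1, 0)‖ₑ ^ 2 + ‖fderiv ℝ u z (0, 1)‖ₑ ^ 2) := by
        gcongr with z
        rw [mul_pow, mul_comm 4, mul_assoc]
        gcongr
        exact ennreal_add_add_sq_le _ _ _
    _ = _ := by
        rw [lintegral_const_mul _ (by fun_prop)]
        simp only [← pow_mul, mul_comm n 2]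
        ring

/-- Constants in the Gagliardo-Nirenberg inequalities on a rectangle with sides at least `h`. -/
def gnConst (h : ℝ) : ℕ → ℝ≥0∞
  | 0 => 1
  | n + 1 => 4 * ((ENNReal.ofReal h)⁻¹ + (n + 1 + 1)) ^ 2 * gnConst h n

theorem gnConst_ne_top {h : ℝ} (hh : 0 < h) (n : ℕ) : gnConst h n ≠ ⊤ := by
  induction n with
  | zero => simp [gnConst]
  | succ n ih =>
    have : (ENNReal.ofReal h)⁻¹ ≠ ⊤ := by simp [hh]
    refine ENNReal.mul_ne_top (ENNReal.mul_ne_top (by simp) (ENNReal.pow_ne_top ?_)) ih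
    exact ENNReal.add_ne_top.2 ⟨this, by simp⟩

/-- Each application of `lintegral_pow_succ_le` raises the exponent by two at the price of one
factor of the energy. One factor stays a pure mass; it will become the small factor in the argument
against vanishing. -/
theorem gagliardoNirenberg_smooth {u : ℝ × ℝ → ℂ} (hu : ContDiff ℝ 1 u) {x₀ x₁ y₀ y₁ h : ℝ}
    (hh : 0 < h) (hx : x₀ + h ≤ x₁) (hy : y₀ + h ≤ y₁) (n : ℕ) :
    ∫⁻ z in closedBox x₀ x₁ y₀ y₁, ‖u z‖ₑ ^ (2 * (n + 1)) ≤ gnConst h n *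
      (∫⁻ z in closedBox x₀ x₁ y₀ y₁, ‖u z‖ₑ ^ 2) *
      (∫⁻ z in closedBox x₀ x₁ y₀ y₁,
        (‖u z‖ₑ ^ 2 + ‖fderiv ℝ u z (1, 0)‖ₑ ^ 2 + ‖fderiv ℝ u z (0, 1)‖ₑ ^ 2)) ^ n := by
  induction n with
  | zero => simp [gnConst]
  | succ n ih =>
    refine (lintegral_pow_succ_le hu hh hx hy (n + 1)).trans ?_
    rw [gnConst, pow_succ _ n]
    push_cast
    refine (mul_le_mul_left (mul_le_mul_right ih _) _).trans (le_of_eq ?_)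
    ring

/-- The Poincaré inequality on a box, in terms of differences. -/
theorem poincare_smooth {u : ℝ × ℝ → ℂ} (hu : ContDiff ℝ 1 u) {x₀ x₁ y₀ y₁ h : ℝ}
    (hx : x₁ - x₀ ≤ h) (hy : y₁ - y₀ ≤ h) :
    ∫⁻ z in closedBox x₀ x₁ y₀ y₁, ∫⁻ w in closedBox x₀ x₁ y₀ y₁, ‖u z - u w‖ₑ ^ 2 ≤
      2 * ENNReal.ofReal h ^ 2 * volume (closedBox x₀ x₁ y₀ y₁) *
      ∫⁻ z in closedBox x₀ x₁ y₀ y₁,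
        (‖fderiv ℝ u z (1, 0)‖ₑ ^ 2 + ‖fderiv ℝ u z (0, 1)‖ₑ ^ 2) := by
  set R := closedBox x₀ x₁ y₀ y₁
  set H := ENNReal.ofReal h
  have m1 : Measurable fun z => ‖fderiv ℝ u z (1, 0)‖ₑ ^ 2 :=
    (measurable_fderiv_apply_enorm hu (1, 0)).pow_const 2
  have m2 : Measurable fun z => ‖fderiv ℝ u z (0, 1)‖ₑ ^ 2 :=
    (measurable_fderiv_apply_enorm hu (0, 1)).pow_const 2
  set F : ℝ → ℝ≥0∞ := fun y => ∫⁻ x in Set.Icc x₀ x₁, ‖fderiv ℝ u (x, y) (1, 0)‖ₑ ^ 2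
  set G : ℝ → ℝ≥0∞ := fun x => ∫⁻ y in Set.Icc y₀ y₁, ‖fderiv ℝ u (x, y) (0, 1)‖ₑ ^ 2
  have mF : Measurable F := Measurable.lintegral_prod_left' m1
  have mG : Measurable G := Measurable.lintegral_prod_right' m2
  have hlenx : volume (Set.Icc x₀ x₁) ≤ H := by
    rw [Real.volume_Icc]; exact ENNReal.ofReal_le_ofReal hx
  have hleny : volume (Set.Icc y₀ y₁) ≤ H := by
    rw [Real.volume_Icc]; exact ENNReal.ofReal_le_ofReal hy
  have hF : ∀ x ∈ Set.Icc x₀ x₁, ∀ x' ∈ Set.Icc x₀ x₁, ∀ y,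
      ‖u (x, y) - u (x', y)‖ₑ ^ 2 ≤ H * F y := by
    intro x hx' x' hx'' y
    have hs : ContDiff ℝ 1 fun t => u (t, y) := hu.comp (contDiff_id.prodMk contDiff_const)
    have h1 := enorm_sub_le_lintegral_deriv hs hx' hx''
    simp only [deriv_fst_slice hu] at h1
    have m : Measurable fun t => ‖fderiv ℝ u (t, y) (1, 0)‖ₑ :=
      (measurable_fderiv_apply_enorm hu (1, 0)).comp (by fun_prop : Measurable fun t => (t, y))
    calc _ ≤ (∫⁻ s in Set.Icc x₀ x₁, ‖fderiv ℝ u (s, y) (1, 0)‖ₑ) ^ 2 := by gcongr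
      _ ≤ _ := (sq_lintegral_le_measure_mul m.aemeasurable)
      _ ≤ _ := by rw [Measure.restrict_apply_univ]; gcongr
  have hG : ∀ y ∈ Set.Icc y₀ y₁, ∀ y' ∈ Set.Icc y₀ y₁, ∀ x,
      ‖u (x, y) - u (x, y')‖ₑ ^ 2 ≤ H * G x := by
    intro y hy' y' hy'' x
    have hs : ContDiff ℝ 1 fun t => u (x, t) := hu.comp (contDiff_const.prodMk contDiff_id)
    have h1 := enorm_sub_le_lintegral_deriv hs hy' hy''
    simp only [deriv_snd_slice hu] at h1
    have m : Measurable fun t => ‖fderiv ℝ u (x, t) (0, 1)‖ₑ :=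
      (measurable_fderiv_apply_enorm hu (0, 1)).comp (by fun_prop : Measurable fun t => (x, t))
    calc _ ≤ (∫⁻ s in Set.Icc y₀ y₁, ‖fderiv ℝ u (x, s) (0, 1)‖ₑ) ^ 2 := by gcongr
      _ ≤ _ := (sq_lintegral_le_measure_mul m.aemeasurable)
      _ ≤ _ := by rw [Measure.restrict_apply_univ]; gcongr
  have hR : MeasurableSet R := measurableSet_Icc.prod measurableSet_Icc
  -- The two points are joined by a horizontal and a vertical segment through the corner `(w.1,
  -- z.2)`.
  have key : ∀ z ∈ R, ∀ w ∈ R, ‖u z - u w‖ₑ ^ 2 ≤ 2 * H * F z.2 + 2 * H * G w.1 := by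
    intro z hz w hw
    calc ‖u z - u w‖ₑ ^ 2
        = ‖(u (z.1, z.2) - u (w.1, z.2)) + (u (w.1, z.2) - u (w.1, w.2))‖ₑ ^ 2 := by simp
      _ ≤ (‖u (z.1, z.2) - u (w.1, z.2)‖ₑ + ‖u (w.1, z.2) - u (w.1, w.2)‖ₑ) ^ 2 := by
        gcongr; exact enorm_add_le _ _
      _ ≤ 2 * (‖u (z.1, z.2) - u (w.1, z.2)‖ₑ ^ 2 + ‖u (w.1, z.2) - u (w.1, w.2)‖ₑ ^ 2) :=
        ennreal_add_sq_le _ _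
      _ ≤ 2 * (H * F z.2 + H * G w.1) := by
        gcongr
        · exact hF _ hz.1 _ hw.1 _
        · exact hG _ hz.2 _ hw.2 _
      _ = _ := by ring
  have iF : ∫⁻ z in R, F z.2 ≤ H * ∫⁻ z in R, ‖fderiv ℝ u z (1, 0)‖ₑ ^ 2 := by
    rw [setLIntegral_box_symm _ _ m1, setLIntegral_box (F := fun z => F z.2) _ _ (mF.comp measurable_snd)]
    dsimp only
    rw [lintegral_const, Measure.restrict_apply_univ, mul_comm]
    gcongr
  have iG : ∫⁻ z in R, G z.1 ≤ H * ∫⁻ z in R, ‖fderiv ℝ u z (0, 1)‖ₑ ^ 2 := by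
    rw [setLIntegral_box _ _ m2, setLIntegral_box_symm (F := fun z => G z.1) _ _ (mG.comp measurable_fst)]
    dsimp only
    rw [lintegral_const, Measure.restrict_apply_univ, mul_comm]
    gcongr
  calc ∫⁻ z in R, ∫⁻ w in R, ‖u z - u w‖ₑ ^ 2
      ≤ ∫⁻ z in R, ∫⁻ w in R, (2 * H * F z.2 + 2 * H * G w.1) :=
        setLIntegral_mono' hR fun z hz => setLIntegral_mono' hR fun w hw => key z hz w hw
    _ = 2 * H * volume R * (∫⁻ z in R, F z.2) + 2 * H * volume R * ∫⁻ z in R, G z.1 := by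
        have e : ∀ z : ℝ × ℝ, ∫⁻ w in R, (2 * H * F z.2 + 2 * H * G w.1)
            = 2 * H * volume R * F z.2 + 2 * H * ∫⁻ w in R, G w.1 := by
          intro z
          rw [lintegral_add_left (by fun_prop), lintegral_const, Measure.restrict_apply_univ,
            lintegral_const_mul _ (f := fun z : ℝ × ℝ => G z.1) (mG.comp measurable_fst)]
          ring
        simp only [e]
        rw [lintegral_add_right _ (by fun_prop), lintegral_const, Measure.restrict_apply_univ,
            lintegral_const_mul _ (f := fun z : ℝ × ℝ => F z.2) (mF.comp measurable_snd)]
        ring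
    _ ≤ 2 * H * volume R * (H * ∫⁻ z in R, ‖fderiv ℝ u z (1, 0)‖ₑ ^ 2) +
          2 * H * volume R * (H * ∫⁻ z in R, ‖fderiv ℝ u z (0, 1)‖ₑ ^ 2) := by gcongr
    _ = _ := by
        rw [lintegral_add_left m1]
        ring

end

noncomputable section

/-! ### Mollification -/

/-- A bump function supported in the ball of radius `1 / (i + 2)`. -/
def mollBump (i : ℕ) : ContDiffBump (0 : ℝ × ℝ) where
  rIn := 1 / (2 * (i + 2))
  rOut := 1 / (i + 2)
  rIn_pos := by positivity
  rIn_lt_rOut := by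
    rw [one_div_lt_one_div (by positivity) (by positivity)]
    have : (0 : ℝ) ≤ i := Nat.cast_nonneg i
    linarith

/-- The mollification of `f` at scale `1 / (i + 2)`. -/
def mollify (i : ℕ) (f : ℝ × ℝ → ℂ) : ℝ × ℝ → ℂ :=
  convolution ((mollBump i).normed volume) f (ContinuousLinearMap.lsmul ℝ ℝ) volume

theorem contDiff_mollify (i : ℕ) {f : ℝ × ℝ → ℂ} (hf : LocallyIntegrable f volume) :
    ContDiff ℝ 1 (mollify i f) :=
  HasCompactSupport.contDiff_convolution_left (n := 1) _ (mollBump i).hasCompactSupport_normed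
    (mollBump i).contDiff_normed hf

theorem ae_tendsto_mollify {f : ℝ × ℝ → ℂ} (hf : LocallyIntegrable f volume) :
    ∀ᵐ z, Tendsto (fun i => mollify i f z) atTop (𝓝 (f z)) := by
  -- The outer radius is exactly twice the inner one, hence `K = 2`.
  refine ContDiffBump.ae_convolution_tendsto_right_of_locallyIntegrable (K := 2) ?_ ?_ hf
  · have := (tendsto_one_div_add_atTop_nhds_zero_nat (𝕜 := ℝ)).comp (tendsto_add_atTop_nat 1)
    refine this.congr fun i => ?_
    simp only [Function.comp, mollBump]
    push_cast
    ring
  · refine Eventually.of_forall fun i => ?_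
    simp only [mollBump]
    rw [← mul_div_assoc, mul_one, div_le_div_iff₀ (by positivity) (by positivity)]
    linarith

/-- Convolution with a probability density contracts `L²`: the density is split as `√ρ · √ρ`,
Cauchy-Schwarz is applied pointwise, and Tonelli with translation invariance does the rest. -/
theorem lintegral_mollify_sq_le (i : ℕ) {f : ℝ × ℝ → ℂ} (hf : AEStronglyMeasurable f volume) :
    ∫⁻ z, ‖mollify i f z‖ₑ ^ 2 ≤ ∫⁻ z, ‖f z‖ₑ ^ 2 := by
  -- Tonelli needs joint measurability of `f (z - t)`, so `f` is first replaced by a measurable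
  -- representative, which leaves the convolution unchanged.
  wlog hm : Measurable f generalizing f with H
  · have e : mollify i f = mollify i (hf.mk f) := by
      funext x
      refine integral_congr_ae ?_
      have hq : Measure.QuasiMeasurePreserving (fun t : ℝ × ℝ => x - t) volume volume :=
        (Measure.measurePreserving_sub_left volume x).quasiMeasurePreserving
      filter_upwards [hq.ae_eq_comp hf.ae_eq_mk] with t ht
      simp only [Function.comp] at ht
      simp [ht]
    rw [e]
    refine (H hf.stronglyMeasurable_mk.aestronglyMeasurable
      hf.stronglyMeasurable_mk.measurable).trans (le_of_eq ?_)
    refine lintegral_congr_ae ?_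
    filter_upwards [hf.ae_eq_mk] with z hz
    rw [hz]
  set ρ := (mollBump i).normed volume
  have hρc : Continuous ρ := (mollBump i).continuous_normed
  have hρ0 : ∀ t, 0 ≤ ρ t := (mollBump i).nonneg_normed
  set r : ℝ × ℝ → ℝ≥0∞ := fun t => ENNReal.ofReal (√(ρ t))
  have hr : Measurable r := (Real.continuous_sqrt.comp hρc).measurable.ennreal_ofReal
  have hrr : ∀ t, r t * r t = ‖ρ t‖ₑ := by
    intro t
    rw [← ENNReal.ofReal_mul (Real.sqrt_nonneg _), Real.mul_self_sqrt (hρ0 t),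
      Real.enorm_eq_ofReal (hρ0 t)]
  have hint : ∫⁻ t, r t ^ 2 = 1 := by
    simp_rw [sq, hrr, Real.enorm_eq_ofReal (hρ0 _)]
    rw [← ofReal_integral_eq_lintegral_ofReal (mollBump i).integrable_normed
      (Eventually.of_forall hρ0), (mollBump i).integral_normed, ENNReal.ofReal_one]
  have hpt : ∀ z, ‖mollify i f z‖ₑ ^ 2 ≤ ∫⁻ t, r t ^ 2 * ‖f (z - t)‖ₑ ^ 2 := by
    intro z
    calc ‖mollify i f z‖ₑ ^ 2 ≤ (∫⁻ t, r t * (r t * ‖f (z - t)‖ₑ)) ^ 2 := by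
          gcongr
          refine (enorm_integral_le_lintegral_enorm _).trans (le_of_eq ?_)
          refine lintegral_congr fun t => ?_
          rw [← mul_assoc, hrr]
          rw [← enorm_smul]
          rfl
      _ ≤ (∫⁻ t, r t ^ 2) * ∫⁻ t, (r t * ‖f (z - t)‖ₑ) ^ 2 :=
          lintegral_mul_sq_le hr.aemeasurable (by fun_prop)
      _ = _ := by
          rw [hint, one_mul]
          simp only [mul_pow]
  calc ∫⁻ z, ‖mollify i f z‖ₑ ^ 2 ≤ ∫⁻ z, ∫⁻ t, r t ^ 2 * ‖f (z - t)‖ₑ ^ 2 :=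
        lintegral_mono hpt
    _ = ∫⁻ t, ∫⁻ z, r t ^ 2 * ‖f (z - t)‖ₑ ^ 2 := by
        refine lintegral_lintegral_swap ?_
        have : Measurable fun q : (ℝ × ℝ) × (ℝ × ℝ) => r q.2 ^ 2 * ‖f (q.1 - q.2)‖ₑ ^ 2 := by
          fun_prop
        exact this.aemeasurable
    _ = ∫⁻ t, r t ^ 2 * ∫⁻ z, ‖f z‖ₑ ^ 2 := by
        refine lintegral_congr fun t => ?_
        rw [lintegral_const_mul _ (by fun_prop)]
        rw [lintegral_sub_right_eq_self (fun z => ‖f z‖ₑ ^ 2) t]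
    _ = _ := by
        rw [lintegral_mul_const _ (by fun_prop), hint, one_mul]

/-- The derivative may be put on the kernel, and `w ↦ ρ (z - w)` is a legitimate test function for
the weak derivative as soon as the ball about `z` stays inside `Ω`. Extending `u` by zero therefore
does no harm at such `z`. -/
theorem fderiv_mollify {Ω : Set (ℝ × ℝ)} (hΩ : MeasurableSet Ω) {e : ℝ × ℝ} {u v : ℝ × ℝ → ℂ}
    (hu : LocallyIntegrable (Ω.indicator u) volume) (h : IsWeakDeriv Ω e u v) {i : ℕ} {z : ℝ × ℝ}
    (hz : Metric.closedBall z (1 / (i + 2)) ⊆ Ω) :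
    fderiv ℝ (mollify i (Ω.indicator u)) z e = mollify i (Ω.indicator v) z := by
  set ρ := (mollBump i).normed volume with hρ
  have hρs : ContDiff ℝ (⊤ : ℕ∞) ρ := (mollBump i).contDiff_normed
  have hρd : Differentiable ℝ ρ := hρs.differentiable (by simp)
  have hρc : HasCompactSupport ρ := (mollBump i).hasCompactSupport_normed
  have e1 : mollify i (Ω.indicator u) =
      convolution (Ω.indicator u) ρ (ContinuousLinearMap.lsmul ℝ ℝ).flip volume :=
    (convolution_flip _).symm
  have hd := HasCompactSupport.hasFDerivAt_convolution_right (ContinuousLinearMap.lsmul ℝ ℝ).flip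
    hρc hu (hρs.of_le (by norm_cast)) z
  rw [e1, hd.fderiv, convolution_precompR_apply _ hu (hρc.fderiv ℝ)
    (hρs.continuous_fderiv (by simp))]
  have hφ : ContDiff ℝ (⊤ : ℕ∞) fun w => ρ (z - w) := hρs.comp (contDiff_const.sub contDiff_id)
  have hφd : ∀ w, fderiv ℝ (fun w => ρ (z - w)) w e = - fderiv ℝ ρ (z - w) e := by
    intro w
    have h1 : HasFDerivAt (fun w : ℝ × ℝ => z - w) (-ContinuousLinearMap.id ℝ (ℝ × ℝ)) w := by
      simpa using (hasFDerivAt_id w).const_sub z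
    have := ((hρd (z - w)).hasFDerivAt.comp w h1).fderiv
    simp only [Function.comp_def] at this
    rw [this]
    simp
  have hφsub : tsupport (fun w => ρ (z - w)) ⊆ Metric.closedBall z (1 / (i + 2)) := by
    refine closure_minimal ?_ Metric.isClosed_closedBall
    intro w hw
    have : z - w ∈ Function.support ρ := hw
    rw [(mollBump i).support_normed_eq, Metric.mem_ball, dist_zero_right] at this
    rw [Metric.mem_closedBall, dist_comm, dist_eq_norm]
    exact this.le
  have hφc : HasCompactSupport fun w => ρ (z - w) :=
    HasCompactSupport.of_support_subset_isCompact (isCompact_closedBall z (1 / (i + 2)))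
      ((subset_tsupport _).trans hφsub)
  have key := h _ hφ hφc (hφsub.trans hz)
  simp only [hφd, neg_smul, integral_neg, neg_inj] at key
  have a1 : convolution (Ω.indicator u) (fun a => fderiv ℝ ρ a e)
      (ContinuousLinearMap.lsmul ℝ ℝ).flip volume z = ∫ w in Ω, fderiv ℝ ρ (z - w) e • u w := by
    rw [← integral_indicator hΩ]
    refine integral_congr_ae (Eventually.of_forall fun w => ?_)
    by_cases hw : w ∈ Ω <;> simp [hw]
  have a2 : mollify i (Ω.indicator v) z = ∫ w in Ω, ρ (z - w) • v w := by
    rw [← integral_indicator hΩ, show mollify i (Ω.indicator v) =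
      convolution (Ω.indicator v) ρ (ContinuousLinearMap.lsmul ℝ ℝ).flip volume from
      (convolution_flip _).symm]
    refine integral_congr_ae (Eventually.of_forall fun w => ?_)
    by_cases hw : w ∈ Ω <;> simp [hw]
  rw [a1, a2, key]

/-- The open box `(x₀, x₁) × (y₀, y₁)`. -/
abbrev openBox (x₀ x₁ y₀ y₁ : ℝ) : Set (ℝ × ℝ) := Set.Ioo x₀ x₁ ×ˢ Set.Ioo y₀ y₁

/-- A closed box inside an open one, exhausting it as `i → ∞`. -/
abbrev innerBox (x₀ x₁ y₀ y₁ : ℝ) (i : ℕ) : Set (ℝ × ℝ) :=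
  closedBox (x₀ + 1 / (i + 1)) (x₁ - 1 / (i + 1)) (y₀ + 1 / (i + 1)) (y₁ - 1 / (i + 1))

theorem measurableSet_openBox (x₀ x₁ y₀ y₁ : ℝ) : MeasurableSet (openBox x₀ x₁ y₀ y₁) :=
  measurableSet_Ioo.prod measurableSet_Ioo

theorem measurableSet_closedBox (x₀ x₁ y₀ y₁ : ℝ) : MeasurableSet (closedBox x₀ x₁ y₀ y₁) :=
  measurableSet_Icc.prod measurableSet_Icc

theorem innerBox_subset (x₀ x₁ y₀ y₁ : ℝ) (i : ℕ) :
    innerBox x₀ x₁ y₀ y₁ i ⊆ openBox x₀ x₁ y₀ y₁ := by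
  have : (0 : ℝ) < 1 / (i + 1) := by positivity
  intro z hz
  simp only [Set.mem_prod, Set.mem_Icc, Set.mem_Ioo] at hz ⊢
  refine ⟨⟨?_, ?_⟩, ?_, ?_⟩ <;> linarith [hz.1.1, hz.1.2, hz.2.1, hz.2.2]

/-- The margin `1 / (i + 1)` of the inner box exceeds the mollification radius `1 / (i + 2)`. -/
theorem closedBall_subset_of_mem_innerBox {x₀ x₁ y₀ y₁ : ℝ} {i : ℕ} {z : ℝ × ℝ}
    (hz : z ∈ innerBox x₀ x₁ y₀ y₁ i) :
    Metric.closedBall z (1 / (i + 2)) ⊆ openBox x₀ x₁ y₀ y₁ := by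
  intro w hw
  have hlt : (1 : ℝ) / (i + 2) < 1 / (i + 1) := by
    apply one_div_lt_one_div_of_lt <;> [positivity; linarith]
  simp only [Set.mem_prod, Set.mem_Icc, Set.mem_Ioo, Metric.mem_closedBall, Prod.dist_eq,
    Real.dist_eq, max_le_iff, abs_le] at hz hw ⊢
  refine ⟨⟨?_, ?_⟩, ?_, ?_⟩ <;> linarith [hz.1.1, hz.1.2, hz.2.1, hz.2.2, hw.1.1, hw.1.2,
    hw.2.1, hw.2.2]

theorem eventually_mem_innerBox {x₀ x₁ y₀ y₁ : ℝ} {z : ℝ × ℝ}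
    (hz : z ∈ openBox x₀ x₁ y₀ y₁) : ∀ᶠ i in atTop, z ∈ innerBox x₀ x₁ y₀ y₁ i := by
  simp only [Set.mem_prod, Set.mem_Ioo] at hz
  have h := tendsto_one_div_add_atTop_nhds_zero_nat (𝕜 := ℝ)
  filter_upwards [h.eventually_lt_const (sub_pos.2 hz.1.1), h.eventually_lt_const
    (sub_pos.2 hz.1.2), h.eventually_lt_const (sub_pos.2 hz.2.1),
    h.eventually_lt_const (sub_pos.2 hz.2.2)] with i h1 h2 h3 h4
  simp only [Set.mem_prod, Set.mem_Icc]
  refine ⟨⟨?_, ?_⟩, ?_, ?_⟩ <;> linarith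

/-- Smooth approximation of a Sobolev function on an open box. -/
theorem exists_smooth_approx {x₀ x₁ y₀ y₁ : ℝ} {u ux uy : ℝ × ℝ → ℂ}
    (hu : MemLp u 2 (volume.restrict (openBox x₀ x₁ y₀ y₁)))
    (hux : MemLp ux 2 (volume.restrict (openBox x₀ x₁ y₀ y₁)))
    (huy : MemLp uy 2 (volume.restrict (openBox x₀ x₁ y₀ y₁)))
    (hdx : IsWeakDeriv (openBox x₀ x₁ y₀ y₁) (1, 0) u ux)
    (hdy : IsWeakDeriv (openBox x₀ x₁ y₀ y₁) (0, 1) u uy) :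
    ∃ w : ℕ → ℝ × ℝ → ℂ, (∀ i, ContDiff ℝ 1 (w i)) ∧
      (∀ᵐ z ∂volume.restrict (openBox x₀ x₁ y₀ y₁), Tendsto (fun i => w i z) atTop (𝓝 (u z))) ∧
      ∀ i, ∫⁻ z in innerBox x₀ x₁ y₀ y₁ i, ‖w i z‖ₑ ^ 2
          ≤ ∫⁻ z in openBox x₀ x₁ y₀ y₁, ‖u z‖ₑ ^ 2 ∧
        ∫⁻ z in innerBox x₀ x₁ y₀ y₁ i, ‖fderiv ℝ (w i) z (1, 0)‖ₑ ^ 2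
          ≤ ∫⁻ z in openBox x₀ x₁ y₀ y₁, ‖ux z‖ₑ ^ 2 ∧
        ∫⁻ z in innerBox x₀ x₁ y₀ y₁ i, ‖fderiv ℝ (w i) z (0, 1)‖ₑ ^ 2
          ≤ ∫⁻ z in openBox x₀ x₁ y₀ y₁, ‖uy z‖ₑ ^ 2 := by
  set Ω := openBox x₀ x₁ y₀ y₁
  have hΩ : MeasurableSet Ω := measurableSet_openBox _ _ _ _
  have hloc : LocallyIntegrable (Ω.indicator u) volume :=
    ((memLp_indicator_iff_restrict hΩ).2 hu).locallyIntegrable (by norm_num)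
  have bound : ∀ i {f : ℝ × ℝ → ℂ}, MemLp f 2 (volume.restrict Ω) →
      ∫⁻ z in innerBox x₀ x₁ y₀ y₁ i, ‖mollify i (Ω.indicator f) z‖ₑ ^ 2
        ≤ ∫⁻ z in Ω, ‖f z‖ₑ ^ 2 := by
    intro i f hf
    refine (setLIntegral_le_lintegral _ _).trans ?_
    refine (lintegral_mollify_sq_le i
      ((memLp_indicator_iff_restrict hΩ).2 hf).aestronglyMeasurable).trans (le_of_eq ?_)
    rw [← lintegral_indicator hΩ]
    refine lintegral_congr fun z => ?_
    by_cases hz : z ∈ Ω <;> simp [hz]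
  have hR : ∀ i, MeasurableSet (innerBox x₀ x₁ y₀ y₁ i) := fun i => measurableSet_closedBox _ _ _ _
  refine ⟨fun i => mollify i (Ω.indicator u), fun i => contDiff_mollify i hloc, ?_, fun i =>
    ⟨bound i hu, ?_, ?_⟩⟩
  · filter_upwards [ae_restrict_of_ae (ae_tendsto_mollify hloc), ae_restrict_mem hΩ] with z hz hm
    simpa [hm] using hz
  · refine le_trans (le_of_eq ?_) (bound i hux)
    refine setLIntegral_congr_fun (hR i) fun z hz => ?_
    simp only
    rw [fderiv_mollify hΩ hloc hdx (closedBall_subset_of_mem_innerBox hz)]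
  · refine le_trans (le_of_eq ?_) (bound i huy)
    refine setLIntegral_congr_fun (hR i) fun z hz => ?_
    simp only
    rw [fderiv_mollify hΩ hloc hdy (closedBall_subset_of_mem_innerBox hz)]

end

noncomputable section

/-! ### Inequalities for Sobolev functions on rectangles -/

/-- Fatou's lemma in the form that carries inequalities from mollifications to Sobolev functions; no
convergence of the gradients is needed, only the bounds on them. -/
theorem lintegral_le_of_ae_tendsto {α : Type*} [MeasurableSpace α] {μ : Measure α}
    {f : ℕ → α → ℝ≥0∞} {g : α → ℝ≥0∞} {C : ℝ≥0∞} (hf : ∀ i, AEMeasurable (f i) μ)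
    (h : ∀ᵐ z ∂μ, Tendsto (fun i => f i z) atTop (𝓝 (g z)))
    (hC : ∀ᶠ i in atTop, ∫⁻ z, f i z ∂μ ≤ C) : ∫⁻ z, g z ∂μ ≤ C := by
  calc ∫⁻ z, g z ∂μ = ∫⁻ z, liminf (fun i => f i z) atTop ∂μ := by
        refine lintegral_congr_ae ?_
        filter_upwards [h] with z hz
        exact hz.liminf_eq.symm
    _ ≤ liminf (fun i => ∫⁻ z, f i z ∂μ) atTop := lintegral_liminf_le' hf
    _ ≤ C := by
        refine liminf_le_of_le (by isBoundedDefault) fun b hb => ?_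
        obtain ⟨i, h1, h2⟩ := (hb.and hC).exists
        exact h1.trans h2

/-- The inequality for smooth functions is applied on the inner boxes. The strict inequalities on
the sides leave room for these to have sides at least `h` eventually. -/
theorem gagliardoNirenberg_openBox {x₀ x₁ y₀ y₁ h : ℝ} {u ux uy : ℝ × ℝ → ℂ}
    (hu : MemLp u 2 (volume.restrict (openBox x₀ x₁ y₀ y₁)))
    (hux : MemLp ux 2 (volume.restrict (openBox x₀ x₁ y₀ y₁)))
    (huy : MemLp uy 2 (volume.restrict (openBox x₀ x₁ y₀ y₁)))
    (hdx : IsWeakDeriv (openBox x₀ x₁ y₀ y₁) (1, 0) u ux)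
    (hdy : IsWeakDeriv (openBox x₀ x₁ y₀ y₁) (0, 1) u uy)
    (hh : 0 < h) (hx : x₀ + h < x₁) (hy : y₀ + h < y₁) (n : ℕ) :
    ∫⁻ z in openBox x₀ x₁ y₀ y₁, ‖u z‖ₑ ^ (2 * (n + 1)) ≤ gnConst h n *
      (∫⁻ z in openBox x₀ x₁ y₀ y₁, ‖u z‖ₑ ^ 2) *
      ((∫⁻ z in openBox x₀ x₁ y₀ y₁, ‖u z‖ₑ ^ 2) + (∫⁻ z in openBox x₀ x₁ y₀ y₁, ‖ux z‖ₑ ^ 2)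
        + ∫⁻ z in openBox x₀ x₁ y₀ y₁, ‖uy z‖ₑ ^ 2) ^ n := by
  obtain ⟨w, hw, hlim, hb⟩ := exists_smooth_approx hu hux huy hdx hdy
  have hR : ∀ i, MeasurableSet (innerBox x₀ x₁ y₀ y₁ i) := fun i => measurableSet_closedBox _ _ _ _
  refine lintegral_le_of_ae_tendsto (f := fun i =>
    (innerBox x₀ x₁ y₀ y₁ i).indicator fun z => ‖w i z‖ₑ ^ (2 * (n + 1))) ?_ ?_ ?_
  · intro i
    exact (((hw i).continuous.enorm.measurable.pow_const _).indicator (hR i)).aemeasurable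
  · filter_upwards [hlim, ae_restrict_mem (measurableSet_openBox _ _ _ _)] with z hz hm
    refine (((ENNReal.continuous_pow _).tendsto _).comp hz.enorm).congr' ?_
    filter_upwards [eventually_mem_innerBox hm] with i hi
    simp only [Function.comp]
    rw [Set.indicator_of_mem hi]
  · have h0 := tendsto_one_div_add_atTop_nhds_zero_nat (𝕜 := ℝ)
    filter_upwards [h0.eventually_lt_const (half_pos (sub_pos.2 hx)),
      h0.eventually_lt_const (half_pos (sub_pos.2 hy))] with i h1 h2
    rw [lintegral_indicator (hR i), Measure.restrict_restrict_of_subset (innerBox_subset _ _ _ _ _)]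
    refine (gagliardoNirenberg_smooth (hw i) hh (by linarith) (by linarith) n).trans ?_
    obtain ⟨b0, b1, b2⟩ := hb i
    have m0 : Measurable fun z => ‖w i z‖ₑ ^ 2 := (hw i).continuous.enorm.measurable.pow_const 2
    have m1 := (measurable_fderiv_apply_enorm (hw i) (1, 0)).pow_const 2
    rw [lintegral_add_left (f := fun z => ‖w i z‖ₑ ^ 2 + ‖fderiv ℝ (w i) z (1, 0)‖ₑ ^ 2)
      (m0.add m1), lintegral_add_left m0]
    gcongr

/-- Fatou's lemma is used on the product of the box with itself. The difference form of the
inequality avoids having to pass to the limit in averages. -/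
theorem poincare_openBox {x₀ x₁ y₀ y₁ h : ℝ} {u ux uy : ℝ × ℝ → ℂ}
    (hu : MemLp u 2 (volume.restrict (openBox x₀ x₁ y₀ y₁)))
    (hux : MemLp ux 2 (volume.restrict (openBox x₀ x₁ y₀ y₁)))
    (huy : MemLp uy 2 (volume.restrict (openBox x₀ x₁ y₀ y₁)))
    (hdx : IsWeakDeriv (openBox x₀ x₁ y₀ y₁) (1, 0) u ux)
    (hdy : IsWeakDeriv (openBox x₀ x₁ y₀ y₁) (0, 1) u uy)
    (hx : x₁ - x₀ ≤ h) (hy : y₁ - y₀ ≤ h) :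
    ∫⁻ z in openBox x₀ x₁ y₀ y₁, ∫⁻ w in openBox x₀ x₁ y₀ y₁, ‖u z - u w‖ₑ ^ 2 ≤
      2 * ENNReal.ofReal h ^ 2 * volume (openBox x₀ x₁ y₀ y₁) *
      ((∫⁻ z in openBox x₀ x₁ y₀ y₁, ‖ux z‖ₑ ^ 2)
        + ∫⁻ z in openBox x₀ x₁ y₀ y₁, ‖uy z‖ₑ ^ 2) := by
  obtain ⟨w, hw, hlim, hb⟩ := exists_smooth_approx hu hux huy hdx hdy
  have hR : ∀ i, MeasurableSet (innerBox x₀ x₁ y₀ y₁ i) := fun i => measurableSet_closedBox _ _ _ _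
  set Ω := openBox x₀ x₁ y₀ y₁
  set R := innerBox x₀ x₁ y₀ y₁
  set D : ℕ → (ℝ × ℝ) × (ℝ × ℝ) → ℝ≥0∞ := fun i =>
    (R i ×ˢ R i).indicator fun q => ‖w i q.1 - w i q.2‖ₑ ^ 2
  have mD : ∀ i, Measurable (D i) := by
    intro i
    have hc := (hw i).continuous
    refine Measurable.indicator ?_ ((hR i).prod (hR i))
    exact ((hc.comp continuous_fst).sub (hc.comp continuous_snd)).enorm.measurable.pow_const 2
  have hD : ∀ᵐ q ∂(volume.restrict Ω).prod (volume.restrict Ω),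
      Tendsto (fun i => D i q) atTop (𝓝 (‖u q.1 - u q.2‖ₑ ^ 2)) := by
    have hm := ae_restrict_mem (μ := volume) (measurableSet_openBox x₀ x₁ y₀ y₁)
    filter_upwards [Measure.quasiMeasurePreserving_fst.ae hlim,
      Measure.quasiMeasurePreserving_snd.ae hlim, Measure.quasiMeasurePreserving_fst.ae hm,
      Measure.quasiMeasurePreserving_snd.ae hm] with q h1 h2 h3 h4
    refine (((ENNReal.continuous_pow _).tendsto _).comp (h1.sub h2).enorm).congr' ?_
    filter_upwards [eventually_mem_innerBox h3, eventually_mem_innerBox h4] with i h5 h6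
    simp only [D, Function.comp]
    rw [Set.indicator_of_mem]
    exact ⟨h5, h6⟩
  have hum : AEMeasurable (fun q : (ℝ × ℝ) × (ℝ × ℝ) => ‖u q.1 - u q.2‖ₑ ^ 2)
      ((volume.restrict Ω).prod (volume.restrict Ω)) :=
    ((hu.aestronglyMeasurable.comp_fst.sub hu.aestronglyMeasurable.comp_snd).enorm.pow_const 2)
  rw [← lintegral_prod _ hum]
  refine lintegral_le_of_ae_tendsto (fun i => (mD i).aemeasurable) hD
    (Eventually.of_forall fun i => ?_)
  have hsub : R i ⊆ Ω := innerBox_subset _ _ _ _ _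
  have hpos : (0 : ℝ) < 1 / (i + 1) := by positivity
  have hp := poincare_smooth (hw i) (x₀ := x₀ + 1 / (i + 1)) (x₁ := x₁ - 1 / (i + 1))
    (y₀ := y₀ + 1 / (i + 1)) (y₁ := y₁ - 1 / (i + 1)) (h := h) (by linarith) (by linarith)
  calc ∫⁻ q, D i q ∂(volume.restrict Ω).prod (volume.restrict Ω)
      = ∫⁻ z in R i, ∫⁻ v in R i, ‖w i z - w i v‖ₑ ^ 2 := by
        rw [lintegral_indicator ((hR i).prod (hR i)), ← Measure.prod_restrict,
          Measure.restrict_restrict_of_subset hsub, lintegral_prod]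
        have hc := (hw i).continuous
        exact (((hc.comp continuous_fst).sub
          (hc.comp continuous_snd)).enorm.measurable.pow_const 2).aemeasurable
    _ ≤ _ := hp
    _ ≤ _ := by
        obtain ⟨b0, b1, b2⟩ := hb i
        rw [lintegral_add_left ((measurable_fderiv_apply_enorm (hw i) (1, 0)).pow_const 2)]
        gcongr

theorem volume_openBox (x₀ x₁ y₀ y₁ : ℝ) :
    volume (openBox x₀ x₁ y₀ y₁) = ENNReal.ofReal (x₁ - x₀) * ENNReal.ofReal (y₁ - y₀) := by
  rw [Measure.volume_eq_prod, Measure.prod_prod, Real.volume_Ioo, Real.volume_Ioo]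

/-- The Poincaré inequality: the mass is controlled by the gradient and the average. -/
theorem lintegral_sq_le_grad_add_average {x₀ x₁ y₀ y₁ h : ℝ} {u ux uy : ℝ × ℝ → ℂ}
    (hu : MemLp u 2 (volume.restrict (openBox x₀ x₁ y₀ y₁)))
    (hux : MemLp ux 2 (volume.restrict (openBox x₀ x₁ y₀ y₁)))
    (huy : MemLp uy 2 (volume.restrict (openBox x₀ x₁ y₀ y₁)))
    (hdx : IsWeakDeriv (openBox x₀ x₁ y₀ y₁) (1, 0) u ux)
    (hdy : IsWeakDeriv (openBox x₀ x₁ y₀ y₁) (0, 1) u uy)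
    (hx : x₁ - x₀ ≤ h) (hy : y₁ - y₀ ≤ h) (hx0 : x₀ < x₁) (hy0 : y₀ < y₁) :
    ∫⁻ z in openBox x₀ x₁ y₀ y₁, ‖u z‖ₑ ^ 2 ≤
      4 * ENNReal.ofReal h ^ 2 * ((∫⁻ z in openBox x₀ x₁ y₀ y₁, ‖ux z‖ₑ ^ 2)
        + ∫⁻ z in openBox x₀ x₁ y₀ y₁, ‖uy z‖ₑ ^ 2) +
      2 * (volume (openBox x₀ x₁ y₀ y₁))⁻¹ * ‖∫ z in openBox x₀ x₁ y₀ y₁, u z‖ₑ ^ 2 := by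
  have hP := poincare_openBox hu hux huy hdx hdy hx hy
  have hV := volume_openBox x₀ x₁ y₀ y₁
  have hΩ := measurableSet_openBox x₀ x₁ y₀ y₁
  set Ω := openBox x₀ x₁ y₀ y₁
  set V := volume Ω with hVdef
  have hV0 : V ≠ 0 := by
    rw [hV]; simp [hx0, hy0]
  have hVt : V ≠ ⊤ := by
    rw [hV]; exact ENNReal.mul_ne_top (by simp) (by simp)
  have : IsFiniteMeasure (volume.restrict Ω) := ⟨by simpa using hVt.lt_top⟩
  have hui : Integrable u (volume.restrict Ω) := hu.integrable (by norm_num)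
  set E := (∫⁻ z in Ω, ‖ux z‖ₑ ^ 2) + ∫⁻ z in Ω, ‖uy z‖ₑ ^ 2
  set A := ∫ z in Ω, u z
  have hpt : ∀ z, V ^ 2 * ‖u z‖ₑ ^ 2 ≤
      2 * V * (∫⁻ w in Ω, ‖u z - u w‖ₑ ^ 2) + 2 * ‖A‖ₑ ^ 2 := by
    intro z
    -- The value of `u` at `z` is its average plus the average of the differences; the latter are
    -- what the Poincaré inequality controls.
    have e : (V.toReal : ℂ) * u z = (∫ w in Ω, (u z - u w)) + A := by
      rw [integral_sub (integrable_const _) hui]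
      simp [A, V, Measure.real]
    have e2 : V * ‖u z‖ₑ = ‖(∫ w in Ω, (u z - u w)) + A‖ₑ := by
      rw [← e, enorm_mul]
      congr 1
      rw [← ofReal_norm]
      simp [ENNReal.ofReal_toReal hVt]
    rw [← mul_pow, e2]
    calc _ ≤ (‖∫ w in Ω, (u z - u w)‖ₑ + ‖A‖ₑ) ^ 2 := by gcongr; exact enorm_add_le _ _
      _ ≤ 2 * (‖∫ w in Ω, (u z - u w)‖ₑ ^ 2 + ‖A‖ₑ ^ 2) := ennreal_add_sq_le _ _
      _ ≤ 2 * (V * (∫⁻ w in Ω, ‖u z - u w‖ₑ ^ 2) + ‖A‖ₑ ^ 2) := by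
        gcongr
        calc _ ≤ (∫⁻ w in Ω, ‖u z - u w‖ₑ) ^ 2 := by
              gcongr; exact enorm_integral_le_lintegral_enorm _
          _ ≤ _ := sq_lintegral_le_measure_mul
            (aestronglyMeasurable_const.sub hu.aestronglyMeasurable).enorm
          _ = _ := by rw [Measure.restrict_apply_univ]
      _ = _ := by ring
  have hint : V ^ 2 * (∫⁻ z in Ω, ‖u z‖ₑ ^ 2) ≤
      V ^ 2 * (4 * ENNReal.ofReal h ^ 2 * E + 2 * V⁻¹ * ‖A‖ₑ ^ 2) := by
    calc V ^ 2 * (∫⁻ z in Ω, ‖u z‖ₑ ^ 2)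
        = ∫⁻ z in Ω, V ^ 2 * ‖u z‖ₑ ^ 2 :=
          (lintegral_const_mul' _ _ (ENNReal.pow_ne_top hVt)).symm
      _ ≤ ∫⁻ z in Ω, (2 * V * (∫⁻ w in Ω, ‖u z - u w‖ₑ ^ 2) + 2 * ‖A‖ₑ ^ 2) :=
          lintegral_mono hpt
      _ = 2 * V * (∫⁻ z in Ω, ∫⁻ w in Ω, ‖u z - u w‖ₑ ^ 2) + 2 * ‖A‖ₑ ^ 2 * V := by
          rw [lintegral_add_right _ measurable_const,
            lintegral_const_mul' _ _ (ENNReal.mul_ne_top (by simp) hVt), lintegral_const,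
            Measure.restrict_apply_univ]
      _ ≤ 2 * V * (2 * ENNReal.ofReal h ^ 2 * V * E) + 2 * ‖A‖ₑ ^ 2 * V := by gcongr
      _ = V ^ 2 * (4 * ENNReal.ofReal h ^ 2 * E) + V * (V * V⁻¹) * (2 * ‖A‖ₑ ^ 2) := by
          rw [ENNReal.mul_inv_cancel hV0 hVt]
          ring
      _ = _ := by ring
  exact (ENNReal.mul_le_mul_iff_right (pow_ne_zero 2 hV0) (ENNReal.pow_ne_top hVt)).1 hint

/-! ### Segments and rectangles -/

theorem measurableSet_openSeg (a : ℝ≥0∞) : MeasurableSet (openSeg a) :=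
  measurableSet_Ioi.inter (ENNReal.measurable_ofReal measurableSet_Iio)

theorem isOpen_openSeg (a : ℝ≥0∞) : IsOpen (openSeg a) :=
  isOpen_Ioi.inter (isOpen_Iio.preimage ENNReal.continuous_ofReal)

theorem measurableSet_openRect (a b : ℝ≥0∞) : MeasurableSet (openRect a b) :=
  (measurableSet_openSeg a).prod (measurableSet_openSeg b)

theorem isOpen_openRect (a b : ℝ≥0∞) : IsOpen (openRect a b) :=
  (isOpen_openSeg a).prod (isOpen_openSeg b)

theorem openSeg_ofReal (x : ℝ) : openSeg (ENNReal.ofReal x) = Set.Ioo 0 x := by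
  ext t
  simp only [openSeg, Set.mem_ofPred_eq, Set.mem_Ioo]
  constructor
  · rintro ⟨h1, h2⟩
    exact ⟨h1, (ENNReal.ofReal_lt_ofReal_iff_of_nonneg h1.le).1 h2⟩
  · rintro ⟨h1, h2⟩
    exact ⟨h1, (ENNReal.ofReal_lt_ofReal_iff_of_nonneg h1.le).2 h2⟩

theorem openSeg_of_ne_top {a : ℝ≥0∞} (ha : a ≠ ⊤) : openSeg a = Set.Ioo 0 a.toReal := by
  rw [← openSeg_ofReal, ENNReal.ofReal_toReal ha]

theorem openSeg_mono {a a' : ℝ≥0∞} (h : a ≤ a') : openSeg a ⊆ openSeg a' :=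
  fun _ ht => ⟨ht.1, ht.2.trans_le h⟩

theorem openRect_mono {a a' b b' : ℝ≥0∞} (h : a ≤ a') (h' : b ≤ b') :
    openRect a b ⊆ openRect a' b' :=
  Set.prod_mono (openSeg_mono h) (openSeg_mono h')

theorem openRect_of_ne_top {a b : ℝ≥0∞} (ha : a ≠ ⊤) (hb : b ≠ ⊤) :
    openRect a b = openBox 0 a.toReal 0 b.toReal := by
  rw [openRect, openSeg_of_ne_top ha, openSeg_of_ne_top hb]

/-- The rectangles `(0, min a i) × (0, min b i)` exhaust `(0, a) × (0, b)`. -/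
theorem iUnion_openRect_min (a b : ℝ≥0∞) :
    ⋃ i : ℕ, openRect (min a i) (min b i) = openRect a b := by
  refine Set.Subset.antisymm (Set.iUnion_subset fun i =>
    openRect_mono (min_le_left _ _) (min_le_left _ _)) ?_
  rintro ⟨x, y⟩ ⟨hx, hy⟩
  obtain ⟨i, hi⟩ := exists_nat_gt (max x y)
  refine Set.mem_iUnion.2 ⟨i, ⟨hx.1, lt_min hx.2 ?_⟩, ⟨hy.1, lt_min hy.2 ?_⟩⟩
  · rw [← ENNReal.ofReal_natCast]
    exact (ENNReal.ofReal_lt_ofReal_iff_of_nonneg hx.1.le).2 ((le_max_left _ _).trans_lt hi)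
  · rw [← ENNReal.ofReal_natCast]
    exact (ENNReal.ofReal_lt_ofReal_iff_of_nonneg hy.1.le).2 ((le_max_right _ _).trans_lt hi)

theorem monotone_openRect_min (a b : ℝ≥0∞) :
    Monotone fun i : ℕ => openRect (min a i) (min b i) := fun _ _ hij =>
  openRect_mono (min_le_min_left _ (by exact_mod_cast hij))
    (min_le_min_left _ (by exact_mod_cast hij))

theorem IsWeakDeriv.mono {Ω Ω' : Set (ℝ × ℝ)} {e : ℝ × ℝ} {u v : ℝ × ℝ → ℂ}
    (h : IsWeakDeriv Ω e u v) (hΩ : MeasurableSet Ω) (hs : Ω' ⊆ Ω) :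
    IsWeakDeriv Ω' e u v := by
  intro φ h1 h2 h3
  have h4 := h φ h1 h2 (h3.trans hs)
  rw [setIntegral_eq_of_subset_of_forall_sdiff_eq_zero hΩ hs,
    setIntegral_eq_of_subset_of_forall_sdiff_eq_zero hΩ hs] at h4
  · exact h4
  · intro z hz
    rw [image_eq_zero_of_notMem_tsupport fun hz' => hz.2 (h3 hz'), zero_smul]
  · intro z hz
    rw [fderiv_of_notMem_tsupport (𝕜 := ℝ) fun hz' => hz.2 (h3 hz')]
    simp

/-- The Gagliardo-Nirenberg inequality on a page. -/
theorem gagliardoNirenberg_openRect {a b : ℝ≥0∞} {h : ℝ} {u ux uy : ℝ × ℝ → ℂ}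
    (hu : MemLp u 2 (volume.restrict (openRect a b)))
    (hux : MemLp ux 2 (volume.restrict (openRect a b)))
    (huy : MemLp uy 2 (volume.restrict (openRect a b)))
    (hdx : IsWeakDeriv (openRect a b) (1, 0) u ux)
    (hdy : IsWeakDeriv (openRect a b) (0, 1) u uy)
    (hh : 0 < h) (ha : ENNReal.ofReal h < a) (hb : ENNReal.ofReal h < b) (n : ℕ) :
    ∫⁻ z in openRect a b, ‖u z‖ₑ ^ (2 * (n + 1)) ≤ gnConst h n *
      (∫⁻ z in openRect a b, ‖u z‖ₑ ^ 2) *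
      ((∫⁻ z in openRect a b, ‖u z‖ₑ ^ 2) + (∫⁻ z in openRect a b, ‖ux z‖ₑ ^ 2)
        + ∫⁻ z in openRect a b, ‖uy z‖ₑ ^ 2) ^ n := by
  conv_lhs => rw [← iUnion_openRect_min a b]
  rw [setLIntegral_iUnion_of_directed _ (monotone_openRect_min a b).directed_le]
  obtain ⟨N, hN⟩ := exists_nat_gt h
  refine iSup_le fun i => ?_
  refine (lintegral_mono_set (monotone_openRect_min a b (le_max_left i N))).trans ?_
  set j := max i N
  have hj : ENNReal.ofReal h < j := by
    rw [← ENNReal.ofReal_natCast]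
    refine (ENNReal.ofReal_lt_ofReal_iff_of_nonneg hh.le).2 (hN.trans_le ?_)
    exact_mod_cast le_max_right i N
  have hta : min a j ≠ ⊤ := ((min_le_right a j).trans_lt (ENNReal.natCast_lt_top j)).ne
  have htb : min b j ≠ ⊤ := ((min_le_right b j).trans_lt (ENNReal.natCast_lt_top j)).ne
  have hs : openRect (min a j) (min b j) ⊆ openRect a b :=
    openRect_mono (min_le_left _ _) (min_le_left _ _)
  have hr := Measure.restrict_mono_set (volume : Measure (ℝ × ℝ)) hs
  have e := openRect_of_ne_top hta htb
  have hla : 0 + h < (min a j).toReal := by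
    rw [zero_add]
    exact (ENNReal.ofReal_lt_iff_lt_toReal hh.le hta).1 (lt_min ha hj)
  have hlb : 0 + h < (min b j).toReal := by
    rw [zero_add]
    exact (ENNReal.ofReal_lt_iff_lt_toReal hh.le htb).1 (lt_min hb hj)
  have := gagliardoNirenberg_openBox (e ▸ hu.mono_measure hr) (e ▸ hux.mono_measure hr)
    (e ▸ huy.mono_measure hr) (e ▸ hdx.mono (measurableSet_openRect a b) hs)
    (e ▸ hdy.mono (measurableSet_openRect a b) hs) hh hla hlb n
  rw [← e] at this
  refine this.trans ?_
  gcongr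

end

noncomputable section

/-! ### The measure of a book and the components of an `H¹` function -/

theorem measurableEmbedding_mk {α β : Type*} [MeasurableSpace α] [DiscreteMeasurableSpace α]
    [MeasurableSpace β] (k : α) : MeasurableEmbedding (Prod.mk k : β → α × β) :=
  measurableEmbedding_prodMk_left k

namespace OpenBook

/-- With all sets of pages measurable, a function on the book is measurable precisely when each
component is, and the whole book becomes a single measure space with an honest `L²`. -/
instance (L : OpenBook) : MeasurableSpace L.Page := ⊤

instance (L : OpenBook) : DiscreteMeasurableSpace L.Page := ⟨fun _ => trivial⟩

instance (L : OpenBook) : Countable L.Page := L.countable_page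

/-- The area measure of the book, on the disjoint union of the pages. -/
def mu (L : OpenBook) : Measure (L.Page × (ℝ × ℝ)) :=
  Measure.sum fun k => (volume.restrict (L.rect k)).map (Prod.mk k)

variable {L : OpenBook}

theorem measurableSet_rect (k : L.Page) : MeasurableSet (L.rect k) := measurableSet_openRect _ _

theorem lintegral_mu (f : L.Page × (ℝ × ℝ) → ℝ≥0∞) :
    ∫⁻ x, f x ∂L.mu = ∑' k, ∫⁻ z in L.rect k, f (k, z) := by
  rw [mu, lintegral_sum_measure]
  exact tsum_congr fun k => (measurableEmbedding_mk k).lintegral_map _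

theorem ae_mu_iff {P : L.Page × (ℝ × ℝ) → Prop} :
    (∀ᵐ x ∂L.mu, P x) ↔ ∀ k, ∀ᵐ z ∂volume.restrict (L.rect k), P (k, z) := by
  rw [mu, Measure.ae_sum_iff]
  exact forall_congr' fun k => (measurableEmbedding_mk k).ae_map_iff

theorem integral_mu {f : L.Page × (ℝ × ℝ) → ℂ} (hf : Integrable f L.mu) :
    ∫ x, f x ∂L.mu = ∑' k, ∫ z in L.rect k, f (k, z) := by
  unfold mu at hf ⊢
  rw [integral_sum_measure hf]
  exact tsum_congr fun k => (measurableEmbedding_mk k).integral_map _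

theorem aestronglyMeasurable_mu_iff {f : L.Page × (ℝ × ℝ) → ℂ} :
    AEStronglyMeasurable f L.mu ↔
      ∀ k, AEStronglyMeasurable (fun z => f (k, z)) (volume.restrict (L.rect k)) := by
  rw [mu, aestronglyMeasurable_sum_measure_iff]
  exact forall_congr' fun k => (measurableEmbedding_mk k).aestronglyMeasurable_map_iff

theorem lpPow_eq (q : ℝ) (u : L.Page → ℝ × ℝ → ℂ) :
    L.lpPow q u = ∫⁻ x, ‖u x.1 x.2‖ₑ ^ q ∂L.mu := by
  rw [lintegral_mu]; rfl

end OpenBook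

theorem eLpNorm_two_sq {α : Type*} [MeasurableSpace α] {μ : Measure α} (f : α → ℂ) :
    eLpNorm f 2 μ ^ 2 = ∫⁻ x, ‖f x‖ₑ ^ (2 : ℝ) ∂μ := by
  rw [eLpNorm_eq_lintegral_rpow_enorm_toReal (by norm_num) (by norm_num)]
  rw [← ENNReal.rpow_natCast, ← ENNReal.rpow_mul]
  norm_num

theorem memLp_two_iff {α : Type*} [MeasurableSpace α] {μ : Measure α} {f : α → ℂ} :
    MemLp f 2 μ ↔ AEStronglyMeasurable f μ ∧ ∫⁻ x, ‖f x‖ₑ ^ (2 : ℝ) ∂μ < ⊤ := by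
  rw [MemLp, ← eLpNorm_two_sq]
  simp

theorem norm_toLp_two_sq {α : Type*} [MeasurableSpace α] {μ : Measure α} {f : α → ℂ}
    (hf : MemLp f 2 μ) : ‖hf.toLp f‖ ^ 2 = (∫⁻ x, ‖f x‖ₑ ^ (2 : ℝ) ∂μ).toReal := by
  rw [Lp.norm_toLp, ← eLpNorm_two_sq, ENNReal.toReal_pow]

namespace OpenBook

variable {L : OpenBook}

theorem memLp_mu_iff {f : L.Page → ℝ × ℝ → ℂ} :
    MemLp (fun x : L.Page × (ℝ × ℝ) => f x.1 x.2) 2 L.mu ↔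
      (∀ k, MemLp (f k) 2 (volume.restrict (L.rect k))) ∧ L.lpPow 2 f < ⊤ := by
  rw [memLp_two_iff, aestronglyMeasurable_mu_iff, lpPow_eq]
  constructor
  · rintro ⟨h1, h2⟩
    refine ⟨fun k => memLp_two_iff.2 ⟨h1 k, lt_of_le_of_lt ?_ h2⟩, h2⟩
    rw [lintegral_mu]
    exact ENNReal.le_tsum k
  · rintro ⟨h1, h2⟩
    exact ⟨fun k => (h1 k).aestronglyMeasurable, h2⟩

/-- The components `u`, `∂ₓu`, `∂ᵧu` of an `H¹` function. -/
def H1.part (u : L.H1) : Fin 3 → L.Page → ℝ × ℝ → ℂ := ![u.toFun, u.dx, u.dy]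

theorem H1.memLp_part (u : L.H1) (i : Fin 3) :
    MemLp (fun x : L.Page × (ℝ × ℝ) => u.part i x.1 x.2) 2 L.mu := by
  rw [memLp_mu_iff]
  fin_cases i
  · exact ⟨u.memLp, u.lpPow_lt⟩
  · exact ⟨u.memLp_dx, u.lpPow_dx_lt⟩
  · exact ⟨u.memLp_dy, u.lpPow_dy_lt⟩

/-- The components of an `H¹` function as elements of `L²`. -/
def H1.comp (u : L.H1) (i : Fin 3) : Lp ℂ 2 L.mu := (u.memLp_part i).toLp _

theorem H1.coeFn_comp (u : L.H1) (i : Fin 3) : u.comp i =ᵐ[L.mu] fun x => u.part i x.1 x.2 :=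
  (u.memLp_part i).coeFn_toLp

theorem H1.coeFn_comp_page (u : L.H1) (i : Fin 3) (k : L.Page) :
    (fun z => u.comp i (k, z)) =ᵐ[volume.restrict (L.rect k)] u.part i k :=
  ae_mu_iff.1 (u.coeFn_comp i) k

theorem H1.norm_comp_sq (u : L.H1) (i : Fin 3) :
    ‖u.comp i‖ ^ 2 = (L.lpPow 2 (u.part i)).toReal := by
  rw [H1.comp, norm_toLp_two_sq, lpPow_eq]

theorem massSq_eq (u : L.H1) : massSq u = ‖u.comp 0‖ ^ 2 := by
  rw [H1.norm_comp_sq]; rfl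

theorem gradSq_eq (u : L.H1) : gradSq u = ‖u.comp 1‖ ^ 2 + ‖u.comp 2‖ ^ 2 := by
  rw [H1.norm_comp_sq, H1.norm_comp_sq, gradSq,
    ENNReal.toReal_add u.lpPow_dx_lt.ne u.lpPow_dy_lt.ne]
  rfl

theorem lpPow_comp (q : ℝ) (u : L.H1) :
    L.lpPow q u.toFun = ∫⁻ x, ‖u.comp 0 x‖ₑ ^ q ∂L.mu := by
  rw [lpPow_eq]
  refine lintegral_congr_ae ?_
  filter_upwards [u.coeFn_comp 0] with x hx
  rw [hx]
  rfl

theorem nontriv_iff (u : L.H1) : Nontriv u ↔ u.comp 0 ≠ 0 := by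
  rw [Nontriv, not_iff_not, lpPow_eq, lintegral_eq_zero_iff']
  · rw [Lp.eq_zero_iff_ae_eq_zero]
    constructor
    · intro h
      filter_upwards [h, u.coeFn_comp 0] with x hx hx'
      rw [hx']
      simpa [H1.part] using hx
    · intro h
      filter_upwards [h, u.coeFn_comp 0] with x hx hx'
      rw [hx'] at hx
      simpa [H1.part] using hx
  · exact (u.memLp_part 0).aestronglyMeasurable.enorm.pow_const _

/-- An `H¹` function from its components. -/
def H1.ofParts (f : Fin 3 → L.Page → ℝ × ℝ → ℂ)
    (hf : ∀ i, MemLp (fun x : L.Page × (ℝ × ℝ) => f i x.1 x.2) 2 L.mu)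
    (hx : ∀ k, IsWeakDeriv (L.rect k) (1, 0) (f 0 k) (f 1 k))
    (hy : ∀ k, IsWeakDeriv (L.rect k) (0, 1) (f 0 k) (f 2 k)) : L.H1 where
  toFun := f 0
  dx := f 1
  dy := f 2
  memLp := (memLp_mu_iff.1 (hf 0)).1
  memLp_dx := (memLp_mu_iff.1 (hf 1)).1
  memLp_dy := (memLp_mu_iff.1 (hf 2)).1
  weak_dx := hx
  weak_dy := hy
  lpPow_lt := (memLp_mu_iff.1 (hf 0)).2
  lpPow_dx_lt := (memLp_mu_iff.1 (hf 1)).2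
  lpPow_dy_lt := (memLp_mu_iff.1 (hf 2)).2

theorem H1.part_ofParts (f : Fin 3 → L.Page → ℝ × ℝ → ℂ) (hf hx hy) :
    (H1.ofParts f hf hx hy).part = f := by
  funext i
  fin_cases i <;> rfl

end OpenBook

/-! ### Linear combinations and pairings of Sobolev functions -/

theorem MemLp.integrable_smul_of_memLp {μ : Measure (ℝ × ℝ)} {φ : ℝ × ℝ → ℝ} {u : ℝ × ℝ → ℂ}
    (hφ : MemLp φ 2 μ) (hu : MemLp u 2 μ) : Integrable (fun z => φ z • u z) μ :=
  memLp_one_iff_integrable.1 (hu.smul (r := 1) hφ)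

theorem memLp_of_contDiff {φ : ℝ × ℝ → ℝ} (h1 : ContDiff ℝ (⊤ : ℕ∞) φ) (h2 : HasCompactSupport φ)
    (μ : Measure (ℝ × ℝ)) [IsFiniteMeasureOnCompacts μ] : MemLp φ 2 μ :=
  h1.continuous.memLp_of_hasCompactSupport h2

theorem memLp_fderiv_of_contDiff {φ : ℝ × ℝ → ℝ} (h1 : ContDiff ℝ (⊤ : ℕ∞) φ)
    (h2 : HasCompactSupport φ) (e : ℝ × ℝ) (μ : Measure (ℝ × ℝ)) [IsFiniteMeasureOnCompacts μ] :
    MemLp (fun z => fderiv ℝ φ z e) 2 μ := by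
  refine Continuous.memLp_of_hasCompactSupport
    ((h1.continuous_fderiv (by simp)).clm_apply continuous_const) ?_
  exact (h2.fderiv ℝ).comp_left (g := fun T : ℝ × ℝ →L[ℝ] ℝ => T e) (by simp)

theorem IsWeakDeriv.congr {Ω : Set (ℝ × ℝ)} {e : ℝ × ℝ} {u v u' v' : ℝ × ℝ → ℂ}
    (h : IsWeakDeriv Ω e u v) (hu : u =ᵐ[volume.restrict Ω] u')
    (hv : v =ᵐ[volume.restrict Ω] v') : IsWeakDeriv Ω e u' v' := by
  intro φ h1 h2 h3
  have h4 := h φ h1 h2 h3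
  have e1 : ∫ z in Ω, fderiv ℝ φ z e • u z = ∫ z in Ω, fderiv ℝ φ z e • u' z :=
    integral_congr_ae (by filter_upwards [hu] with z hz; rw [hz])
  have e2 : ∫ z in Ω, φ z • v z = ∫ z in Ω, φ z • v' z :=
    integral_congr_ae (by filter_upwards [hv] with z hz; rw [hz])
  rw [← e1, ← e2, h4]

theorem IsWeakDeriv.comb {Ω : Set (ℝ × ℝ)} {e : ℝ × ℝ} {u v u' v' : ℝ × ℝ → ℂ}
    (h : IsWeakDeriv Ω e u v) (h' : IsWeakDeriv Ω e u' v')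
    (hu : MemLp u 2 (volume.restrict Ω)) (hv : MemLp v 2 (volume.restrict Ω))
    (hu' : MemLp u' 2 (volume.restrict Ω)) (hv' : MemLp v' 2 (volume.restrict Ω)) (s t : ℂ) :
    IsWeakDeriv Ω e (fun z => s * u z + t * u' z) (fun z => s * v z + t * v' z) := by
  intro φ h1 h2 h3
  have hφ := memLp_of_contDiff h1 h2 (volume.restrict Ω)
  have hφ' := memLp_fderiv_of_contDiff h1 h2 e (volume.restrict Ω)
  have E : ∀ {ψ : ℝ × ℝ → ℝ} {f g : ℝ × ℝ → ℂ}, MemLp ψ 2 (volume.restrict Ω) →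
      MemLp f 2 (volume.restrict Ω) → MemLp g 2 (volume.restrict Ω) →
      ∫ z in Ω, ψ z • (s * f z + t * g z)
        = s * (∫ z in Ω, ψ z • f z) + t * ∫ z in Ω, ψ z • g z := by
    intro ψ f g hψ hf hg
    rw [← integral_const_mul, ← integral_const_mul, ← integral_add
      ((MemLp.integrable_smul_of_memLp hψ hf).const_mul s)
      ((MemLp.integrable_smul_of_memLp hψ hg).const_mul t)]
    refine integral_congr_ae (Eventually.of_forall fun z => ?_)
    simp only [Complex.real_smul]
    ring
  rw [E hφ' hu hu', E hφ hv hv', h φ h1 h2 h3, h' φ h1 h2 h3]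
  ring

namespace OpenBook

variable {L : OpenBook}

theorem H1.weakDeriv_part (u : L.H1) (k : L.Page) :
    IsWeakDeriv (L.rect k) (1, 0) (u.part 0 k) (u.part 1 k) ∧
    IsWeakDeriv (L.rect k) (0, 1) (u.part 0 k) (u.part 2 k) :=
  ⟨u.weak_dx k, u.weak_dy k⟩

theorem H1.memLp_part_page (u : L.H1) (i : Fin 3) (k : L.Page) :
    MemLp (u.part i k) 2 (volume.restrict (L.rect k)) :=
  (memLp_mu_iff.1 (u.memLp_part i)).1 k

/-- The linear combination `s u + t v`. -/
def H1.comb (s t : ℂ) (u v : L.H1) : L.H1 :=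
  H1.ofParts (fun i k z => s * u.part i k z + t * v.part i k z)
    (fun i => ((u.memLp_part i).const_mul s).add ((v.memLp_part i).const_mul t))
    (fun k => (u.weakDeriv_part k).1.comb (v.weakDeriv_part k).1 (u.memLp_part_page 0 k)
      (u.memLp_part_page 1 k) (v.memLp_part_page 0 k) (v.memLp_part_page 1 k) s t)
    (fun k => (u.weakDeriv_part k).2.comb (v.weakDeriv_part k).2 (u.memLp_part_page 0 k)
      (u.memLp_part_page 2 k) (v.memLp_part_page 0 k) (v.memLp_part_page 2 k) s t)

theorem H1.part_comb (s t : ℂ) (u v : L.H1) (i : Fin 3) :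
    (H1.comb s t u v).part i = fun k z => s * u.part i k z + t * v.part i k z := by
  rw [H1.comb, H1.part_ofParts]

theorem H1.comp_comb (s t : ℂ) (u v : L.H1) (i : Fin 3) :
    (H1.comb s t u v).comp i = s • u.comp i + t • v.comp i := by
  rw [H1.comp, H1.comp, H1.comp, ← MemLp.toLp_const_smul, ← MemLp.toLp_const_smul,
    ← MemLp.toLp_add]
  refine MemLp.toLp_congr _ _ (Eventually.of_forall fun x => ?_)
  simp [H1.part_comb]

/-- An `H¹` function from elements of `L²`. -/
theorem exists_h1_of_comp (f : Fin 3 → Lp ℂ 2 L.mu)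
    (hx : ∀ k, IsWeakDeriv (L.rect k) (1, 0) (fun z => f 0 (k, z)) (fun z => f 1 (k, z)))
    (hy : ∀ k, IsWeakDeriv (L.rect k) (0, 1) (fun z => f 0 (k, z)) (fun z => f 2 (k, z))) :
    ∃ u : L.H1, (∀ i, u.comp i = f i) ∧ ∀ i k z, u.part i k z = f i (k, z) := by
  refine ⟨H1.ofParts (fun i k z => f i (k, z)) (fun i => Lp.memLp (f i)) hx hy, fun i => ?_, ?_⟩
  · rw [H1.comp]
    refine (MemLp.toLp_congr _ (Lp.memLp (f i)) (Eventually.of_forall fun x => ?_)).trans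
      (Lp.toLp_coeFn _ _)
    rw [H1.part_ofParts]
  · intro i k z
    rw [H1.part_ofParts]

/-- Pairings on a page are represented by elements of `L²`. -/
theorem exists_inner_eq_setIntegral (k : L.Page) {ψ : ℝ × ℝ → ℝ}
    (hψ : MemLp ψ 2 (volume.restrict (L.rect k))) :
    ∃ e : Lp ℂ 2 L.mu, ∀ f : Lp ℂ 2 L.mu,
      inner ℂ e f = ∫ z in L.rect k, ψ z • f (k, z) := by
  classical
  set g : L.Page → ℝ × ℝ → ℂ := fun k' z => if k' = k then (ψ z : ℂ) else 0
  have hg : MemLp (fun x : L.Page × (ℝ × ℝ) => g x.1 x.2) 2 L.mu := by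
    rw [memLp_mu_iff]
    have hψ' : MemLp (fun z => (ψ z : ℂ)) 2 (volume.restrict (L.rect k)) := hψ.ofReal
    constructor
    · intro k'
      by_cases h : k' = k
      · subst h
        simpa [g] using hψ'
      · simp [g, h]
    · rw [lpPow, tsum_eq_single k]
      · simpa [g] using (memLp_two_iff.1 hψ').2
      · intro k' h
        simp [g, h]
  refine ⟨hg.toLp _, fun f => ?_⟩
  have hint : Integrable (fun x => inner ℂ (hg.toLp _ x) (f x)) L.mu :=
    L2.integrable_inner _ _
  rw [L2.inner_def]
  have hint2 : Integrable (fun x : L.Page × (ℝ × ℝ) => conj (g x.1 x.2) * f x) L.mu := by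
    refine hint.congr ?_
    filter_upwards [hg.coeFn_toLp] with x hx
    rw [hx, RCLike.inner_apply']
  have e1 : ∫ x, inner ℂ (hg.toLp _ x) (f x) ∂L.mu = ∫ x, conj (g x.1 x.2) * f x ∂L.mu := by
    refine integral_congr_ae ?_
    filter_upwards [hg.coeFn_toLp] with x hx
    rw [hx, RCLike.inner_apply']
  rw [e1, integral_mu hint2, tsum_eq_single k]
  · simp [g]
  · intro k' h
    simp [g, h]

/-- Expresses the inner product through the three `L²` components, so that componentwise weak
convergence yields `WeaklyNull`. -/
theorem h1Inner_eq (u v : L.H1) : h1Inner u v = ∑ i, inner ℂ (v.comp i) (u.comp i) := by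
  have hint : ∀ i, Integrable (fun x : L.Page × (ℝ × ℝ) =>
      u.part i x.1 x.2 * conj (v.part i x.1 x.2)) L.mu := by
    intro i
    refine (L2.integrable_inner (𝕜 := ℂ) (v.comp i) (u.comp i)).congr ?_
    filter_upwards [u.coeFn_comp i, v.coeFn_comp i] with x h1 h2
    rw [h1, h2, RCLike.inner_apply]
  have e1 : ∀ i, inner ℂ (v.comp i) (u.comp i) =
      ∫ x, u.part i x.1 x.2 * conj (v.part i x.1 x.2) ∂L.mu := by
    intro i
    rw [L2.inner_def]
    refine integral_congr_ae ?_
    filter_upwards [u.coeFn_comp i, v.coeFn_comp i] with x h1 h2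
    rw [h1, h2, RCLike.inner_apply]
  simp only [e1, Fin.sum_univ_three]
  have h2 := (hint 0).add (hint 1)
  rw [← integral_add (hint 0) (hint 1)]
  have h3 := h2.add (hint 2)
  simp only [Pi.add_def] at h2 h3
  rw [← integral_add h2 (hint 2), integral_mu h3]
  rfl

end OpenBook

end

noncomputable section

/-! ### Weak compactness -/

/-- Bounded sequences in a Hilbert space have weakly convergent subsequences. -/
theorem exists_subseq_weak_tendsto {H : Type*} [NormedAddCommGroup H] [InnerProductSpace ℂ H]
    [CompleteSpace H] (x : ℕ → H) {C : ℝ} (hC : ∀ n, ‖x n‖ ≤ C) :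
    ∃ (y : H) (φ : ℕ → ℕ), StrictMono φ ∧
      ∀ e : H, Tendsto (fun n => inner ℂ e (x (φ n))) atTop (𝓝 (inner ℂ e y)) := by
  -- The closed span of the sequence is separable, so that the Banach-Alaoglu theorem holds
  -- sequentially in its dual. Test vectors outside are replaced by their projections, which have
  -- the same inner products with the sequence.
  set K : Submodule ℂ H := (Submodule.span ℂ (Set.range x)).topologicalClosure
  have hsep : TopologicalSpace.IsSeparable (K : Set H) :=
    (Set.countable_range x).isSeparable.span.closure
  have : TopologicalSpace.SeparableSpace K := hsep.separableSpace
  have : CompleteSpace K := (Submodule.isClosed_topologicalClosure _).completeSpace_coe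
  have hmem : ∀ n, x n ∈ K := fun n =>
    Submodule.le_topologicalClosure _ (Submodule.subset_span ⟨n, rfl⟩)
  set x' : ℕ → K := fun n => ⟨x n, hmem n⟩
  obtain ⟨f, -, φ, hφ, hlim⟩ := WeakDual.isSeqCompact_closedBall ℂ K 0 C
    (x := fun n => StrongDual.toWeakDual (InnerProductSpace.toDual ℂ K (x' n)))
    (fun n => by
      simp only [Set.mem_preimage, mem_closedBall_zero_iff]
      change ‖InnerProductSpace.toDual ℂ K (x' n)‖ ≤ C
      rw [LinearIsometryEquiv.norm_map]
      exact hC n)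
  set y := (InnerProductSpace.toDual ℂ K).symm (WeakDual.toStrongDual f)
  rw [tendsto_iff_forall_eval_tendsto_topDualPairing] at hlim
  have h1 : ∀ e : K, Tendsto (fun n => inner ℂ (x' (φ n)) e) atTop (𝓝 (inner ℂ y e)) := by
    intro e
    have h2 : inner ℂ y e = f e := by
      rw [← InnerProductSpace.toDual_apply_apply (𝕜 := ℂ) (x := y),
        LinearIsometryEquiv.apply_symm_apply]
      rfl
    rw [h2]
    exact hlim e
  refine ⟨y, φ, hφ, fun e => ?_⟩
  have h3 := h1 (K.orthogonalProjectionOnto e)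
  simp only [Submodule.inner_orthogonalProjectionOnto_eq_of_mem_left] at h3
  have h4 := (Complex.continuous_conj.tendsto _).comp h3
  simp only [Function.comp_def] at h4
  simpa only [inner_conj_symm] using h4

namespace OpenBook

variable {L : OpenBook}

/-- Weak convergence in `H¹`. -/
def WeakConv (u : ℕ → L.H1) (v : L.H1) : Prop :=
  ∀ (i : Fin 3) (e : Lp ℂ 2 L.mu),
    Tendsto (fun n => inner ℂ e ((u n).comp i)) atTop (𝓝 (inner ℂ e (v.comp i)))

theorem WeakConv.comp_strictMono {u : ℕ → L.H1} {v : L.H1} (h : WeakConv u v) {φ : ℕ → ℕ}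
    (hφ : StrictMono φ) : WeakConv (fun n => u (φ n)) v :=
  fun i e => (h i e).comp hφ.tendsto_atTop

theorem WeakConv.tendsto_setIntegral {u : ℕ → L.H1} {v : L.H1} (h : WeakConv u v) (i : Fin 3)
    (k : L.Page) {ψ : ℝ × ℝ → ℝ} (hψ : MemLp ψ 2 (volume.restrict (L.rect k))) :
    Tendsto (fun n => ∫ z in L.rect k, ψ z • (u n).part i k z) atTop
      (𝓝 (∫ z in L.rect k, ψ z • v.part i k z)) := by
  obtain ⟨e, he⟩ := exists_inner_eq_setIntegral k hψ
  have hc : ∀ w : L.H1, inner ℂ e (w.comp i) = ∫ z in L.rect k, ψ z • w.part i k z := by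
    intro w
    rw [he]
    refine integral_congr_ae ?_
    filter_upwards [w.coeFn_comp_page i k] with z hz
    rw [hz]
  simpa only [hc] using h i e

/-- Bounded sequences in `H¹` have weakly convergent subsequences. -/
theorem exists_subseq_weakConv (u : ℕ → L.H1) {C : ℝ} (hC : ∀ n i, ‖(u n).comp i‖ ≤ C) :
    ∃ (v : L.H1) (φ : ℕ → ℕ), StrictMono φ ∧ WeakConv (fun n => u (φ n)) v := by
  obtain ⟨f0, φ0, h0, l0⟩ := exists_subseq_weak_tendsto (fun n => (u n).comp 0) fun n => hC n 0
  obtain ⟨f1, φ1, h1, l1⟩ := exists_subseq_weak_tendsto (fun n => (u (φ0 n)).comp 1)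
    fun n => hC _ 1
  obtain ⟨f2, φ2, h2, l2⟩ := exists_subseq_weak_tendsto (fun n => (u (φ0 (φ1 n))).comp 2)
    fun n => hC _ 2
  set φ := fun n => φ0 (φ1 (φ2 n))
  have hφ : StrictMono φ := h0.comp (h1.comp h2)
  set f : Fin 3 → Lp ℂ 2 L.mu := ![f0, f1, f2]
  have hl : ∀ i e, Tendsto (fun n => inner ℂ e ((u (φ n)).comp i)) atTop (𝓝 (inner ℂ e (f i))) := by
    intro i e
    fin_cases i
    · exact (l0 e).comp (h1.comp h2).tendsto_atTop
    · exact (l1 e).comp h2.tendsto_atTop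
    · exact l2 e
  -- Both sides of the identity that defines a weak derivative are inner products with fixed
  -- elements of `L²`, hence the identity survives the weak limit.
  have key : ∀ (k : L.Page) (d : ℝ × ℝ) (i : Fin 3),
      (∀ w : L.H1, IsWeakDeriv (L.rect k) d (w.part 0 k) (w.part i k)) →
      IsWeakDeriv (L.rect k) d (fun z => f 0 (k, z)) (fun z => f i (k, z)) := by
    intro k d i hw ψ p1 p2 p3
    obtain ⟨e0, he0⟩ := exists_inner_eq_setIntegral k
      (memLp_fderiv_of_contDiff p1 p2 d (volume.restrict (L.rect k)))
    obtain ⟨e1, he1⟩ := exists_inner_eq_setIntegral k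
      (memLp_of_contDiff p1 p2 (volume.restrict (L.rect k)))
    rw [← he0, ← he1]
    refine tendsto_nhds_unique (hl 0 e0) (((hl i e1).neg).congr fun n => ?_)
    rw [he0, he1]
    have := (hw (u (φ n))).congr ((u (φ n)).coeFn_comp_page 0 k).symm
      ((u (φ n)).coeFn_comp_page i k).symm ψ p1 p2 p3
    rw [this]
  obtain ⟨v, hv, -⟩ := exists_h1_of_comp f (fun k => key k _ 1 fun w => w.weak_dx k)
    (fun k => key k _ 2 fun w => w.weak_dy k)
  exact ⟨v, φ, hφ, fun i e => by rw [hv]; exact hl i e⟩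

end OpenBook

/-! ### Local compactness -/

theorem restrict_closedBox (x₀ x₁ y₀ y₁ : ℝ) :
    (volume : Measure (ℝ × ℝ)).restrict (closedBox x₀ x₁ y₀ y₁)
      = volume.restrict (openBox x₀ x₁ y₀ y₁) := by
  rw [Measure.volume_eq_prod, ← Measure.prod_restrict, ← Measure.prod_restrict,
    Measure.restrict_congr_set (Ioo_ae_eq_Icc (a := x₀) (b := x₁)).symm,
    Measure.restrict_congr_set (Ioo_ae_eq_Icc (a := y₀) (b := y₁)).symm]

/-- The cells of a grid. -/
def gridCell (δ η : ℝ) (c : ℕ × ℕ) : Set (ℝ × ℝ) :=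
  openBox (c.1 * δ) ((c.1 + 1) * δ) (c.2 * η) ((c.2 + 1) * η)

theorem nat_eq_of_mem_Ioo {δ x : ℝ} (hδ : 0 < δ) {i j : ℕ}
    (hi : x ∈ Set.Ioo (i * δ) ((i + 1) * δ)) (hj : x ∈ Set.Ioo (j * δ) ((j + 1) * δ)) : i = j := by
  have h1 : (i : ℝ) < j + 1 := lt_of_mul_lt_mul_right (hi.1.trans hj.2) hδ.le
  have h2 : (j : ℝ) < i + 1 := lt_of_mul_lt_mul_right (hj.1.trans hi.2) hδ.le
  norm_cast at h1 h2
  omega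

theorem gridCell_pairwiseDisjoint {δ η : ℝ} (hδ : 0 < δ) (hη : 0 < η) (s : Set (ℕ × ℕ)) :
    s.PairwiseDisjoint (gridCell δ η) := by
  intro c _ c' _ hne
  rw [Function.onFun, Set.disjoint_left]
  rintro z ⟨h1, h2⟩ ⟨h3, h4⟩
  exact hne (Prod.ext (nat_eq_of_mem_Ioo hδ h1 h3) (nat_eq_of_mem_Ioo hη h2 h4))

theorem exists_nat_mem_Icc {δ x : ℝ} (hδ : 0 < δ) {N : ℕ} (h0 : 0 < x) (hN : x < N * δ) :
    ∃ i < N, x ∈ Set.Icc (i * δ) ((i + 1) * δ) := by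
  have h1 : ((⌊x / δ⌋₊ : ℕ) : ℝ) ≤ x / δ := Nat.floor_le (by positivity)
  refine ⟨⌊x / δ⌋₊, ?_, (le_div_iff₀ hδ).1 h1, ((div_lt_iff₀ hδ).1 (Nat.lt_floor_add_one _)).le⟩
  have : ((⌊x / δ⌋₊ : ℕ) : ℝ) < N := h1.trans_lt ((div_lt_iff₀ hδ).2 hN)
  exact_mod_cast this

/-- The closed cells cover the box, and their boundaries are null sets. -/
theorem lintegral_openBox_le_sum_gridCell {δ η : ℝ} (hδ : 0 < δ) (hη : 0 < η) (N : ℕ)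
    (F : ℝ × ℝ → ℝ≥0∞) :
    ∫⁻ z in openBox 0 (N * δ) 0 (N * η), F z ≤
      ∑ c ∈ Finset.range N ×ˢ Finset.range N, ∫⁻ z in gridCell δ η c, F z := by
  set S := Finset.range N ×ˢ Finset.range N
  have hsub : openBox 0 (N * δ) 0 (N * η) ⊆
      ⋃ c : S, closedBox (c.1.1 * δ) ((c.1.1 + 1) * δ) (c.1.2 * η) ((c.1.2 + 1) * η) := by
    rintro z ⟨h1, h2⟩
    obtain ⟨i, hi, hi'⟩ := exists_nat_mem_Icc hδ h1.1 h1.2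
    obtain ⟨j, hj, hj'⟩ := exists_nat_mem_Icc hη h2.1 h2.2
    exact Set.mem_iUnion.2 ⟨⟨(i, j), by simp [S, hi, hj]⟩, hi', hj'⟩
  refine (lintegral_mono_set hsub).trans ((lintegral_iUnion_le _ _).trans (le_of_eq ?_))
  rw [tsum_fintype, ← Finset.sum_coe_sort S]
  refine Finset.sum_congr rfl fun c _ => ?_
  rw [restrict_closedBox]
  rfl

theorem gridCell_subset {δ η : ℝ} (hδ : 0 < δ) (hη : 0 < η) {N : ℕ} {c : ℕ × ℕ}
    (hc : c ∈ Finset.range N ×ˢ Finset.range N) :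
    gridCell δ η c ⊆ openBox 0 (N * δ) 0 (N * η) := by
  simp only [Finset.mem_product, Finset.mem_range] at hc
  have h1 : (c.1 : ℝ) + 1 ≤ N := by exact_mod_cast hc.1
  have h2 : (c.2 : ℝ) + 1 ≤ N := by exact_mod_cast hc.2
  rintro z ⟨⟨a1, a2⟩, a3, a4⟩
  refine ⟨⟨lt_of_le_of_lt (by positivity) a1, a2.trans_le (by gcongr)⟩,
    ⟨lt_of_le_of_lt (by positivity) a3, a4.trans_le (by gcongr)⟩⟩

theorem sum_gridCell_le {δ η : ℝ} (hδ : 0 < δ) (hη : 0 < η) (N : ℕ) (F : ℝ × ℝ → ℝ≥0∞) :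
    ∑ c ∈ Finset.range N ×ˢ Finset.range N, ∫⁻ z in gridCell δ η c, F z ≤
      ∫⁻ z in openBox 0 (N * δ) 0 (N * η), F z := by
  rw [← lintegral_biUnion_finset (gridCell_pairwiseDisjoint hδ hη _)
    (fun c _ => measurableSet_openBox _ _ _ _)]
  exact lintegral_mono_set (Set.iUnion₂_subset fun c hc => gridCell_subset hδ hη hc)

namespace OpenBook

variable {L : OpenBook}

theorem lpPow_two (u : L.Page → ℝ × ℝ → ℂ) :
    L.lpPow 2 u = ∑' k, ∫⁻ z in L.rect k, ‖u k z‖ₑ ^ 2 := by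
  simp [lpPow, ENNReal.rpow_ofNat]

theorem H1.lpPow_part (u : L.H1) (i : Fin 3) :
    L.lpPow 2 (u.part i) = ENNReal.ofReal (‖u.comp i‖ ^ 2) := by
  rw [H1.norm_comp_sq, ENNReal.ofReal_toReal]
  exact (memLp_mu_iff.1 (u.memLp_part i)).2.ne

theorem H1.lintegral_page_le (u : L.H1) (i : Fin 3) (k : L.Page) :
    ∫⁻ z in L.rect k, ‖u.part i k z‖ₑ ^ 2 ≤ ENNReal.ofReal (‖u.comp i‖ ^ 2) := by
  rw [← H1.lpPow_part, lpPow_two]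
  exact ENNReal.le_tsum (f := fun k => ∫⁻ z in L.rect k, ‖u.part i k z‖ₑ ^ 2) k

/-- **Rellich's theorem** on bounded parts of the pages. -/
theorem tendsto_lintegral_of_weakly_null {w : ℕ → L.H1} {C : ℝ} (hC : ∀ n i, ‖(w n).comp i‖ ≤ C)
    (hw : ∀ e : Lp ℂ 2 L.mu, Tendsto (fun n => inner ℂ e ((w n).comp 0)) atTop (𝓝 0))
    (k : L.Page) {a b : ℝ≥0∞} (ha : a ≤ L.width k) (hb : b ≤ L.height k) (ha' : a ≠ ⊤)
    (hb' : b ≠ ⊤) :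
    Tendsto (fun n => ∫⁻ z in openRect a b, ‖(w n).part 0 k z‖ₑ ^ 2) atTop (𝓝 0) := by
  rcases eq_or_ne a 0 with rfl | ha0
  · simp [openRect, openSeg]
  rcases eq_or_ne b 0 with rfl | hb0
  · simp [openRect, openSeg]
  rw [ENNReal.tendsto_nhds_zero]
  intro ε hε
  rcases eq_or_ne ε ⊤ with rfl | hεt
  · simp
  set X := a.toReal
  set Y := b.toReal
  have hX : 0 < X := ENNReal.toReal_pos ha0 ha'
  have hY : 0 < Y := ENNReal.toReal_pos hb0 hb'
  set M := ENNReal.ofReal (C ^ 2) + ENNReal.ofReal (C ^ 2)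
  have hM : M ≠ ⊤ := by simp [M]
  -- The grid is so fine that the gradient terms of the Poincaré inequality, summed over all cells,
  -- contribute at most `ε / 2`; here `M` bounds the squared norm of the gradient along the
  -- sequence.
  obtain ⟨N, hN0, hN⟩ : ∃ N : ℕ, 0 < N ∧
      4 * ENNReal.ofReal (max X Y / N) ^ 2 * M ≤ ε / 2 := by
    have h1 : Tendsto (fun N : ℕ => max X Y / (N : ℝ)) atTop (𝓝 0) :=
      tendsto_const_div_atTop_nhds_zero_nat _
    have h2 : Tendsto (fun N : ℕ => 4 * ENNReal.ofReal (max X Y / N) ^ 2 * M) atTop (𝓝 0) := by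
      have h3 := (ENNReal.continuous_pow 2).tendsto _ |>.comp
        ((ENNReal.continuous_ofReal.tendsto _).comp h1)
      have h4 := ENNReal.Tendsto.mul_const (ENNReal.Tendsto.const_mul (a := 4) h3
        (Or.inr (by simp))) (Or.inr hM)
      simpa using h4
    have h5 := ENNReal.tendsto_nhds_zero.1 h2 (ε / 2) (ENNReal.half_pos hε.ne')
    obtain ⟨N, h6, h7⟩ := (h5.and (eventually_gt_atTop 0)).exists
    exact ⟨N, h7, h6⟩
  have hN' : (0 : ℝ) < N := by exact_mod_cast hN0
  set δ := X / N
  set η := Y / N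
  have hδ : 0 < δ := by positivity
  have hη : 0 < η := by positivity
  have eX : N * δ = X := by simp only [δ]; field_simp
  have eY : N * η = Y := by simp only [η]; field_simp
  have hbox : openRect a b = openBox 0 (N * δ) 0 (N * η) := by
    rw [eX, eY]; exact openRect_of_ne_top ha' hb'
  set S := Finset.range N ×ˢ Finset.range N
  have hsub : openBox 0 (N * δ) 0 (N * η) ⊆ L.rect k := hbox ▸ openRect_mono ha hb
  have hcell : ∀ c ∈ S, gridCell δ η c ⊆ L.rect k := fun c hc => (gridCell_subset hδ hη hc).trans hsub
  -- For the fixed grid there remain finitely many averages. Each is the inner product with an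
  -- indicator function and tends to zero by weak convergence.
  have hlim : Tendsto (fun n => ∑ c ∈ S,
      2 * (volume (gridCell δ η c))⁻¹ * ‖∫ z in gridCell δ η c, (w n).part 0 k z‖ₑ ^ 2)
      atTop (𝓝 0) := by
    have : (0 : ℝ≥0∞) = ∑ c ∈ S, 0 := by simp
    rw [this]
    refine tendsto_finsetSum _ fun c hc => ?_
    have hm : MeasurableSet (gridCell δ η c) := measurableSet_openBox _ _ _ _
    have hv : volume (gridCell δ η c) = ENNReal.ofReal δ * ENNReal.ofReal η := by
      rw [gridCell, volume_openBox]
      congr 2 <;> ring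
    have hv0 : (volume (gridCell δ η c))⁻¹ ≠ ⊤ := by simp [hv, hδ, hη]
    have hvt : volume (gridCell δ η c) ≠ ⊤ := by
      rw [hv]; exact ENNReal.mul_ne_top (by simp) (by simp)
    have hψ : MemLp ((gridCell δ η c).indicator fun _ => (1 : ℝ)) 2 (volume.restrict (L.rect k)) := by
      refine memLp_indicator_const _ hm _ (Or.inr ?_)
      exact ((Measure.restrict_apply_le _ _).trans_lt hvt.lt_top).ne
    obtain ⟨e, he⟩ := exists_inner_eq_setIntegral k hψ
    have hc' : ∀ n, inner ℂ e ((w n).comp 0) = ∫ z in gridCell δ η c, (w n).part 0 k z := by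
      intro n
      rw [he]
      conv_rhs => rw [← Set.inter_eq_self_of_subset_right (hcell c hc), ← setIntegral_indicator hm]
      refine integral_congr_ae ?_
      filter_upwards [(w n).coeFn_comp_page 0 k] with z hz
      rw [hz]
      by_cases hz' : z ∈ gridCell δ η c <;> simp [hz']
    have h1 := hw e
    simp only [hc'] at h1
    have h2 := ENNReal.Tendsto.const_mul (a := 2 * (volume (gridCell δ η c))⁻¹)
      (((ENNReal.continuous_pow 2).tendsto _).comp h1.enorm)
      (Or.inr (ENNReal.mul_ne_top (by simp) hv0))
    simpa using h2
  filter_upwards [ENNReal.tendsto_nhds_zero.1 hlim (ε / 2) (ENNReal.half_pos hε.ne')] with n hn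
  rw [hbox]
  refine (lintegral_openBox_le_sum_gridCell hδ hη N _).trans ?_
  have hP : ∀ c ∈ S, ∫⁻ z in gridCell δ η c, ‖(w n).part 0 k z‖ₑ ^ 2 ≤
      4 * ENNReal.ofReal (max X Y / N) ^ 2 *
        ((∫⁻ z in gridCell δ η c, ‖(w n).part 1 k z‖ₑ ^ 2) +
          ∫⁻ z in gridCell δ η c, ‖(w n).part 2 k z‖ₑ ^ 2) +
      2 * (volume (gridCell δ η c))⁻¹ * ‖∫ z in gridCell δ η c, (w n).part 0 k z‖ₑ ^ 2 := by
    intro c hc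
    have hr := Measure.restrict_mono_set (volume : Measure (ℝ × ℝ)) (hcell c hc)
    have hd := (w n).weakDeriv_part k
    refine lintegral_sq_le_grad_add_average (((w n).memLp_part_page 0 k).mono_measure hr)
      (((w n).memLp_part_page 1 k).mono_measure hr) (((w n).memLp_part_page 2 k).mono_measure hr)
      (hd.1.mono (measurableSet_rect k) (hcell c hc))
      (hd.2.mono (measurableSet_rect k) (hcell c hc)) ?_ ?_ ?_ ?_
    · have : X / N ≤ max X Y / N := by gcongr; exact le_max_left _ _
      simp only [δ]; linarith
    · have : Y / N ≤ max X Y / N := by gcongr; exact le_max_right _ _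
      simp only [η]; linarith
    · nlinarith
    · nlinarith
  have hE : ∀ i, ∑ c ∈ S, ∫⁻ z in gridCell δ η c, ‖(w n).part i k z‖ₑ ^ 2
      ≤ ENNReal.ofReal (C ^ 2) := by
    intro i
    refine (sum_gridCell_le hδ hη N _).trans ((lintegral_mono_set hsub).trans ?_)
    refine ((w n).lintegral_page_le i k).trans (ENNReal.ofReal_le_ofReal ?_)
    exact pow_le_pow_left₀ (norm_nonneg _) (hC n i) 2
  calc _ ≤ ∑ c ∈ S, _ := Finset.sum_le_sum hP
    _ ≤ 4 * ENNReal.ofReal (max X Y / N) ^ 2 * M + ε / 2 := by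
      rw [Finset.sum_add_distrib, ← Finset.mul_sum, Finset.sum_add_distrib]
      gcongr
      · exact add_le_add (hE 1) (hE 2)
    _ ≤ ε / 2 + ε / 2 := by gcongr
    _ = ε := ENNReal.add_halves ε

/-- Bounded, weakly null sequences converge to `0` almost everywhere along a subsequence. -/
theorem exists_subseq_ae_tendsto_zero {w : ℕ → L.H1} {C : ℝ} (hC : ∀ n i, ‖(w n).comp i‖ ≤ C)
    (hw : ∀ e : Lp ℂ 2 L.mu, Tendsto (fun n => inner ℂ e ((w n).comp 0)) atTop (𝓝 0)) :
    ∃ φ : ℕ → ℕ, StrictMono φ ∧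
      ∀ᵐ x ∂L.mu, Tendsto (fun n => (w (φ n)).comp 0 x) atTop (𝓝 0) := by
  set R : L.Page × ℕ → Set (ℝ × ℝ) := fun j =>
    openRect (min (L.width j.1) j.2) (min (L.height j.1) j.2)
  have hR : ∀ j, R j ⊆ L.rect j.1 := fun j => openRect_mono (min_le_left _ _) (min_le_left _ _)
  -- Instead of a diagonal argument over pages and truncations, all of them are put into one measure
  -- `ν` with positive summable weights. Convergence on each piece then gives convergence in
  -- `L²(ν)`, hence a subsequence converging `ν`-almost everywhere; this controls every piece, since
  -- the weights are positive.
  obtain ⟨wt, hwt, hsum⟩ := ENNReal.exists_pos_sum_of_countable one_ne_zero (L.Page × ℕ)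
  set ν : Measure (L.Page × (ℝ × ℝ)) :=
    Measure.sum fun j => wt j • (volume.restrict (R j)).map (Prod.mk j.1)
  have hν : ν ≪ L.mu := by
    refine Measure.absolutelyContinuous_sum_left fun j => ?_
    refine Measure.AbsolutelyContinuous.trans (Measure.smul_absolutelyContinuous) ?_
    refine Measure.AbsolutelyContinuous.trans ?_ (Measure.le_sum _ j.1).absolutelyContinuous
    exact (Measure.map_mono (Measure.restrict_mono_set _ (hR j))
      (measurableEmbedding_mk _).measurable).absolutelyContinuous
  have hlint : ∀ f : L.Page × (ℝ × ℝ) → ℝ≥0∞,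
      ∫⁻ x, f x ∂ν = ∑' j, wt j * ∫⁻ z in R j, f (j.1, z) := by
    intro f
    rw [lintegral_sum_measure]
    refine tsum_congr fun j => ?_
    rw [lintegral_smul_measure, (measurableEmbedding_mk j.1).lintegral_map]
    rfl
  have hcomp : ∀ n j, ∫⁻ z in R j, ‖(w n).comp 0 (j.1, z)‖ₑ ^ (2 : ℝ)
      = ∫⁻ z in R j, ‖(w n).part 0 j.1 z‖ₑ ^ 2 := by
    intro n j
    refine lintegral_congr_ae ?_
    filter_upwards [ae_restrict_of_ae_restrict_of_subset (hR j) ((w n).coeFn_comp_page 0 j.1)]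
      with z hz
    rw [hz, ENNReal.rpow_ofNat]
  have htend : Tendsto (fun n => ∫⁻ x, ‖(w n).comp 0 x‖ₑ ^ (2 : ℝ) ∂ν) atTop (𝓝 0) := by
    simp only [hlint, hcomp]
    have h1 := tendsto_lintegral_of_dominated_convergence (μ := (Measure.count : Measure (L.Page × ℕ)))
      (F := fun n j => (wt j : ℝ≥0∞) * ∫⁻ z in R j, ‖(w n).part 0 j.1 z‖ₑ ^ 2) (f := fun _ => 0)
      (fun j => wt j * ENNReal.ofReal (C ^ 2)) (fun n => Measurable.of_discrete)
      (fun n => Eventually.of_forall fun j => ?_) ?_ (Eventually.of_forall fun j => ?_)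
    · simpa only [lintegral_count, lintegral_zero] using h1
    · dsimp only
      gcongr
      refine (lintegral_mono_set (hR j)).trans (((w n).lintegral_page_le 0 j.1).trans ?_)
      exact ENNReal.ofReal_le_ofReal (pow_le_pow_left₀ (norm_nonneg _) (hC n 0) 2)
    · rw [lintegral_count, ENNReal.tsum_mul_right]
      exact ENNReal.mul_ne_top (hsum.trans_le le_top).ne (by simp)
    · have h2 := tendsto_lintegral_of_weakly_null hC hw j.1
        (a := min (L.width j.1) j.2) (b := min (L.height j.1) j.2)
        (min_le_left _ _) (min_le_left _ _)
        ((min_le_right _ _).trans_lt (ENNReal.natCast_lt_top _)).ne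
        ((min_le_right _ _).trans_lt (ENNReal.natCast_lt_top _)).ne
      simpa using ENNReal.Tendsto.const_mul (a := (wt j : ℝ≥0∞)) h2 (Or.inr (by simp))
  have hmeas : TendstoInMeasure ν (fun n => (w n).comp 0) atTop (fun _ => (0 : ℂ)) := by
    refine tendstoInMeasure_of_tendsto_eLpNorm (p := 2) (by norm_num)
      (fun n => (Lp.aestronglyMeasurable _).mono_ac hν) aestronglyMeasurable_const ?_
    have h1 : ∀ n, eLpNorm ((fun x => (w n).comp 0 x) - fun _ => (0 : ℂ)) 2 ν =
        (∫⁻ x, ‖(w n).comp 0 x‖ₑ ^ (2 : ℝ) ∂ν) ^ (1 / 2 : ℝ) := by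
      intro n
      rw [eLpNorm_eq_lintegral_rpow_enorm_toReal (by norm_num) (by norm_num)]
      simp
    simp only [h1]
    have h2 := (ENNReal.continuous_rpow_const (y := (1 / 2 : ℝ))).tendsto 0 |>.comp htend
    simpa [Function.comp_def] using h2
  obtain ⟨φ, hφ, hae⟩ := hmeas.exists_seq_tendsto_ae
  refine ⟨φ, hφ, ?_⟩
  rw [Measure.ae_sum_iff] at hae
  rw [ae_mu_iff]
  intro k
  rw [rect, ← iUnion_openRect_min, ae_restrict_iUnion_iff]
  intro i
  have h1 := hae (k, i)
  rw [Measure.ae_smul_measure_iff (hwt _).ne', (measurableEmbedding_mk k).ae_map_iff] at h1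
  exact h1

end OpenBook

end

noncomputable section

/-! ### Symmetries of rectangles -/

/-- The map `t ↦ t` or `t ↦ ℓ - t` of a segment of length `ℓ`. -/
def flipIf (r : Bool) (ℓ : ℝ≥0∞) (t : ℝ) : ℝ := if r = true then ℓ.toReal - t else t

theorem flipIf_flipIf (r : Bool) (ℓ : ℝ≥0∞) (t : ℝ) : flipIf r ℓ (flipIf r ℓ t) = t := by
  unfold flipIf; split_ifs <;> ring

theorem flipIf_xor (r r' : Bool) (ℓ : ℝ≥0∞) (t : ℝ) :
    flipIf r' ℓ (flipIf r ℓ t) = flipIf (xor r r') ℓ t := by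
  cases r <;> cases r' <;> simp [flipIf]

theorem flipIf_mem_openSeg {r : Bool} {ℓ : ℝ≥0∞} (h : r = true → ℓ ≠ ⊤) {t : ℝ} :
    flipIf r ℓ t ∈ openSeg ℓ ↔ t ∈ openSeg ℓ := by
  unfold flipIf
  split_ifs with hr
  · rw [openSeg_of_ne_top (h hr)]
    simp only [Set.mem_Ioo]
    constructor <;> rintro ⟨h1, h2⟩ <;> constructor <;> linarith
  · rfl

theorem closedSeg_of_ne_top {a : ℝ≥0∞} (ha : a ≠ ⊤) : closedSeg a = Set.Icc 0 a.toReal := by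
  ext t
  simp only [closedSeg, Set.mem_ofPred_eq, Set.mem_Icc, ENNReal.ofReal_le_iff_le_toReal ha]

theorem flipIf_mem_closedSeg {r : Bool} {ℓ : ℝ≥0∞} (h : r = true → ℓ ≠ ⊤) {t : ℝ} :
    flipIf r ℓ t ∈ closedSeg ℓ ↔ t ∈ closedSeg ℓ := by
  unfold flipIf
  split_ifs with hr
  · rw [closedSeg_of_ne_top (h hr)]
    simp only [Set.mem_Icc]
    constructor <;> rintro ⟨h1, h2⟩ <;> constructor <;> linarith
  · rfl

theorem measurableEmbedding_flipIf (r : Bool) (ℓ : ℝ≥0∞) : MeasurableEmbedding (flipIf r ℓ) := by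
  cases r
  · exact MeasurableEmbedding.id
  · exact (MeasurableEquiv.subLeft ℓ.toReal).measurableEmbedding

theorem measurePreserving_flipIf (r : Bool) (ℓ : ℝ≥0∞) :
    MeasurePreserving (flipIf r ℓ) volume volume := by
  cases r
  · exact MeasurePreserving.id _
  · exact Measure.measurePreserving_sub_left volume ℓ.toReal

theorem measurePreserving_flipIf_openSeg {r : Bool} {ℓ : ℝ≥0∞} (h : r = true → ℓ ≠ ⊤) :
    MeasurePreserving (flipIf r ℓ) (volume.restrict (openSeg ℓ)) (volume.restrict (openSeg ℓ)) := by
  have := (measurePreserving_flipIf r ℓ).restrict_preimage (measurableSet_openSeg ℓ)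
  rwa [show flipIf r ℓ ⁻¹' openSeg ℓ = openSeg ℓ from Set.ext fun t => flipIf_mem_openSeg h] at this

/-- The coordinate directions. -/
def axisDir : Bool → ℝ × ℝ
  | false => (1, 0)
  | true => (0, 1)

/-- The components of the outer unit normal. -/
def PageSide.normalComp (s : PageSide) : Bool → ℝ
  | false => s.normal.1
  | true => s.normal.2

/-- A function that is positive inside a rectangle and vanishes on its sides. -/
def segBump (a : ℝ≥0∞) (x : ℝ) : ℝ := if a = ⊤ then x else x * (a.toReal - x)

/-- A symmetry between rectangles: an axis preserving isometry of the plane that maps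
`(0, a) × (0, b)` onto `(0, a') × (0, b')`. -/
structure PageSym (a b a' b' : ℝ≥0∞) where
  map : ℝ × ℝ → ℝ × ℝ
  inv : ℝ × ℝ → ℝ × ℝ
  lin : ℝ × ℝ →L[ℝ] ℝ × ℝ
  left_inv : ∀ z, inv (map z) = z
  right_inv : ∀ z, map (inv z) = z
  hasFDerivAt : ∀ z, HasFDerivAt map lin z
  contDiff_inv : ContDiff ℝ (⊤ : ℕ∞) inv
  measurePreserving : MeasurePreserving map volume volume
  mem_iff : ∀ z, map z ∈ openRect a' b' ↔ z ∈ openRect a b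
  sgn : Bool → ℝ
  idx : Bool → Bool
  lin_dir : ∀ i, lin (axisDir i) = sgn i • axisDir (idx i)
  abs_sgn : ∀ i, |sgn i| = 1
  idx_inj : idx true = !(idx false)
  side : PageSide → PageSide
  rev : PageSide → Bool
  present : ∀ s, s.Present a b → (side s).Present a' b'
  side_surj : ∀ s', s'.Present a' b' → ∃ s : PageSide, s.Present a b ∧ side s = s'
  length_eq : ∀ s, (side s).length a' b' = s.length a b
  rev_finite : ∀ s, rev s = true → s.length a b ≠ ⊤
  point_eq : ∀ s t, s.Present a b →
    map (s.point a b t) = (side s).point a' b' (flipIf (rev s) (s.length a b) t)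
  normal_eq : ∀ s i, s.normalComp i = sgn i * (side s).normalComp (idx i)
  dims : (a' = a ∧ b' = b) ∨ (a' = b ∧ b' = a)
  bump_eq : ∀ z, segBump a' (map z).1 * segBump b' (map z).2 = segBump a z.1 * segBump b z.2

namespace PageSym

variable {a b a' b' a'' b'' : ℝ≥0∞}

/-- The gradient component in the direction of an axis. -/
def gradComp (U : Fin 3 → ℝ × ℝ → ℂ) : Bool → ℝ × ℝ → ℂ
  | false => U 1
  | true => U 2

/-- The pull back of a function and its gradient. -/
def pull (S : PageSym a b a' b') (U : Fin 3 → ℝ × ℝ → ℂ) : Fin 3 → ℝ × ℝ → ℂ :=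
  ![fun z => U 0 (S.map z), fun z => S.sgn false • gradComp U (S.idx false) (S.map z),
    fun z => S.sgn true • gradComp U (S.idx true) (S.map z)]

theorem continuous_map (S : PageSym a b a' b') : Continuous S.map :=
  continuous_iff_continuousAt.2 fun z => (S.hasFDerivAt z).continuousAt

/-- The map of a symmetry, as a homeomorphism of the plane. -/
def homeo (S : PageSym a b a' b') : ℝ × ℝ ≃ₜ ℝ × ℝ where
  toFun := S.map
  invFun := S.inv
  left_inv := S.left_inv
  right_inv := S.right_inv
  continuous_toFun := S.continuous_map
  continuous_invFun := S.contDiff_inv.continuous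

theorem measurableEmbedding_map (S : PageSym a b a' b') : MeasurableEmbedding S.map :=
  S.homeo.measurableEmbedding

theorem measurePreserving_rect (S : PageSym a b a' b') :
    MeasurePreserving S.map (volume.restrict (openRect a b)) (volume.restrict (openRect a' b')) := by
  have := S.measurePreserving.restrict_preimage (measurableSet_openRect a' b')
  rwa [show S.map ⁻¹' openRect a' b' = openRect a b from Set.ext S.mem_iff] at this

theorem setIntegral_comp (S : PageSym a b a' b') (f : ℝ × ℝ → ℂ) :
    ∫ z in openRect a b, f (S.map z) = ∫ z in openRect a' b', f z :=
  S.measurePreserving_rect.integral_comp S.measurableEmbedding_map f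

theorem setLIntegral_comp (S : PageSym a b a' b') (f : ℝ × ℝ → ℝ≥0∞) :
    ∫⁻ z in openRect a b, f (S.map z) = ∫⁻ z in openRect a' b', f z :=
  S.measurePreserving_rect.lintegral_comp_emb S.measurableEmbedding_map f

theorem fderiv_eq (S : PageSym a b a' b') {φ : ℝ × ℝ → ℝ} (hφ : ContDiff ℝ (⊤ : ℕ∞) φ) (i : Bool)
    (z : ℝ × ℝ) : fderiv ℝ φ z (axisDir i) =
      S.sgn i * fderiv ℝ (fun w => φ (S.inv w)) (S.map z) (axisDir (S.idx i)) := by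
  have h1 : Differentiable ℝ fun w => φ (S.inv w) :=
    (hφ.comp S.contDiff_inv).differentiable (by simp)
  have h2 := (h1 (S.map z)).hasFDerivAt.comp z (S.hasFDerivAt z)
  have h3 : ((fun w => φ (S.inv w)) ∘ S.map) = φ := by
    funext w; simp [S.left_inv]
  rw [h3] at h2
  rw [h2.fderiv, ContinuousLinearMap.comp_apply, S.lin_dir, map_smul, smul_eq_mul]

theorem tsupport_comp_inv (S : PageSym a b a' b') (φ : ℝ × ℝ → ℝ) {z : ℝ × ℝ} :
    S.map z ∈ tsupport (fun w => φ (S.inv w)) ↔ z ∈ tsupport φ := by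
  have h := tsupport_comp_eq_preimage φ S.homeo.symm
  change tsupport (fun w => φ (S.inv w)) = S.inv ⁻¹' _ at h
  rw [h, Set.mem_preimage, S.left_inv]

theorem hasCompactSupport_comp_inv (S : PageSym a b a' b') {φ : ℝ × ℝ → ℝ}
    (h : HasCompactSupport φ) : HasCompactSupport fun w => φ (S.inv w) :=
  h.comp_homeomorph S.homeo.symm

/-- Test functions are transported by the inverse symmetry. The chain rule turns a coordinate
direction into plus or minus a coordinate direction, and areas are preserved. -/
theorem isWeakDeriv_pull (S : PageSym a b a' b') {i : Bool} {u v : ℝ × ℝ → ℂ}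
    (h : IsWeakDeriv (openRect a' b') (axisDir (S.idx i)) u v) :
    IsWeakDeriv (openRect a b) (axisDir i) (fun z => u (S.map z))
      (fun z => S.sgn i • v (S.map z)) := by
  intro φ h1 h2 h3
  have h4 := h (fun w => φ (S.inv w)) (h1.comp S.contDiff_inv) (S.hasCompactSupport_comp_inv h2)
    (by
      intro w hw
      rw [← S.right_inv w] at hw ⊢
      exact (S.mem_iff _).2 (h3 ((S.tsupport_comp_inv φ).1 hw)))
  have e1 : ∫ z in openRect a b, fderiv ℝ φ z (axisDir i) • u (S.map z) =
      S.sgn i • ∫ w in openRect a' b', fderiv ℝ (fun w => φ (S.inv w)) w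
        (axisDir (S.idx i)) • u w := by
    rw [← S.setIntegral_comp, ← integral_smul]
    refine integral_congr_ae (Eventually.of_forall fun z => ?_)
    simp only [S.fderiv_eq h1 i z, mul_smul]
  have e2 : ∫ z in openRect a b, φ z • S.sgn i • v (S.map z) =
      S.sgn i • ∫ w in openRect a' b', φ (S.inv w) • v w := by
    rw [← S.setIntegral_comp, ← integral_smul]
    refine integral_congr_ae (Eventually.of_forall fun z => ?_)
    simp only [S.left_inv]
    rw [smul_comm]
  rw [e1, e2, h4, smul_neg]

theorem green_pull (S : PageSym a b a' b') (i : Bool) (u v : ℝ × ℝ → ℂ) {φ : ℝ × ℝ → ℝ}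
    (hφ : ContDiff ℝ (⊤ : ℕ∞) φ) :
    ∫ z in openRect a b, (fderiv ℝ φ z (axisDir i) • u (S.map z) +
        φ z • S.sgn i • v (S.map z)) =
      S.sgn i • ∫ w in openRect a' b', (fderiv ℝ (fun w => φ (S.inv w)) w
        (axisDir (S.idx i)) • u w + φ (S.inv w) • v w) := by
  rw [← S.setIntegral_comp, ← integral_smul]
  refine integral_congr_ae (Eventually.of_forall fun z => ?_)
  simp only [S.fderiv_eq hφ i z, mul_smul, S.left_inv, smul_add]
  rw [smul_comm (φ z)]

/-- Traces are transported by symmetries. -/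
theorem isTrace_pull (S : PageSym a b a' b') {U : Fin 3 → ℝ × ℝ → ℂ} {s : PageSide} {g : ℝ → ℂ}
    (hs : s.Present a b) (h : IsTrace a' b' (U 0) (U 1) (U 2) (S.side s) g) :
    IsTrace a b (S.pull U 0) (S.pull U 1) (S.pull U 2) s
      (fun t => g (flipIf (S.rev s) (s.length a b) t)) := by
  obtain ⟨hg, hG⟩ := h
  rw [S.length_eq] at hg
  have hmp := measurePreserving_flipIf_openSeg (S.rev_finite s)
  refine ⟨hg.comp_measurePreserving hmp, fun φ h1 h2 h3 => ?_⟩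
  -- The transported test function must vanish near the other sides of the image; this holds because
  -- a symmetry permutes the sides.
  have h4 := hG (fun w => φ (S.inv w)) (h1.comp S.contDiff_inv) (S.hasCompactSupport_comp_inv h2)
    (by
      intro s' hs' hne t ht
      obtain ⟨r, hr, rfl⟩ := S.side_surj s' hs'
      have h5 : flipIf (S.rev r) (r.length a b) t ∈ closedSeg (r.length a b) :=
        (flipIf_mem_closedSeg (S.rev_finite r)).2 (by rwa [S.length_eq] at ht)
      have h6 := h3 r hr (by rintro rfl; exact hne rfl) _ h5
      have h7 := S.point_eq r (flipIf (S.rev r) (r.length a b) t) hr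
      rw [flipIf_flipIf] at h7
      rw [← h7, S.tsupport_comp_inv]
      exact h6)
  have hG' : ∀ i, ∫ w in openRect a' b', (fderiv ℝ (fun w => φ (S.inv w)) w (axisDir i) • U 0 w +
      φ (S.inv w) • gradComp U i w) = (S.side s).normalComp i •
      ∫ t in openSeg (s.length a b), φ (S.inv ((S.side s).point a' b' t)) • g t := by
    intro i
    rw [S.length_eq] at h4
    cases i
    · exact h4.1
    · exact h4.2
  have e : ∫ t in openSeg (s.length a b), φ (S.inv ((S.side s).point a' b' t)) • g t =
      ∫ t in openSeg (s.length a b), φ (s.point a b t) •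
        g (flipIf (S.rev s) (s.length a b) t) := by
    rw [← hmp.integral_comp (measurableEmbedding_flipIf _ _)]
    refine integral_congr_ae (Eventually.of_forall fun t => ?_)
    simp only [← S.point_eq s t hs, S.left_inv]
  have key : ∀ i, ∫ z in openRect a b, (fderiv ℝ φ z (axisDir i) • U 0 (S.map z) +
        φ z • S.sgn i • gradComp U (S.idx i) (S.map z)) = s.normalComp i •
      ∫ t in openSeg (s.length a b), φ (s.point a b t) •
        g (flipIf (S.rev s) (s.length a b) t) := by
    intro i
    rw [S.green_pull i _ _ h1, hG', e, smul_smul, S.normal_eq s i]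
  exact ⟨key false, key true⟩

theorem enorm_sgn_smul (S : PageSym a b a' b') (i : Bool) (w : ℂ) : ‖S.sgn i • w‖ₑ = ‖w‖ₑ := by
  rw [enorm_smul, Real.enorm_eq_ofReal_abs, S.abs_sgn, ENNReal.ofReal_one, one_mul]

theorem grad_pull (S : PageSym a b a' b') (U : Fin 3 → ℝ × ℝ → ℂ) (z : ℝ × ℝ) :
    ‖S.pull U 1 z‖ₑ ^ (2 : ℝ) + ‖S.pull U 2 z‖ₑ ^ (2 : ℝ) =
      ‖U 1 (S.map z)‖ₑ ^ (2 : ℝ) + ‖U 2 (S.map z)‖ₑ ^ (2 : ℝ) := by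
  change ‖S.sgn false • gradComp U (S.idx false) (S.map z)‖ₑ ^ (2 : ℝ) +
    ‖S.sgn true • gradComp U (S.idx true) (S.map z)‖ₑ ^ (2 : ℝ) = _
  rw [enorm_sgn_smul, enorm_sgn_smul, S.idx_inj]
  cases S.idx false
  · rfl
  · exact add_comm _ _

theorem aestronglyMeasurable_pull (S : PageSym a b a' b') {U : Fin 3 → ℝ × ℝ → ℂ}
    (hU : ∀ i, AEStronglyMeasurable (U i) (volume.restrict (openRect a' b'))) (i : Fin 3) :
    AEStronglyMeasurable (S.pull U i) (volume.restrict (openRect a b)) := by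
  have h : ∀ i, AEStronglyMeasurable (fun z => U i (S.map z)) (volume.restrict (openRect a b)) :=
    fun i => (hU i).comp_measurePreserving S.measurePreserving_rect
  have h' : ∀ i, AEStronglyMeasurable (fun z => gradComp U i (S.map z))
      (volume.restrict (openRect a b)) := by
    intro i; cases i
    exacts [h 1, h 2]
  fin_cases i
  · exact h 0
  · exact (h' (S.idx false)).const_smul (S.sgn false)
  · exact (h' (S.idx true)).const_smul (S.sgn true)

/-- The identity. -/
def refl (a b : ℝ≥0∞) : PageSym a b a b where
  map := id
  inv := id
  lin := ContinuousLinearMap.id ℝ _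
  left_inv _ := rfl
  right_inv _ := rfl
  hasFDerivAt z := hasFDerivAt_id z
  contDiff_inv := contDiff_id
  measurePreserving := MeasurePreserving.id _
  mem_iff _ := Iff.rfl
  sgn _ := 1
  idx := id
  lin_dir _ := by simp
  abs_sgn _ := by simp
  idx_inj := rfl
  side := id
  rev _ := false
  present _ h := h
  side_surj s h := ⟨s, h, rfl⟩
  length_eq _ := rfl
  rev_finite _ h := by simp at h
  point_eq _ _ _ := rfl
  normal_eq _ _ := by simp
  dims := Or.inl ⟨rfl, rfl⟩
  bump_eq _ := rfl

/-- The composition of symmetries. -/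
def comp (S' : PageSym a' b' a'' b'') (S : PageSym a b a' b') : PageSym a b a'' b'' where
  map z := S'.map (S.map z)
  inv z := S.inv (S'.inv z)
  lin := S'.lin.comp S.lin
  left_inv z := by rw [S'.left_inv, S.left_inv]
  right_inv z := by rw [S.right_inv, S'.right_inv]
  hasFDerivAt z := (S'.hasFDerivAt _).comp z (S.hasFDerivAt z)
  contDiff_inv := S.contDiff_inv.comp S'.contDiff_inv
  measurePreserving := S'.measurePreserving.comp S.measurePreserving
  mem_iff z := by rw [S'.mem_iff, S.mem_iff]
  sgn i := S.sgn i * S'.sgn (S.idx i)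
  idx i := S'.idx (S.idx i)
  lin_dir i := by
    rw [ContinuousLinearMap.comp_apply, S.lin_dir, map_smul, S'.lin_dir, smul_smul]
  abs_sgn i := by rw [abs_mul, S.abs_sgn, S'.abs_sgn, one_mul]
  idx_inj := by
    rw [S.idx_inj]
    cases S.idx false
    · exact S'.idx_inj
    · simp [S'.idx_inj]
  side s := S'.side (S.side s)
  rev s := xor (S.rev s) (S'.rev (S.side s))
  present s h := S'.present _ (S.present s h)
  side_surj s'' h := by
    obtain ⟨s', h', rfl⟩ := S'.side_surj s'' h
    obtain ⟨s, hs, rfl⟩ := S.side_surj s' h'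
    exact ⟨s, hs, rfl⟩
  length_eq s := by rw [S'.length_eq, S.length_eq]
  rev_finite s h := by
    rcases hr : S.rev s with _ | _
    · rw [hr] at h
      rw [← S.length_eq]
      exact S'.rev_finite _ (by simpa using h)
    · exact S.rev_finite s hr
  point_eq s t h := by
    rw [S.point_eq s t h, S'.point_eq _ _ (S.present s h), S.length_eq, flipIf_xor]
  normal_eq s i := by rw [S.normal_eq, S'.normal_eq, mul_assoc]
  dims := by
    rcases S.dims with ⟨h1, h2⟩ | ⟨h1, h2⟩ <;> rcases S'.dims with ⟨h3, h4⟩ | ⟨h3, h4⟩ <;>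
      simp [h1, h2, h3, h4]
  bump_eq z := by rw [S'.bump_eq, S.bump_eq]

/-- The exchange of the coordinates. -/
def swap (a b : ℝ≥0∞) : PageSym a b b a where
  map z := (z.2, z.1)
  inv z := (z.2, z.1)
  lin := (ContinuousLinearMap.snd ℝ ℝ ℝ).prod (ContinuousLinearMap.fst ℝ ℝ ℝ)
  left_inv _ := rfl
  right_inv _ := rfl
  hasFDerivAt z := ((ContinuousLinearMap.snd ℝ ℝ ℝ).prod
    (ContinuousLinearMap.fst ℝ ℝ ℝ)).hasFDerivAt
  contDiff_inv := contDiff_snd.prodMk contDiff_fst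
  measurePreserving := Measure.measurePreserving_swap
  mem_iff z := ⟨fun h => ⟨h.2, h.1⟩, fun h => ⟨h.2, h.1⟩⟩
  sgn _ := 1
  idx i := !i
  lin_dir i := by cases i <;> simp [axisDir]
  abs_sgn _ := by simp
  idx_inj := rfl
  side
    | .west => .south
    | .east => .north
    | .south => .west
    | .north => .east
  rev _ := false
  present s h := by cases s <;> exact h
  side_surj s h := by
    cases s
    exacts [⟨.south, h, rfl⟩, ⟨.north, h, rfl⟩, ⟨.west, h, rfl⟩, ⟨.east, h, rfl⟩]
  length_eq s := by cases s <;> rfl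
  rev_finite _ h := by simp at h
  point_eq s t _ := by cases s <;> rfl
  normal_eq s i := by
    cases s <;> cases i <;> simp [PageSide.normalComp, PageSide.normal]
  dims := Or.inr ⟨rfl, rfl⟩
  bump_eq z := mul_comm _ _

/-- The reflection in the first coordinate. -/
def reflX (a b : ℝ≥0∞) (ha : a ≠ ⊤) : PageSym a b a b where
  map z := (a.toReal - z.1, z.2)
  inv z := (a.toReal - z.1, z.2)
  lin := (-ContinuousLinearMap.fst ℝ ℝ ℝ).prod (ContinuousLinearMap.snd ℝ ℝ ℝ)
  left_inv z := by simp
  right_inv z := by simp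
  hasFDerivAt z := by
    have h1 : HasFDerivAt (fun z : ℝ × ℝ => a.toReal - z.1) (-ContinuousLinearMap.fst ℝ ℝ ℝ) z :=
      (ContinuousLinearMap.fst ℝ ℝ ℝ).hasFDerivAt.const_sub a.toReal
    exact h1.prodMk (ContinuousLinearMap.snd ℝ ℝ ℝ).hasFDerivAt
  contDiff_inv := (contDiff_const.sub contDiff_fst).prodMk contDiff_snd
  measurePreserving :=
    (Measure.measurePreserving_sub_left volume a.toReal).prod (MeasurePreserving.id _)
  mem_iff z := by
    have := flipIf_mem_openSeg (r := true) (ℓ := a) (t := z.1) fun _ => ha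
    simp only [flipIf, if_true] at this
    simp only [openRect, Set.mem_prod, this]
  sgn i := if i then 1 else -1
  idx := id
  lin_dir i := by cases i <;> simp [axisDir]
  abs_sgn i := by cases i <;> simp
  idx_inj := rfl
  side
    | .west => .east
    | .east => .west
    | .south => .south
    | .north => .north
  rev
    | .west => false
    | .east => false
    | .south => true
    | .north => true
  present s h := by
    cases s
    exacts [ha, trivial, trivial, h]
  side_surj s h := by
    cases s
    exacts [⟨.east, ha, rfl⟩, ⟨.west, trivial, rfl⟩, ⟨.south, trivial, rfl⟩, ⟨.north, h, rfl⟩]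
  length_eq s := by cases s <;> rfl
  rev_finite s h := by
    cases s
    exacts [by simp at h, by simp at h, ha, ha]
  point_eq s t _ := by
    cases s <;> simp [PageSide.point, flipIf, PageSide.length]
  normal_eq s i := by
    cases s <;> cases i <;> simp [PageSide.normalComp, PageSide.normal]
  dims := Or.inl ⟨rfl, rfl⟩
  bump_eq z := by
    simp only [segBump, ha, if_false]
    ring

/-- The reflection in the second coordinate. -/
def reflY (a b : ℝ≥0∞) (hb : b ≠ ⊤) : PageSym a b a b :=
  (swap b a).comp ((reflX b a hb).comp (swap a b))

end PageSym

end

noncomputable section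

/-! ### Traces -/

theorem IsTrace.congr {a b : ℝ≥0∞} {u ux uy u' ux' uy' : ℝ × ℝ → ℂ} {s : PageSide} {g g' : ℝ → ℂ}
    (h : IsTrace a b u ux uy s g) (hu : u =ᵐ[volume.restrict (openRect a b)] u')
    (hx : ux =ᵐ[volume.restrict (openRect a b)] ux')
    (hy : uy =ᵐ[volume.restrict (openRect a b)] uy')
    (hg : g =ᵐ[volume.restrict (openSeg (s.length a b))] g') :
    IsTrace a b u' ux' uy' s g' := by
  obtain ⟨h1, h2⟩ := h
  refine ⟨h1.ae_eq hg, fun φ p1 p2 p3 => ?_⟩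
  have h3 := h2 φ p1 p2 p3
  have e0 : ∫ t in openSeg (s.length a b), φ (s.point a b t) • g t =
      ∫ t in openSeg (s.length a b), φ (s.point a b t) • g' t :=
    integral_congr_ae (by filter_upwards [hg] with t ht; rw [ht])
  have e1 : ∫ z in openRect a b, (fderiv ℝ φ z (1, 0) • u z + φ z • ux z) =
      ∫ z in openRect a b, (fderiv ℝ φ z (1, 0) • u' z + φ z • ux' z) :=
    integral_congr_ae (by filter_upwards [hu, hx] with t ht ht'; rw [ht, ht'])
  have e2 : ∫ z in openRect a b, (fderiv ℝ φ z (0, 1) • u z + φ z • uy z) =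
      ∫ z in openRect a b, (fderiv ℝ φ z (0, 1) • u' z + φ z • uy' z) :=
    integral_congr_ae (by filter_upwards [hu, hy] with t ht ht'; rw [ht, ht'])
  rw [← e0, ← e1, ← e2]
  exact h3

/-- A smooth cut-off function on the line. -/
def cutoff (h : ℝ) (hh : 0 < h) : ContDiffBump (0 : ℝ) where
  rIn := h / 2
  rOut := h
  rIn_pos := by linarith
  rIn_lt_rOut := by linarith

theorem memLp_two_smul_lintegral_lt_top {f : ℝ → ℝ} (hf : Continuous f) (hc : HasCompactSupport f) :
    ∫⁻ x, ‖f x‖ₑ ^ 2 < ⊤ := by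
  have h := (hf.memLp_of_hasCompactSupport hc (p := 2) (μ := volume)).ofReal (K := ℂ)
  have h2 := (memLp_two_iff.1 h).2
  refine lt_of_le_of_lt (le_of_eq (lintegral_congr fun x => ?_)) h2
  rw [ENNReal.rpow_ofNat, RCLike.ofReal_eq_complex_ofReal, ← ofReal_norm (f x),
    ← ofReal_norm ((f x : ℝ) : ℂ), Complex.norm_real]

/-- The products `χ(x) ψ(y)` are allowed in Green's formula for the west side: `χ` vanishes before
the east side is reached, and `ψ` vanishes near both endpoints. -/
theorem not_point_mem_of_subset {a b : ℝ≥0∞} {h : ℝ} (hh : 0 < h) (ha : ENNReal.ofReal h < a)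
    {ψ : ℝ → ℝ} (hψ : tsupport ψ ⊆ openSeg b) :
    ∀ s' : PageSide, s'.Present a b → s' ≠ .west → ∀ t ∈ closedSeg (s'.length a b),
      s'.point a b t ∉ tsupport fun z : ℝ × ℝ => cutoff h hh z.1 * ψ z.2 := by
  have hsub : (tsupport fun z : ℝ × ℝ => cutoff h hh z.1 * ψ z.2) ⊆
      Metric.closedBall 0 h ×ˢ tsupport ψ := by
    refine closure_minimal ?_ (Metric.isClosed_closedBall.prod (isClosed_tsupport ψ))
    intro z hz
    have h1 : cutoff h hh z.1 ≠ 0 := left_ne_zero_of_mul hz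
    have h2 : ψ z.2 ≠ 0 := right_ne_zero_of_mul hz
    refine ⟨?_, subset_tsupport _ h2⟩
    have : z.1 ∈ Function.support (cutoff h hh) := h1
    rw [(cutoff h hh).support_eq] at this
    exact Metric.ball_subset_closedBall this
  intro s' hs' hne t _ hmem
  have h3 := hsub hmem
  cases s' with
  | west => exact hne rfl
  | east =>
    have h4 := h3.1
    have hlt : h < a.toReal := (ENNReal.ofReal_lt_iff_lt_toReal hh.le hs').1 ha
    simp only [PageSide.point, mem_closedBall_zero_iff, Real.norm_eq_abs] at h4
    linarith [le_abs_self a.toReal]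
  | south =>
    have h4 := (hψ h3.2).1
    simp [PageSide.point] at h4
  | north =>
    have h4 := (hψ h3.2).2
    have hb : b ≠ ⊤ := hs'
    simp [PageSide.point, ENNReal.ofReal_toReal hb] at h4

/-- The trace on the west side is bounded by the `H¹` norm. -/
theorem exists_trace_bound_west {a : ℝ≥0∞} (ha0 : 0 < a) (b : ℝ≥0∞) :
    ∃ C : ℝ≥0∞, C ≠ ⊤ ∧ ∀ (u ux uy : ℝ × ℝ → ℂ) (g : ℝ → ℂ),
      MemLp u 2 (volume.restrict (openRect a b)) → MemLp ux 2 (volume.restrict (openRect a b)) →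
      IsTrace a b u ux uy .west g →
      ∫⁻ t in openSeg b, ‖g t‖ₑ ^ 2 ≤
        C * ((∫⁻ z in openRect a b, ‖u z‖ₑ ^ 2) + ∫⁻ z in openRect a b, ‖ux z‖ₑ ^ 2) := by
  obtain ⟨h, hh, ha⟩ : ∃ h : ℝ, 0 < h ∧ ENNReal.ofReal h < a := by
    obtain ⟨r, hr0, hr⟩ := ENNReal.lt_iff_exists_nnreal_btwn.1 ha0
    exact ⟨r, by exact_mod_cast hr0, by simpa using hr⟩
  set χ := cutoff h hh
  have hχs : ContDiff ℝ (⊤ : ℕ∞) χ := χ.contDiff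
  have hχd : ∀ x, HasDerivAt χ (deriv χ x) x := fun x =>
    (hχs.differentiable (by simp) x).hasDerivAt
  have hχc : Continuous χ := hχs.continuous
  have hχ'c : Continuous (deriv χ) := hχs.continuous_deriv (by simp)
  set D0 := ∫⁻ x, ‖χ x‖ₑ ^ 2
  set D1 := ∫⁻ x, ‖deriv χ x‖ₑ ^ 2
  have hD0 : D0 < ⊤ := memLp_two_smul_lintegral_lt_top hχc χ.hasCompactSupport
  have hD1 : D1 < ⊤ := memLp_two_smul_lintegral_lt_top hχ'c χ.hasCompactSupport.deriv
  refine ⟨2 * (D0 + D1), ENNReal.mul_ne_top (by simp) (ENNReal.add_lt_top.2 ⟨hD0, hD1⟩).ne, ?_⟩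
  intro u ux uy g hu hux htr
  -- Integrals over individual horizontal lines are used below, so genuinely measurable
  -- representatives are needed.
  wlog hm : Measurable u ∧ Measurable ux generalizing u ux with H
  · have mu := hu.aestronglyMeasurable
    have mx := hux.aestronglyMeasurable
    have := H (mu.mk u) (mx.mk ux) (hu.ae_eq mu.ae_eq_mk) (hux.ae_eq mx.ae_eq_mk)
      (htr.congr mu.ae_eq_mk mx.ae_eq_mk (ae_eq_refl uy) (ae_eq_refl g))
      ⟨mu.stronglyMeasurable_mk.measurable, mx.stronglyMeasurable_mk.measurable⟩
    refine this.trans (le_of_eq ?_)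
    congr 2
    · exact lintegral_congr_ae (by filter_upwards [mu.ae_eq_mk] with z hz; rw [hz])
    · exact lintegral_congr_ae (by filter_upwards [mx.ae_eq_mk] with z hz; rw [hz])
  obtain ⟨mu, mx⟩ := hm
  obtain ⟨hg, hG⟩ := htr
  simp only [PageSide.length] at hg
  set F : ℝ × ℝ → ℂ := fun z => deriv χ z.1 • u z + χ z.1 • ux z
  have mF : Measurable F :=
    ((hχ'c.measurable.comp measurable_fst).smul mu).add ((hχc.measurable.comp measurable_fst).smul mx)
  -- The integrand is the derivative in `x` of `χ u`. Since `χ` is one at `0` and vanishes beyond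
  -- `h`, the integral `K` should be minus the trace; its `L²` norm is easy to bound by
  -- Cauchy-Schwarz on each line.
  set K : ℝ → ℂ := fun t => ∫ x in openSeg a, F (x, t)
  have mK : StronglyMeasurable K := mF.stronglyMeasurable.integral_prod_left
  have hKpt : ∀ t, ‖K t‖ₑ ^ 2 ≤ 2 * (D0 + D1) *
      ((∫⁻ x in openSeg a, ‖u (x, t)‖ₑ ^ 2) + ∫⁻ x in openSeg a, ‖ux (x, t)‖ₑ ^ 2) := by
    intro t
    have mu' : Measurable fun x => ‖u (x, t)‖ₑ := (mu.comp (by fun_prop)).enorm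
    have mx' : Measurable fun x => ‖ux (x, t)‖ₑ := (mx.comp (by fun_prop)).enorm
    have m0 : Measurable fun x => ‖χ x‖ₑ := hχc.measurable.enorm
    have m1 : Measurable fun x => ‖deriv χ x‖ₑ := hχ'c.measurable.enorm
    calc ‖K t‖ₑ ^ 2 ≤ ((∫⁻ x in openSeg a, ‖deriv χ x‖ₑ * ‖u (x, t)‖ₑ) +
          ∫⁻ x in openSeg a, ‖χ x‖ₑ * ‖ux (x, t)‖ₑ) ^ 2 := by
          gcongr
          refine (enorm_integral_le_lintegral_enorm _).trans ?_
          rw [← lintegral_add_left (f := fun x => ‖deriv χ x‖ₑ * ‖u (x, t)‖ₑ) (m1.mul mu')]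
          refine lintegral_mono fun x => ?_
          exact (enorm_add_le _ _).trans (le_of_eq (by rw [enorm_smul, enorm_smul]))
      _ ≤ 2 * ((∫⁻ x in openSeg a, ‖deriv χ x‖ₑ * ‖u (x, t)‖ₑ) ^ 2 +
          (∫⁻ x in openSeg a, ‖χ x‖ₑ * ‖ux (x, t)‖ₑ) ^ 2) := ennreal_add_sq_le _ _
      _ ≤ 2 * (D1 * (∫⁻ x in openSeg a, ‖u (x, t)‖ₑ ^ 2) +
          D0 * ∫⁻ x in openSeg a, ‖ux (x, t)‖ₑ ^ 2) := by
          gcongr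
          · refine (lintegral_mul_sq_le m1.aemeasurable mu'.aemeasurable).trans ?_
            gcongr
            exact setLIntegral_le_lintegral _ _
          · refine (lintegral_mul_sq_le m0.aemeasurable mx'.aemeasurable).trans ?_
            gcongr
            exact setLIntegral_le_lintegral _ _
      _ ≤ 2 * ((D0 + D1) * (∫⁻ x in openSeg a, ‖u (x, t)‖ₑ ^ 2) +
          (D0 + D1) * ∫⁻ x in openSeg a, ‖ux (x, t)‖ₑ ^ 2) := by
          gcongr
          · exact le_add_self
          · exact le_self_add
      _ = _ := by ring
  have hK : ∫⁻ t in openSeg b, ‖K t‖ₑ ^ 2 ≤ 2 * (D0 + D1) *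
      ((∫⁻ z in openRect a b, ‖u z‖ₑ ^ 2) + ∫⁻ z in openRect a b, ‖ux z‖ₑ ^ 2) := by
    have mu2 : Measurable fun z => ‖u z‖ₑ ^ 2 := mu.enorm.pow_const 2
    have mx2 : Measurable fun z => ‖ux z‖ₑ ^ 2 := mx.enorm.pow_const 2
    refine (lintegral_mono hKpt).trans (le_of_eq ?_)
    rw [lintegral_const_mul _ (f := fun t => (∫⁻ x in openSeg a, ‖u (x, t)‖ₑ ^ 2) +
        ∫⁻ x in openSeg a, ‖ux (x, t)‖ₑ ^ 2)
        (mu2.lintegral_prod_left'.add mx2.lintegral_prod_left'),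
      lintegral_add_left mu2.lintegral_prod_left', openRect, setLIntegral_box_symm _ _ mu2,
      setLIntegral_box_symm _ _ mx2]
  have hfin : ∀ {f : ℝ × ℝ → ℂ}, MemLp f 2 (volume.restrict (openRect a b)) →
      ∫⁻ z in openRect a b, ‖f z‖ₑ ^ 2 < ⊤ := by
    intro f hf
    simpa using (memLp_two_iff.1 hf).2
  have hKmem : MemLp K 2 (volume.restrict (openSeg b)) := by
    refine memLp_two_iff.2 ⟨mK.aestronglyMeasurable, ?_⟩
    refine lt_of_le_of_lt (by simpa using hK) ?_
    exact ENNReal.mul_lt_top (ENNReal.mul_lt_top (by simp) (ENNReal.add_lt_top.2 ⟨hD0, hD1⟩))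
      (ENNReal.add_lt_top.2 ⟨hfin hu, hfin hux⟩)
  have hsum := hKmem.add hg
  -- Green's formula with the test functions `χ(x) ψ(y)` says that `K + g` annihilates every smooth
  -- `ψ` with compact support in the open segment.
  have hzero : ∀ᵐ t, t ∈ openSeg b → (K + g) t = 0 := by
    refine (isOpen_openSeg b).ae_eq_zero_of_integral_contDiff_smul_eq_zero ?_ ?_
    · exact locallyIntegrableOn_of_locallyIntegrable_restrict
        (hsum.locallyIntegrable (by norm_num))
    · intro ψ p1 p2 p3
      have hφ : ContDiff ℝ (⊤ : ℕ∞) fun z : ℝ × ℝ => χ z.1 * ψ z.2 :=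
        (hχs.comp contDiff_fst).mul (p1.comp contDiff_snd)
      have hφc : HasCompactSupport fun z : ℝ × ℝ => χ z.1 * ψ z.2 := by
        refine HasCompactSupport.of_support_subset_isCompact
          (χ.hasCompactSupport.isCompact.prod p2.isCompact) ?_
        intro z hz
        exact ⟨subset_tsupport _ (left_ne_zero_of_mul hz), subset_tsupport _ (right_ne_zero_of_mul hz)⟩
      have hφd : ∀ z : ℝ × ℝ, fderiv ℝ (fun z : ℝ × ℝ => χ z.1 * ψ z.2) z (1, 0)
          = deriv χ z.1 * ψ z.2 := by
        intro z
        have h1 : HasFDerivAt (fun z : ℝ × ℝ => χ z.1)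
            (deriv χ z.1 • ContinuousLinearMap.fst ℝ ℝ ℝ) z :=
          (hχd z.1).comp_hasFDerivAt z hasFDerivAt_fst
        have h2 : HasFDerivAt (fun z : ℝ × ℝ => ψ z.2)
            (deriv ψ z.2 • ContinuousLinearMap.snd ℝ ℝ ℝ) z :=
          ((p1.differentiable (by simp) z.2).hasDerivAt).comp_hasFDerivAt z hasFDerivAt_snd
        have h3 := (h1.mul h2).fderiv
        change fderiv ℝ (fun z : ℝ × ℝ => χ z.1 * ψ z.2) z = _ at h3
        rw [h3]
        simp [mul_comm]
      have hgreen := (hG _ hφ hφc (not_point_mem_of_subset hh ha p3)).1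
      have hχ0 : χ 0 = 1 := χ.one_of_mem_closedBall (by simp [χ.rIn_pos.le])
      simp only [PageSide.normal, PageSide.length, PageSide.point, hφd, hχ0, one_mul] at hgreen
      have hL : ∫ z in openRect a b, ((deriv χ z.1 * ψ z.2) • u z + (χ z.1 * ψ z.2) • ux z)
          = ∫ t in openSeg b, ψ t • K t := by
        have hi : Integrable (fun z : ℝ × ℝ => (deriv χ z.1 * ψ z.2) • u z +
            (χ z.1 * ψ z.2) • ux z) (volume.restrict (openRect a b)) := by
          have m1 := memLp_of_contDiff hφ hφc (volume.restrict (openRect a b))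
          have m2 := memLp_fderiv_of_contDiff hφ hφc (1, 0) (volume.restrict (openRect a b))
          simp only [hφd] at m2
          exact (MemLp.integrable_smul_of_memLp m2 hu).add (MemLp.integrable_smul_of_memLp m1 hux)
        rw [openRect, Measure.volume_eq_prod, ← Measure.prod_restrict] at hi ⊢
        rw [integral_prod_symm _ hi]
        refine integral_congr_ae (Eventually.of_forall fun t => ?_)
        simp only [K]
        rw [← integral_smul]
        refine integral_congr_ae (Eventually.of_forall fun x => ?_)
        simp only [F, smul_add, smul_smul, mul_comm]
      rw [hL] at hgreen
      have hψ2 : MemLp ψ 2 (volume.restrict (openSeg b)) :=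
        p1.continuous.memLp_of_hasCompactSupport p2
      have i1 : Integrable (fun t => ψ t • K t) (volume.restrict (openSeg b)) :=
        memLp_one_iff_integrable.1 (hKmem.smul (r := 1) hψ2)
      have i2 : Integrable (fun t => ψ t • g t) (volume.restrict (openSeg b)) :=
        memLp_one_iff_integrable.1 (hg.smul (r := 1) hψ2)
      rw [← setIntegral_eq_integral_of_forall_compl_eq_zero (s := openSeg b)]
      · simp only [Pi.add_apply, smul_add]
        rw [integral_add i1 i2, hgreen]
        simp
      · intro t ht
        rw [image_eq_zero_of_notMem_tsupport fun ht' => ht (p3 ht'), zero_smul]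
  refine le_trans (le_of_eq ?_) hK
  refine setLIntegral_congr_fun_ae (measurableSet_openSeg b) ?_
  filter_upwards [hzero] with t ht htm
  have h1 := ht htm
  simp only [Pi.add_apply] at h1
  rw [eq_neg_of_add_eq_zero_left h1, enorm_neg]

/-- The trace on any side is bounded by the `H¹` norm. -/
theorem exists_trace_bound {a b : ℝ≥0∞} (ha0 : 0 < a) (hb0 : 0 < b) {s : PageSide}
    (hs : s.Present a b) :
    ∃ C : ℝ≥0∞, C ≠ ⊤ ∧ ∀ (U : Fin 3 → ℝ × ℝ → ℂ) (g : ℝ → ℂ),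
      (∀ i, MemLp (U i) 2 (volume.restrict (openRect a b))) →
      IsTrace a b (U 0) (U 1) (U 2) s g →
      ∫⁻ t in openSeg (s.length a b), ‖g t‖ₑ ^ 2 ≤
        C * ∑ i, ∫⁻ z in openRect a b, ‖U i z‖ₑ ^ 2 := by
  -- Any side is carried to the west side by a symmetry. Reflections and the exchange of coordinates
  -- mix the gradient components only up to order and sign, so the full gradient on the right-hand
  -- side absorbs them.
  have gen : ∀ {c d : ℝ≥0∞} (S : PageSym c d a b), 0 < c → S.side .west = s →
      S.rev .west = false → ∃ C : ℝ≥0∞, C ≠ ⊤ ∧ ∀ (U : Fin 3 → ℝ × ℝ → ℂ) (g : ℝ → ℂ),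
      (∀ i, MemLp (U i) 2 (volume.restrict (openRect a b))) →
      IsTrace a b (U 0) (U 1) (U 2) s g →
      ∫⁻ t in openSeg (s.length a b), ‖g t‖ₑ ^ 2 ≤
        C * ∑ i, ∫⁻ z in openRect a b, ‖U i z‖ₑ ^ 2 := by
    intro c d S hc hS hr
    obtain ⟨C, hC, hb⟩ := exists_trace_bound_west hc d
    refine ⟨C, hC, fun U g hU htr => ?_⟩
    have hlen : s.length a b = d := by rw [← hS, S.length_eq]; rfl
    have h1 := S.isTrace_pull (s := .west) (g := g) trivial (hS ▸ htr)
    simp only [hr, flipIf] at h1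
    have hm := S.aestronglyMeasurable_pull fun i => (hU i).aestronglyMeasurable
    have e0 : ∫⁻ z in openRect c d, ‖S.pull U 0 z‖ₑ ^ (2 : ℝ) =
        ∫⁻ z in openRect a b, ‖U 0 z‖ₑ ^ (2 : ℝ) :=
      S.setLIntegral_comp fun z => ‖U 0 z‖ₑ ^ (2 : ℝ)
    have e1 : ∫⁻ z in openRect c d, ‖S.pull U 1 z‖ₑ ^ (2 : ℝ) ≤
        (∫⁻ z in openRect a b, ‖U 1 z‖ₑ ^ (2 : ℝ)) + ∫⁻ z in openRect a b, ‖U 2 z‖ₑ ^ (2 : ℝ) := by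
      rw [← lintegral_add_left' ((hU 1).aestronglyMeasurable.enorm.pow_const _),
        ← S.setLIntegral_comp]
      refine lintegral_mono fun z => ?_
      rw [← S.grad_pull]
      exact le_self_add
    have hU' := fun i => (memLp_two_iff.1 (hU i)).2
    have h2 := hb _ _ _ g (memLp_two_iff.2 ⟨hm 0, e0 ▸ hU' 0⟩)
      (memLp_two_iff.2 ⟨hm 1, e1.trans_lt (ENNReal.add_lt_top.2 ⟨hU' 1, hU' 2⟩)⟩) h1
    simp only [ENNReal.rpow_ofNat] at e0 e1
    rw [hlen, Fin.sum_univ_three]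
    refine h2.trans ?_
    rw [e0, add_assoc]
    gcongr
  cases s with
  | west => exact gen (PageSym.refl a b) ha0 rfl rfl
  | east => exact gen (PageSym.reflX a b hs) ha0 rfl rfl
  | south => exact gen (PageSym.swap b a) hb0 rfl rfl
  | north => exact gen ((PageSym.swap b a).comp (PageSym.reflX b a hs)) hb0 rfl rfl

theorem inner_toLp_ofReal {α : Type*} [MeasurableSpace α] {μ : Measure α} {ψ : α → ℝ}
    (hψ : MemLp (fun x => (ψ x : ℂ)) 2 μ) (f : Lp ℂ 2 μ) :
    inner ℂ (hψ.toLp _) f = ∫ x, ψ x • f x ∂μ := by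
  rw [L2.inner_def]
  refine integral_congr_ae ?_
  filter_upwards [hψ.coeFn_toLp] with x hx
  rw [hx, RCLike.inner_apply']
  simp

namespace OpenBook

variable {L : OpenBook}

theorem coord_eq_flipIf {k : L.Page} {s : L.Sides k} {j : L.Binding} (h : L.attach k s = j) :
    L.coord k s = flipIf (L.reversed k s) (L.bindingLength j) := by
  subst h; rfl

theorem length_eq_bindingLength {k : L.Page} {s : L.Sides k} {j : L.Binding}
    (h : L.attach k s = j) : s.1.length (L.width k) (L.height k) = L.bindingLength j := by
  subst h; exact (L.attach_length k s).symm

theorem reversed_finite' {k : L.Page} {s : L.Sides k} {j : L.Binding}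
    (h : L.attach k s = j) : L.reversed k s = true → L.bindingLength j ≠ ⊤ := by
  subst h; exact L.reversed_finite k s

theorem green_integrable {a b : ℝ≥0∞} {u v : ℝ × ℝ → ℂ}
    (hu : MemLp u 2 (volume.restrict (openRect a b)))
    (hv : MemLp v 2 (volume.restrict (openRect a b))) {φ : ℝ × ℝ → ℝ}
    (h1 : ContDiff ℝ (⊤ : ℕ∞) φ) (h2 : HasCompactSupport φ) (e : ℝ × ℝ) :
    ∫ z in openRect a b, (fderiv ℝ φ z e • u z + φ z • v z) =
      (∫ z in openRect a b, fderiv ℝ φ z e • u z) + ∫ z in openRect a b, φ z • v z :=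
  integral_add
    (MemLp.integrable_smul_of_memLp (memLp_fderiv_of_contDiff h1 h2 e _) hu)
    (MemLp.integrable_smul_of_memLp (memLp_of_contDiff h1 h2 _) hv)

/-- A side is parametrized by a closed isometric embedding of the line, so a test function
restricted to it still has compact support. -/
theorem memLp_comp_point {a b ℓ : ℝ≥0∞} {φ : ℝ × ℝ → ℝ} (h1 : ContDiff ℝ (⊤ : ℕ∞) φ)
    (h2 : HasCompactSupport φ) (s : PageSide) (r : Bool) (μ : Measure ℝ)
    [IsFiniteMeasureOnCompacts μ] :
    MemLp (fun t => (φ (s.point a b (flipIf r ℓ t)) : ℂ)) 2 μ := by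
  have hiso : Isometry fun t => s.point a b (flipIf r ℓ t) := by
    refine Isometry.of_dist_eq fun t t' => ?_
    have e : dist (ℓ.toReal - t) (ℓ.toReal - t') = dist t t' := by
      rw [Real.dist_eq, Real.dist_eq, ← abs_neg]
      ring_nf
    cases s <;> cases r <;> simp [PageSide.point, flipIf, Prod.dist_eq, e, -dist_sub_left]
  have hc : HasCompactSupport fun t => φ (s.point a b (flipIf r ℓ t)) :=
    h2.comp_isClosedEmbedding hiso.isClosedEmbedding
  exact ((h1.continuous.comp hiso.continuous).memLp_of_hasCompactSupport hc).ofReal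

/-- `H¹_D` is weakly closed. -/
theorem memH1D_of_weakConv {u : ℕ → L.H1} {v : L.H1} (h : WeakConv u v) {C : ℝ}
    (hC : ∀ n i, ‖(u n).comp i‖ ≤ C) (hu : ∀ n, MemH1D (u n)) : MemH1D v := by
  intro j
  by_cases hj : ∃ (k : L.Page) (s : L.Sides k), L.attach k s = j
  swap
  · exact ⟨0, fun k s hks => absurd ⟨k, s, hks⟩ hj⟩
  obtain ⟨k₀, s₀, h₀⟩ := hj
  -- A single incident page suffices to bound the traces `g n` in `L²` of the binding. A weak limit
  -- `y` of a subsequence of them is then the common trace of `v` for all incident pages, since both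
  -- sides of Green's formula converge.
  choose g hg using fun n => hu n j
  set ℓ := L.bindingLength j
  have hmem : ∀ n, MemLp (g n) 2 (volume.restrict (openSeg ℓ)) := by
    intro n
    have h1 := (hg n k₀ s₀ h₀).1
    rw [length_eq_bindingLength h₀, coord_eq_flipIf h₀] at h1
    have h2 := h1.comp_measurePreserving (measurePreserving_flipIf_openSeg (reversed_finite' h₀))
    refine h2.ae_eq (Eventually.of_forall fun t => ?_)
    simp [Function.comp, flipIf_flipIf]
  obtain ⟨M, hM, hbound⟩ := exists_trace_bound (L.width_pos k₀) (L.height_pos k₀) s₀.2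
  have hnorm : ∀ n, ‖(hmem n).toLp (g n)‖ ^ 2 ≤ (M * (3 * ENNReal.ofReal (C ^ 2))).toReal := by
    intro n
    rw [norm_toLp_two_sq]
    refine ENNReal.toReal_mono (ENNReal.mul_ne_top hM (ENNReal.mul_ne_top (by simp) (by simp))) ?_
    have h1 := hbound (fun i => (u n).part i k₀) _ (fun i => (u n).memLp_part_page i k₀)
      (hg n k₀ s₀ h₀)
    rw [length_eq_bindingLength h₀, coord_eq_flipIf h₀] at h1
    have hmp := measurePreserving_flipIf_openSeg (reversed_finite' h₀)
    rw [hmp.lintegral_comp_emb (measurableEmbedding_flipIf _ _) (fun t => ‖g n t‖ₑ ^ 2)] at h1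
    simp only [ENNReal.rpow_ofNat]
    refine h1.trans ?_
    gcongr
    refine (Finset.sum_le_card_nsmul _ _ (ENNReal.ofReal (C ^ 2)) fun i _ => ?_).trans
      (by simp)
    refine ((u n).lintegral_page_le i k₀).trans (ENNReal.ofReal_le_ofReal ?_)
    exact pow_le_pow_left₀ (norm_nonneg _) (hC n i) 2
  obtain ⟨y, θ, hθ, hy⟩ := exists_subseq_weak_tendsto (fun n => (hmem n).toLp (g n))
    (C := √((M * (3 * ENNReal.ofReal (C ^ 2))).toReal)) fun n =>
      Real.le_sqrt_of_sq_le (hnorm n)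
  refine ⟨y, fun k s hks => ?_⟩
  have hmp := measurePreserving_flipIf_openSeg (reversed_finite' hks)
  have hlen := length_eq_bindingLength hks
  have hcoord := coord_eq_flipIf hks
  refine ⟨?_, fun φ p1 p2 p3 => ?_⟩
  · rw [hlen, hcoord]
    exact (Lp.memLp y).comp_measurePreserving hmp
  set r := L.reversed k s
  have hψ := memLp_comp_point (a := L.width k) (b := L.height k) (ℓ := ℓ) p1 p2 s.1 r
    (volume.restrict (openSeg ℓ))
  have hconv : ∀ f : ℝ → ℂ, ∫ t in openSeg (s.1.length (L.width k) (L.height k)),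
      φ (s.1.point (L.width k) (L.height k) t) • f (L.coord k s t) =
      ∫ t in openSeg ℓ, φ (s.1.point (L.width k) (L.height k) (flipIf r ℓ t)) • f t := by
    intro f
    rw [hlen, hcoord]
    rw [← hmp.integral_comp (measurableEmbedding_flipIf _ _)]
    simp only [r, ℓ, flipIf_flipIf]
  have hlimB : Tendsto (fun n => ∫ t in openSeg (s.1.length (L.width k) (L.height k)),
      φ (s.1.point (L.width k) (L.height k) t) • g (θ n) (L.coord k s t)) atTop
      (𝓝 (∫ t in openSeg (s.1.length (L.width k) (L.height k)),
        φ (s.1.point (L.width k) (L.height k) t) • y (L.coord k s t))) := by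
    simp only [hconv]
    have h1 := hy (hψ.toLp _)
    simp only [inner_toLp_ofReal] at h1
    refine h1.congr fun n => ?_
    refine integral_congr_ae ?_
    filter_upwards [(hmem (θ n)).coeFn_toLp] with t ht
    rw [ht]
  have hlimA : ∀ (e : ℝ × ℝ) (i : Fin 3), Tendsto (fun n => ∫ z in openRect (L.width k) (L.height k),
      (fderiv ℝ φ z e • (u (θ n)).part 0 k z + φ z • (u (θ n)).part i k z)) atTop
      (𝓝 (∫ z in openRect (L.width k) (L.height k),
        (fderiv ℝ φ z e • v.part 0 k z + φ z • v.part i k z))) := by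
    intro e i
    have hw : ∀ w : L.H1, _ := fun w =>
      green_integrable (w.memLp_part_page 0 k) (w.memLp_part_page i k) p1 p2 e
    simp only [hw]
    have h' := h.comp_strictMono hθ
    exact (h'.tendsto_setIntegral 0 k (memLp_fderiv_of_contDiff p1 p2 e _)).add
      (h'.tendsto_setIntegral i k (memLp_of_contDiff p1 p2 _))
  have hgr : ∀ n, _ := fun n => (hg (θ n) k s hks).2 φ p1 p2 p3
  constructor
  · exact tendsto_nhds_unique (hlimA (1, 0) 1)
      ((hlimB.const_smul s.1.normal.1).congr fun n => (hgr n).1.symm)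
  · exact tendsto_nhds_unique (hlimA (0, 1) 2)
      ((hlimB.const_smul s.1.normal.2).congr fun n => (hgr n).2.symm)

/-- `H¹_D` is a linear space. -/
theorem MemH1D.comb {u v : L.H1} (hu : MemH1D u) (hv : MemH1D v) (s t : ℂ) :
    MemH1D (H1.comb s t u v) := by
  intro j
  obtain ⟨g, hg⟩ := hu j
  obtain ⟨g', hg'⟩ := hv j
  refine ⟨fun x => s * g x + t * g' x, fun k c hk => ?_⟩
  obtain ⟨m, h⟩ := hg k c hk
  obtain ⟨m', h'⟩ := hg' k c hk
  refine ⟨(m.const_mul s).add (m'.const_mul t), fun φ p1 p2 p3 => ?_⟩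
  have hψ : MemLp (fun x => φ (c.1.point (L.width k) (L.height k) x)) 2
      (volume.restrict (openSeg (c.1.length (L.width k) (L.height k)))) := by
    have := memLp_comp_point (a := L.width k) (b := L.height k) (ℓ := 0) p1 p2 c.1 false
      (volume.restrict (openSeg (c.1.length (L.width k) (L.height k))))
    simpa [flipIf] using this.re
  have hB : ∫ x in openSeg (c.1.length (L.width k) (L.height k)),
      φ (c.1.point (L.width k) (L.height k) x) • (s * g (L.coord k c x) + t * g' (L.coord k c x)) =
      s * (∫ x in openSeg (c.1.length (L.width k) (L.height k)),
        φ (c.1.point (L.width k) (L.height k) x) • g (L.coord k c x)) +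
      t * ∫ x in openSeg (c.1.length (L.width k) (L.height k)),
        φ (c.1.point (L.width k) (L.height k) x) • g' (L.coord k c x) := by
    have i1 : Integrable (fun x => φ (c.1.point (L.width k) (L.height k) x) • g (L.coord k c x))
        (volume.restrict (openSeg (c.1.length (L.width k) (L.height k)))) :=
      memLp_one_iff_integrable.1 (m.smul (r := 1) hψ)
    have i2 : Integrable (fun x => φ (c.1.point (L.width k) (L.height k) x) • g' (L.coord k c x))
        (volume.restrict (openSeg (c.1.length (L.width k) (L.height k)))) :=
      memLp_one_iff_integrable.1 (m'.smul (r := 1) hψ)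
    rw [← integral_const_mul, ← integral_const_mul, ← integral_add
      (i1.const_mul s) (i2.const_mul t)]
    refine integral_congr_ae (Eventually.of_forall fun x => ?_)
    simp only [Complex.real_smul]
    ring
  have hA : ∀ (e : ℝ × ℝ) (i : Fin 3),
      ∫ z in openRect (L.width k) (L.height k), (fderiv ℝ φ z e • (H1.comb s t u v).part 0 k z +
        φ z • (H1.comb s t u v).part i k z) =
      s * (∫ z in openRect (L.width k) (L.height k),
        (fderiv ℝ φ z e • u.part 0 k z + φ z • u.part i k z)) +
      t * ∫ z in openRect (L.width k) (L.height k),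
        (fderiv ℝ φ z e • v.part 0 k z + φ z • v.part i k z) := by
    intro e i
    have hi : ∀ w : L.H1, Integrable (fun z => fderiv ℝ φ z e • w.part 0 k z + φ z • w.part i k z)
        (volume.restrict (openRect (L.width k) (L.height k))) := fun w =>
      (MemLp.integrable_smul_of_memLp (memLp_fderiv_of_contDiff p1 p2 e _)
        (w.memLp_part_page 0 k)).add
      (MemLp.integrable_smul_of_memLp (memLp_of_contDiff p1 p2 _) (w.memLp_part_page i k))
    rw [← integral_const_mul, ← integral_const_mul, ← integral_add
      ((hi u).const_mul s) ((hi v).const_mul t)]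
    refine integral_congr_ae (Eventually.of_forall fun x => ?_)
    simp only [Complex.real_smul, H1.part_comb]
    ring
  have h1 := h φ p1 p2 p3
  have h2 := h' φ p1 p2 p3
  refine ⟨(hA (1, 0) 1).trans ?_, (hA (0, 1) 2).trans ?_⟩
  · rw [hB, show (∫ z in openRect (L.width k) (L.height k),
        (fderiv ℝ φ z (1, 0) • u.part 0 k z + φ z • u.part 1 k z)) = _ from h1.1,
      show (∫ z in openRect (L.width k) (L.height k),
        (fderiv ℝ φ z (1, 0) • v.part 0 k z + φ z • v.part 1 k z)) = _ from h2.1]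
    simp only [Complex.real_smul]
    ring
  · rw [hB, show (∫ z in openRect (L.width k) (L.height k),
        (fderiv ℝ φ z (0, 1) • u.part 0 k z + φ z • u.part 2 k z)) = _ from h1.2,
      show (∫ z in openRect (L.width k) (L.height k),
        (fderiv ℝ φ z (0, 1) • v.part 0 k z + φ z • v.part 2 k z)) = _ from h2.2]
    simp only [Complex.real_smul]
    ring

end OpenBook

end

noncomputable section

/-! ### The Brezis-Lieb lemma -/

/-- If `y ≤ δ x`, the sum is at most `(1 + δ) x`, and `δ` is chosen so that `(1 + δ) ^ q < 1 + ε`.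
Otherwise `x` is dominated by `y / δ`. -/
theorem exists_rpow_add_le {q ε : ℝ} (hq : 0 < q) (hε : 0 < ε) :
    ∃ C : ℝ, 0 ≤ C ∧ ∀ x y : ℝ, 0 ≤ x → 0 ≤ y → (x + y) ^ q ≤ (1 + ε) * x ^ q + C * y ^ q := by
  have hcont : Tendsto (fun δ : ℝ => (1 + δ) ^ q) (𝓝[>] 0) (𝓝 1) := by
    have : ContinuousAt (fun δ : ℝ => (1 + δ) ^ q) 0 :=
      ContinuousAt.rpow_const (by fun_prop) (Or.inr hq.le)
    have h := this.tendsto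
    simp only [add_zero, Real.one_rpow] at h
    exact h.mono_left nhdsWithin_le_nhds
  obtain ⟨δ, h1, h2⟩ := ((hcont.eventually_lt_const (show (1 : ℝ) < 1 + ε by linarith)).and
    self_mem_nhdsWithin).exists
  have hδ : 0 < δ := h2
  refine ⟨(1 + 1 / δ) ^ q, by positivity, fun x y hx hy => ?_⟩
  rcases le_total y (δ * x) with h | h
  · calc (x + y) ^ q ≤ ((1 + δ) * x) ^ q := by gcongr; linarith
      _ = (1 + δ) ^ q * x ^ q := Real.mul_rpow (by positivity) hx
      _ ≤ (1 + ε) * x ^ q := by gcongr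
      _ ≤ _ := by
        have : 0 ≤ (1 + 1 / δ) ^ q * y ^ q := by positivity
        linarith
  · calc (x + y) ^ q ≤ ((1 + 1 / δ) * y) ^ q := by
          gcongr
          have : x ≤ 1 / δ * y := by
            rw [one_div, inv_mul_eq_div, le_div_iff₀ hδ]; linarith
          linarith
      _ = (1 + 1 / δ) ^ q * y ^ q := Real.mul_rpow (by positivity) hy
      _ ≤ _ := by
        have : 0 ≤ (1 + ε) * x ^ q := by positivity
        linarith

/-- The preceding inequality is used twice, for `a + b` in terms of `b` and for `b` in terms of `a +
b`. -/
theorem exists_abs_rpow_norm_add_sub_le {q ε : ℝ} (hq : 0 < q) (hε : 0 < ε) :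
    ∃ C : ℝ, 0 ≤ C ∧ ∀ a b : ℂ, |‖a + b‖ ^ q - ‖b‖ ^ q| ≤ ε * ‖b‖ ^ q + C * ‖a‖ ^ q := by
  obtain ⟨C, hC, h⟩ := exists_rpow_add_le hq hε
  refine ⟨C, hC, fun a b => ?_⟩
  have h1 : ‖a + b‖ ^ q ≤ (‖b‖ + ‖a‖) ^ q := by
    gcongr; rw [add_comm]; exact norm_add_le _ _
  have h2 : ‖b‖ ^ q ≤ (‖a + b‖ + ‖a‖) ^ q := by
    gcongr
    calc ‖b‖ = ‖(a + b) - a‖ := by ring_nf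
      _ ≤ _ := norm_sub_le _ _
  have h3 := h ‖b‖ ‖a‖ (norm_nonneg _) (norm_nonneg _)
  have h4 := h ‖a + b‖ ‖a‖ (norm_nonneg _) (norm_nonneg _)
  have hb : 0 ≤ ‖b‖ ^ q := by positivity
  have ha : 0 ≤ ‖a‖ ^ q := by positivity
  have hCa := mul_nonneg hC ha
  have hεb := mul_nonneg hε.le hb
  rw [abs_le]
  constructor
  · rcases le_total (‖b‖ ^ q) (‖a + b‖ ^ q) with h5 | h5
    · linarith
    · nlinarith
  · linarith

/-- The **Brezis-Lieb lemma**. -/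
theorem brezis_lieb {α : Type*} [MeasurableSpace α] {μ : Measure α} {q : ℝ} (hq : 0 < q)
    {f : α → ℂ} {w : ℕ → α → ℂ} {M : ℝ}
    (hf : Integrable (fun x => ‖f x‖ ^ q) μ) (hw : ∀ n, Integrable (fun x => ‖w n x‖ ^ q) μ)
    (hfw : ∀ n, Integrable (fun x => ‖f x + w n x‖ ^ q) μ)
    (hM : ∀ n, ∫ x, ‖w n x‖ ^ q ∂μ ≤ M) (hlim : ∀ᵐ x ∂μ, Tendsto (fun n => w n x) atTop (𝓝 0)) :
    Tendsto (fun n => ∫ x, ‖f x + w n x‖ ^ q ∂μ - ∫ x, ‖w n x‖ ^ q ∂μ) atTop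
      (𝓝 (∫ x, ‖f x‖ ^ q ∂μ)) := by
  rw [Metric.tendsto_atTop]
  intro η hη
  have hM0 : 0 ≤ M := le_trans (integral_nonneg fun x => by positivity) (hM 0)
  set ε := η / (2 * (M + 1))
  have hε : 0 < ε := by positivity
  obtain ⟨C, hC, hpt⟩ := exists_abs_rpow_norm_add_sub_le hq hε
  set d : ℕ → α → ℝ := fun n x => ‖f x + w n x‖ ^ q - ‖w n x‖ ^ q - ‖f x‖ ^ q
  have hd : ∀ n, Integrable (d n) μ := fun n => ((hfw n).sub (hw n)).sub hf
  -- After subtracting `ε ‖w n‖ ^ q`, the defect is dominated by a multiple of `‖f‖ ^ q` and tends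
  -- to zero pointwise. What was subtracted integrates to at most `ε M`, which is below `η / 2`.
  set W : ℕ → α → ℝ := fun n x => max (|d n x| - ε * ‖w n x‖ ^ q) 0
  have hWm : ∀ n, Integrable (W n) μ := fun n => ((hd n).abs.sub ((hw n).const_mul ε)).pos_part
  have hW : Tendsto (fun n => ∫ x, W n x ∂μ) atTop (𝓝 (∫ _, (0 : ℝ) ∂μ)) := by
    refine tendsto_integral_of_dominated_convergence (fun x => (C + 1) * ‖f x‖ ^ q)
      (fun n => (hWm n).aestronglyMeasurable) (hf.const_mul _) (fun n => ?_) ?_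
    · refine Eventually.of_forall fun x => ?_
      rw [Real.norm_of_nonneg (le_max_right _ _)]
      have h0 : 0 ≤ ‖f x‖ ^ q := by positivity
      refine max_le ?_ (by positivity)
      have h1 := hpt (f x) (w n x)
      have h2 : |d n x| ≤ |‖f x + w n x‖ ^ q - ‖w n x‖ ^ q| + |‖f x‖ ^ q| := abs_sub _ _
      rw [abs_of_nonneg h0] at h2
      linarith
    · filter_upwards [hlim] with x hx
      have hc : Continuous fun z : ℂ => max (|‖f x + z‖ ^ q - ‖z‖ ^ q - ‖f x‖ ^ q| - ε * ‖z‖ ^ q) 0 := by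
        have h1 : Continuous fun z : ℂ => ‖z‖ ^ q := continuous_norm.rpow_const fun _ => Or.inr hq.le
        have h2 : Continuous fun z : ℂ => ‖f x + z‖ ^ q :=
          h1.comp (continuous_const.add continuous_id)
        exact ((((h2.sub h1).sub continuous_const).abs).sub (h1.const_mul ε)).max continuous_const
      have := (hc.tendsto 0).comp hx
      simpa [W, d, Function.comp_def, Real.zero_rpow hq.ne'] using this
  simp only [integral_zero] at hW
  obtain ⟨N, hN⟩ := (Metric.tendsto_atTop.1 hW) (η / 2) (half_pos hη)
  refine ⟨N, fun n hn => ?_⟩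
  have h1 : ∫ x, ‖f x + w n x‖ ^ q ∂μ - ∫ x, ‖w n x‖ ^ q ∂μ - ∫ x, ‖f x‖ ^ q ∂μ = ∫ x, d n x ∂μ := by
    have h0 : Integrable (fun x => ‖f x + w n x‖ ^ q - ‖w n x‖ ^ q) μ := (hfw n).sub (hw n)
    rw [← integral_sub (hfw n) (hw n), ← integral_sub h0 hf]
  rw [Real.dist_eq, h1]
  have h2 := hN n hn
  rw [Real.dist_eq, sub_zero] at h2
  calc |∫ x, d n x ∂μ| ≤ ∫ x, |d n x| ∂μ := abs_integral_le_integral_abs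
    _ ≤ ∫ x, (W n x + ε * ‖w n x‖ ^ q) ∂μ := by
      refine integral_mono (hd n).abs ((hWm n).add ((hw n).const_mul ε)) fun x => ?_
      have := le_max_left (|d n x| - ε * ‖w n x‖ ^ q) 0
      simp only [W]
      linarith
    _ = ∫ x, W n x ∂μ + ε * ∫ x, ‖w n x‖ ^ q ∂μ := by
      rw [integral_add (hWm n) ((hw n).const_mul ε), integral_const_mul]
    _ < η / 2 + η / 2 := by
      have h3 : ε * ∫ x, ‖w n x‖ ^ q ∂μ ≤ ε * (M + 1) := by
        gcongr; linarith [hM n]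
      have h4 : ε * (M + 1) = η / 2 := by simp only [ε]; field_simp
      linarith [le_abs_self (∫ x, W n x ∂μ)]
    _ = η := by ring

/-! ### Sobolev inequalities on the book -/

/-- Below the threshold `lam` the square dominates, above it the high power does. The freedom in
`lam` makes the coefficient of the square as small as desired when `q > 2`. -/
theorem rpow_le_interp {q lam t : ℝ} (hq : 2 ≤ q) (hl : 0 < lam) (ht : 0 ≤ t) {n : ℕ}
    (hn : q ≤ 2 * (n + 1)) :
    t ^ q ≤ lam ^ (q - 2) * t ^ 2 + lam ^ (q - 2 * (n + 1)) * t ^ (2 * (n + 1)) := by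
  rcases ht.eq_or_lt with rfl | ht0
  · rw [Real.zero_rpow (by linarith)]
    positivity
  rcases le_total t lam with h | h
  · have e : t ^ q = t ^ (q - 2) * t ^ 2 := by
      rw [← Real.rpow_natCast, ← Real.rpow_add ht0]; norm_num
    have h1 : t ^ (q - 2) ≤ lam ^ (q - 2) := Real.rpow_le_rpow ht h (by linarith)
    have h2 : 0 ≤ lam ^ (q - 2 * (n + 1)) * t ^ (2 * (n + 1)) := by positivity
    nlinarith [sq_nonneg t]
  · have e : t ^ q = t ^ (q - 2 * (n + 1)) * t ^ (2 * (n + 1)) := by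
      rw [← Real.rpow_natCast t (2 * (n + 1)), ← Real.rpow_add ht0]
      push_cast
      ring_nf
    have h1 : t ^ (q - 2 * (n + 1)) ≤ lam ^ (q - 2 * (n + 1)) :=
      Real.rpow_le_rpow_of_nonpos hl h (by linarith)
    have h2 : 0 ≤ lam ^ (q - 2) * t ^ 2 := by positivity
    have h3 : 0 ≤ t ^ (2 * (n + 1)) := by positivity
    nlinarith

theorem enorm_rpow_le_interp {q lam : ℝ} (hq : 2 ≤ q) (hl : 0 < lam) (z : ℂ) {n : ℕ}
    (hn : q ≤ 2 * (n + 1)) :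
    ‖z‖ₑ ^ q ≤ ENNReal.ofReal (lam ^ (q - 2)) * ‖z‖ₑ ^ 2 +
      ENNReal.ofReal (lam ^ (q - 2 * (n + 1))) * ‖z‖ₑ ^ (2 * (n + 1)) := by
  rw [← ofReal_norm, ENNReal.ofReal_rpow_of_nonneg (norm_nonneg _) (by linarith),
    ← ENNReal.ofReal_pow (norm_nonneg _), ← ENNReal.ofReal_pow (norm_nonneg _),
    ← ENNReal.ofReal_mul (by positivity), ← ENNReal.ofReal_mul (by positivity),
    ← ENNReal.ofReal_add (by positivity) (by positivity)]
  exact ENNReal.ofReal_le_ofReal (rpow_le_interp hq hl (norm_nonneg _) hn)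

namespace OpenBook

variable {L : OpenBook}

/-- The sides of all pages are longer than `h`. -/
def SidesAbove (L : OpenBook) (h : ℝ) : Prop :=
  0 < h ∧ ∀ k, ENNReal.ofReal h < L.width k ∧ ENNReal.ofReal h < L.height k

/-- The squared `H¹` norm. -/
def energy (u : L.H1) : ℝ := ‖u.comp 0‖ ^ 2 + ‖u.comp 1‖ ^ 2 + ‖u.comp 2‖ ^ 2

theorem energy_nonneg (u : L.H1) : 0 ≤ energy u := by unfold energy; positivity

theorem energy_eq (u : L.H1) : energy u = massSq u + gradSq u := by
  rw [energy, massSq_eq, gradSq_eq]; ring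

theorem norm_comp_sq_le_energy (u : L.H1) (i : Fin 3) : ‖u.comp i‖ ^ 2 ≤ energy u := by
  unfold energy
  fin_cases i <;> simp <;> nlinarith [sq_nonneg ‖u.comp 0‖, sq_nonneg ‖u.comp 1‖,
    sq_nonneg ‖u.comp 2‖]

theorem norm_comp_le_of_energy_le {u : L.H1} {C : ℝ} (h : energy u ≤ C) (i : Fin 3) :
    ‖u.comp i‖ ≤ √C :=
  Real.le_sqrt_of_sq_le ((norm_comp_sq_le_energy u i).trans h)

/-- The mass on one page. -/
def pageMass (u : L.H1) (k : L.Page) : ℝ≥0∞ := ∫⁻ z in L.rect k, ‖u.toFun k z‖ₑ ^ 2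

theorem ofReal_energy (u : L.H1) : ENNReal.ofReal (energy u) =
    ∑' k, ((∫⁻ z in L.rect k, ‖u.part 0 k z‖ₑ ^ 2) + (∫⁻ z in L.rect k, ‖u.part 1 k z‖ₑ ^ 2) +
      ∫⁻ z in L.rect k, ‖u.part 2 k z‖ₑ ^ 2) := by
  rw [ENNReal.tsum_add, ENNReal.tsum_add, ← lpPow_two, ← lpPow_two, ← lpPow_two, H1.lpPow_part,
    H1.lpPow_part, H1.lpPow_part, energy, ENNReal.ofReal_add (by positivity) (by positivity),
    ENNReal.ofReal_add (by positivity) (by positivity)]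

/-- This is the estimate behind non-vanishing. On each page the mass factor is bounded by `δ` and
all but one of the energy factors by the total energy; the last energy factor is summed over the
pages. No constant depends on the number of pages. -/
theorem tsum_pow_le_of_pageMass_le {h : ℝ} (hL : L.SidesAbove h) (u : L.H1) {δ : ℝ≥0∞}
    (hδ : ∀ k, pageMass u k ≤ δ) (n : ℕ) :
    ∑' k, ∫⁻ z in L.rect k, ‖u.toFun k z‖ₑ ^ (2 * (n + 1 + 1)) ≤
      gnConst h (n + 1) * δ * ENNReal.ofReal (energy u) ^ (n + 1) := by
  set E : L.Page → ℝ≥0∞ := fun k => (∫⁻ z in L.rect k, ‖u.part 0 k z‖ₑ ^ 2) +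
    (∫⁻ z in L.rect k, ‖u.part 1 k z‖ₑ ^ 2) + ∫⁻ z in L.rect k, ‖u.part 2 k z‖ₑ ^ 2
  have hE : ENNReal.ofReal (energy u) = ∑' k, E k := ofReal_energy u
  have hpage : ∀ k, ∫⁻ z in L.rect k, ‖u.toFun k z‖ₑ ^ (2 * (n + 1 + 1)) ≤
      gnConst h (n + 1) * δ * ENNReal.ofReal (energy u) ^ n * E k := by
    intro k
    have hd := u.weakDeriv_part k
    refine (gagliardoNirenberg_openRect (u.memLp_part_page 0 k) (u.memLp_part_page 1 k)
      (u.memLp_part_page 2 k) hd.1 hd.2 hL.1 (hL.2 k).1 (hL.2 k).2 (n + 1)).trans ?_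
    change gnConst h (n + 1) * pageMass u k * E k ^ (n + 1) ≤ _
    rw [pow_succ, ← mul_assoc]
    gcongr
    · exact hδ k
    · rw [hE]; exact ENNReal.le_tsum k
  refine (ENNReal.tsum_le_tsum hpage).trans (le_of_eq ?_)
  rw [ENNReal.tsum_mul_left, ← hE, pow_succ]
  ring

/-- The interpolated Sobolev inequality. -/
theorem lpPow_le_of_pageMass_le {h : ℝ} (hL : L.SidesAbove h) (u : L.H1) {q : ℝ} (hq : 2 ≤ q)
    {n : ℕ} (hn : q ≤ 2 * (n + 1 + 1)) {lam : ℝ} (hl : 0 < lam) {δ : ℝ≥0∞}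
    (hδ : ∀ k, pageMass u k ≤ δ) :
    L.lpPow q u.toFun ≤ ENNReal.ofReal (lam ^ (q - 2)) * ENNReal.ofReal (energy u) +
      ENNReal.ofReal (lam ^ (q - 2 * (n + 1 + 1))) *
        (gnConst h (n + 1) * δ * ENNReal.ofReal (energy u) ^ (n + 1)) := by
  have hm : ∀ k, AEMeasurable (fun z => ‖u.toFun k z‖ₑ) (volume.restrict (L.rect k)) :=
    fun k => (u.memLp k).aestronglyMeasurable.enorm
  have hn' : q ≤ 2 * (((n + 1 : ℕ) : ℝ) + 1) := by push_cast; exact hn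
  calc L.lpPow q u.toFun
      ≤ ∑' k, ∫⁻ z in L.rect k, (ENNReal.ofReal (lam ^ (q - 2)) * ‖u.toFun k z‖ₑ ^ 2 +
        ENNReal.ofReal (lam ^ (q - 2 * (((n + 1 : ℕ) : ℝ) + 1))) *
          ‖u.toFun k z‖ₑ ^ (2 * (n + 1 + 1))) :=
        ENNReal.tsum_le_tsum fun k => lintegral_mono fun z => enorm_rpow_le_interp hq hl _ hn'
    _ = ENNReal.ofReal (lam ^ (q - 2)) * L.lpPow 2 u.toFun +
        ENNReal.ofReal (lam ^ (q - 2 * (((n + 1 : ℕ) : ℝ) + 1))) *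
          ∑' k, ∫⁻ z in L.rect k, ‖u.toFun k z‖ₑ ^ (2 * (n + 1 + 1)) := by
        rw [lpPow_two, ← ENNReal.tsum_mul_left, ← ENNReal.tsum_mul_left, ← ENNReal.tsum_add]
        refine tsum_congr fun k => ?_
        rw [lintegral_add_left' (((hm k).pow_const 2).const_mul _),
          lintegral_const_mul'' _ ((hm k).pow_const 2), lintegral_const_mul'' _ ((hm k).pow_const _)]
    _ ≤ _ := by
        have e : L.lpPow 2 u.toFun ≤ ENNReal.ofReal (energy u) := by
          rw [show L.lpPow 2 u.toFun = L.lpPow 2 (u.part 0) from rfl, H1.lpPow_part]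
          exact ENNReal.ofReal_le_ofReal (norm_comp_sq_le_energy u 0)
        push_cast
        gcongr
        exact tsum_pow_le_of_pageMass_le hL u hδ n

theorem pageMass_le_energy (u : L.H1) (k : L.Page) : pageMass u k ≤ ENNReal.ofReal (energy u) :=
  (u.lintegral_page_le 0 k).trans (ENNReal.ofReal_le_ofReal (norm_comp_sq_le_energy u 0))

theorem exists_nat_le_two_mul (q : ℝ) : ∃ n : ℕ, q ≤ 2 * ((n : ℝ) + 1 + 1) := by
  obtain ⟨n, hn⟩ := exists_nat_gt q
  exact ⟨n, by have : (0 : ℝ) ≤ n := Nat.cast_nonneg n; linarith⟩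

theorem lpPow_lt_top {h : ℝ} (hL : L.SidesAbove h) (u : L.H1) {q : ℝ} (hq : 2 ≤ q) :
    L.lpPow q u.toFun < ⊤ := by
  obtain ⟨n, hn⟩ := exists_nat_le_two_mul q
  refine (lpPow_le_of_pageMass_le hL u hq hn one_pos (pageMass_le_energy u)).trans_lt ?_
  have hg := gnConst_ne_top hL.1 (n + 1)
  refine ENNReal.add_lt_top.2 ⟨ENNReal.mul_lt_top (by simp) (by simp),
    ENNReal.mul_lt_top (by simp) (ENNReal.mul_lt_top (ENNReal.mul_lt_top hg.lt_top (by simp)) ?_)⟩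
  exact ENNReal.pow_lt_top (by simp)

/-- In real terms: for every `ε` there is `C` with `‖u‖_q^q ≤ ε ‖u‖² + C δ ‖u‖^{2n}`, if the mass
on each page is at most `δ`. -/
theorem exists_toReal_lpPow_le {h : ℝ} (hL : L.SidesAbove h) {q : ℝ} (hq : 2 < q) {ε : ℝ}
    (hε : 0 < ε) : ∃ (C : ℝ) (n : ℕ), 0 ≤ C ∧ ∀ (u : L.H1) (δ : ℝ), 0 ≤ δ →
      (∀ k, pageMass u k ≤ ENNReal.ofReal δ) →
      (L.lpPow q u.toFun).toReal ≤ ε * energy u + C * δ * energy u ^ (n + 1) := by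
  obtain ⟨n, hn⟩ := exists_nat_le_two_mul q
  -- Chosen so that the coefficient `lam ^ (q - 2)` of the energy is exactly `ε`.
  set lam := ε ^ (1 / (q - 2))
  have hl : 0 < lam := by positivity
  have hlam : lam ^ (q - 2) = ε := by
    rw [← Real.rpow_mul hε.le, one_div, inv_mul_cancel₀ (by linarith), Real.rpow_one]
  have hg := gnConst_ne_top hL.1 (n + 1)
  refine ⟨lam ^ (q - 2 * (n + 1 + 1)) * (gnConst h (n + 1)).toReal, n, by positivity,
    fun u δ hδ hm => ?_⟩
  have h1 := lpPow_le_of_pageMass_le hL u hq.le hn hl hm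
  rw [hlam, ← ENNReal.ofReal_toReal hg, ← ENNReal.ofReal_pow (energy_nonneg u),
    ← ENNReal.ofReal_mul (by positivity), ← ENNReal.ofReal_mul (by positivity),
    ← ENNReal.ofReal_mul (by positivity), ← ENNReal.ofReal_mul (by positivity),
    ← ENNReal.ofReal_add (mul_nonneg hε.le (energy_nonneg u))
      (by have := energy_nonneg u; positivity)] at h1
  have h2 := ENNReal.toReal_le_of_le_ofReal (by have := energy_nonneg u; positivity) h1
  refine h2.trans (le_of_eq ?_)
  ring

end OpenBook

end

noncomputable section

/-! ### The variational argument -/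

namespace OpenBook

variable {L : OpenBook}

/-- The quadratic part of the Nehari functional. -/
def quad (ω : ℝ) (u : L.H1) : ℝ := gradSq u + ω * massSq u

/-- `‖u‖_{L^q}^q` as a real number. -/
def powNorm (q : ℝ) (u : L.H1) : ℝ := (L.lpPow q u.toFun).toReal

theorem nehari_eq (p ω : ℝ) (u : L.H1) : nehari p ω u = quad ω u - powNorm (p + 1) u := rfl

theorem powNorm_nonneg (q : ℝ) (u : L.H1) : 0 ≤ powNorm q u := ENNReal.toReal_nonneg

/-- The competitors for the action level. -/
def Admissible (p ω : ℝ) (u : L.H1) : Prop := MemH1D u ∧ Nontriv u ∧ nehari p ω u ≤ 0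

theorem massSq_nonneg (u : L.H1) : 0 ≤ massSq u := ENNReal.toReal_nonneg

theorem gradSq_nonneg (u : L.H1) : 0 ≤ gradSq u := ENNReal.toReal_nonneg

theorem massSq_pos {u : L.H1} (hu : Nontriv u) : 0 < massSq u := by
  rw [massSq_eq]
  have := norm_pos_iff.2 ((nontriv_iff u).1 hu)
  positivity

theorem energy_pos {u : L.H1} (hu : Nontriv u) : 0 < energy u := by
  rw [energy_eq]
  linarith [massSq_pos hu, gradSq_nonneg u]

theorem spectralBottom_nonneg (L : OpenBook) : 0 ≤ L.spectralBottom := by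
  refine Real.sInf_nonneg ?_
  rintro r ⟨u, -, -, rfl⟩
  exact div_nonneg (gradSq_nonneg u) (massSq_nonneg u)

theorem spectralBottom_mul_le {u : L.H1} (hu : MemH1D u) :
    L.spectralBottom * massSq u ≤ gradSq u := by
  by_cases h : Nontriv u
  · rw [← le_div_iff₀ (massSq_pos h)]
    refine csInf_le ⟨0, ?_⟩ ⟨u, hu, h, rfl⟩
    rintro r ⟨u, -, -, rfl⟩
    exact div_nonneg (gradSq_nonneg u) (massSq_nonneg u)
  · have h0 : massSq u = 0 := by
      rw [Nontriv, not_not] at h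
      rw [massSq, h, ENNReal.toReal_zero]
    rw [h0, mul_zero]
    exact gradSq_nonneg u

theorem exists_coercive {ω : ℝ} (hω : -L.spectralBottom < ω) :
    ∃ c > 0, ∀ u : L.H1, MemH1D u → c * energy u ≤ quad ω u := by
  have hb := spectralBottom_nonneg L
  set b := L.spectralBottom
  -- For `c ≤ 1` the part `1 - c` of the gradient term is at least `(1 - c) b` times the mass. The
  -- difference to be shown nonnegative is then at least `ω + b - c (1 + b)` times the mass.
  refine ⟨min 1 ((ω + b) / (1 + b)), lt_min one_pos (div_pos (by linarith) (by linarith)),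
    fun u hu => ?_⟩
  set c := min 1 ((ω + b) / (1 + b))
  have h1 : c ≤ 1 := min_le_left _ _
  have h2 : c * (1 + b) ≤ ω + b := (le_div_iff₀ (by linarith)).1 (min_le_right _ _)
  have h3 := spectralBottom_mul_le hu
  rw [energy_eq, quad]
  have h4 : (1 - c) * (b * massSq u) ≤ (1 - c) * gradSq u :=
    mul_le_mul_of_nonneg_left h3 (by linarith)
  nlinarith [mul_nonneg (sub_nonneg.2 h2) (massSq_nonneg u)]

/-- Admissible functions are bounded away from zero. -/
theorem exists_le_powNorm {h : ℝ} (hL : L.SidesAbove h) {p ω c : ℝ} (hp : 1 < p) (hc : 0 < c)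
    (hco : ∀ u : L.H1, MemH1D u → c * energy u ≤ quad ω u) :
    ∃ ε > 0, ∀ u : L.H1, Admissible p ω u → ε ≤ powNorm (p + 1) u := by
  obtain ⟨C, n, hC, hS⟩ := exists_toReal_lpPow_le hL (q := p + 1) (by linarith) (half_pos hc)
  refine ⟨c * min 1 (c / (2 * (C + 1))), by positivity, fun u ⟨h1, h2, h3⟩ => ?_⟩
  have h4 := hco u h1
  rw [nehari_eq] at h3
  have hE := energy_pos h2
  have h5 : powNorm (p + 1) u ≤ c / 2 * energy u + C * energy u * energy u ^ (n + 1) :=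
    hS u (energy u) hE.le (pageMass_le_energy u)
  refine le_trans (mul_le_mul_of_nonneg_left ?_ hc.le) (h4.trans (by linarith))
  -- Coercivity, `I_ω(u) ≤ 0` and the Sobolev inequality with `ε = c / 2` give `c / 2 ≤ C E ^ (n +
  -- 1)` for the energy `E > 0`, which is impossible for small `E`.
  by_contra! h6
  have h7 : energy u < 1 := h6.trans_le (min_le_left _ _)
  have h8 : energy u < c / (2 * (C + 1)) := h6.trans_le (min_le_right _ _)
  rw [lt_div_iff₀ (by positivity)] at h8
  have h9 : energy u ^ (n + 1) ≤ energy u := by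
    rw [pow_succ]
    exact mul_le_of_le_one_left hE.le (pow_le_one₀ hE.le h7.le)
  have h10 : C * energy u * energy u ^ (n + 1) ≤ C * energy u * energy u := by gcongr
  nlinarith

variable {p ω : ℝ}

theorem potential_eq {h : ℝ} (hL : L.SidesAbove h) (hp : 1 < p) (u : L.H1) :
    potential p u = ENNReal.ofReal ((p - 1) / (2 * (p + 1)) * powNorm (p + 1) u) := by
  have := lpPow_lt_top hL u (q := p + 1) (by linarith)
  rw [ENNReal.ofReal_mul (div_nonneg (by linarith) (by linarith)), powNorm,
    ENNReal.ofReal_toReal this.ne, potential]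

theorem level_le {u : L.H1} (hu : Admissible p ω u) : L.level p ω ≤ potential p u :=
  iInf₂_le u hu

theorem level_pos {h : ℝ} (hL : L.SidesAbove h) (hp : 1 < p) (hω : -L.spectralBottom < ω) :
    0 < L.level p ω := by
  obtain ⟨c, hc, hco⟩ := exists_coercive hω
  obtain ⟨ε, hε, h1⟩ := exists_le_powNorm hL hp hc hco
  have hcp : 0 < (p - 1) / (2 * (p + 1)) := div_pos (by linarith) (by linarith)
  refine lt_of_lt_of_le (ENNReal.ofReal_pos.2 (mul_pos hcp hε)) (le_iInf₂ fun u hu => ?_)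
  rw [potential_eq hL hp]
  exact ENNReal.ofReal_le_ofReal (mul_le_mul_of_nonneg_left (h1 u hu) hcp.le)

/-! ### Minimizing sequences -/

/-- A minimizing sequence for the action level. -/
def IsMinimizing (p ω : ℝ) (u : ℕ → L.H1) : Prop :=
  (∀ n, Admissible p ω (u n)) ∧ Tendsto (fun n => potential p (u n)) atTop (𝓝 (L.level p ω))

theorem IsMinimizing.comp_strictMono {u : ℕ → L.H1} (hu : IsMinimizing p ω u) {φ : ℕ → ℕ}
    (hφ : StrictMono φ) : IsMinimizing p ω fun n => u (φ n) :=
  ⟨fun _ => hu.1 _, hu.2.comp hφ.tendsto_atTop⟩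

theorem exists_isMinimizing (h : L.level p ω ≠ ⊤) : ∃ u : ℕ → L.H1, IsMinimizing p ω u := by
  have h1 : ∀ n : ℕ, ∃ u : L.H1, Admissible p ω u ∧
      potential p u ≤ L.level p ω + ((n : ℝ≥0∞))⁻¹ := by
    intro n
    -- For `n = 0` the inverse is `⊤`, so that the bound is empty but true.
    have h2 : L.level p ω < L.level p ω + ((n : ℝ≥0∞))⁻¹ := ENNReal.lt_add_right h (by simp)
    obtain ⟨u, hu⟩ := iInf_lt_iff.1 h2
    obtain ⟨hu1, hu2⟩ := iInf_lt_iff.1 hu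
    exact ⟨u, hu1, hu2.le⟩
  choose u hu hle using h1
  refine ⟨u, hu, tendsto_of_tendsto_of_tendsto_of_le_of_le tendsto_const_nhds ?_
    (fun n => level_le (hu n)) hle⟩
  simpa using (tendsto_const_nhds (x := L.level p ω)).add ENNReal.tendsto_inv_nat_nhds_zero

/-- The infimum of `‖u‖_{p+1}^{p+1}` over admissible functions. -/
def realLevel (L : OpenBook) (p ω : ℝ) : ℝ := (L.level p ω).toReal / ((p - 1) / (2 * (p + 1)))

theorem ofReal_realLevel (hp : 1 < p) (hl : L.level p ω ≠ ⊤) :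
    ENNReal.ofReal ((p - 1) / (2 * (p + 1)) * L.realLevel p ω) = L.level p ω := by
  have hcp : 0 < (p - 1) / (2 * (p + 1)) := div_pos (by linarith) (by linarith)
  rw [realLevel, mul_div_cancel₀ _ hcp.ne', ENNReal.ofReal_toReal hl]

theorem realLevel_le {h : ℝ} (hL : L.SidesAbove h) (hp : 1 < p) {u : L.H1}
    (hu : Admissible p ω u) : L.realLevel p ω ≤ powNorm (p + 1) u := by
  have hcp : 0 < (p - 1) / (2 * (p + 1)) := div_pos (by linarith) (by linarith)
  have h1 := level_le hu
  rw [potential_eq hL hp] at h1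
  rw [realLevel, div_le_iff₀' hcp]
  exact ENNReal.toReal_le_of_le_ofReal (mul_nonneg hcp.le (powNorm_nonneg _ u)) h1

theorem IsMinimizing.tendsto_powNorm {h : ℝ} (hL : L.SidesAbove h) (hp : 1 < p) {u : ℕ → L.H1}
    (hu : IsMinimizing p ω u) (hl : L.level p ω ≠ ⊤) :
    Tendsto (fun n => powNorm (p + 1) (u n)) atTop (𝓝 (L.realLevel p ω)) := by
  have hcp : 0 < (p - 1) / (2 * (p + 1)) := div_pos (by linarith) (by linarith)
  have h1 := ((ENNReal.tendsto_toReal hl).comp hu.2).div_const ((p - 1) / (2 * (p + 1)))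
  refine h1.congr fun n => ?_
  rw [Function.comp_apply, potential_eq hL hp,
    ENNReal.toReal_ofReal (mul_nonneg hcp.le (powNorm_nonneg _ _)), mul_div_cancel_left₀ _ hcp.ne']

/-- Coercivity and `I_ω ≤ 0` bound the energy by the `L^{p+1}` term, which converges along a
minimizing sequence. -/
theorem IsMinimizing.exists_energy_le {h : ℝ} (hL : L.SidesAbove h) (hp : 1 < p)
    (hω : -L.spectralBottom < ω) {u : ℕ → L.H1}
    (hu : IsMinimizing p ω u) (hl : L.level p ω ≠ ⊤) : ∃ C, ∀ n, energy (u n) ≤ C := by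
  obtain ⟨c, hc, hco⟩ := exists_coercive hω
  obtain ⟨M, hM⟩ := (hu.tendsto_powNorm hL hp hl).bddAbove_range
  refine ⟨M / c, fun n => ?_⟩
  rw [le_div_iff₀' hc]
  have h1 := (hu.1 n).2.2
  rw [nehari_eq] at h1
  linarith [hco _ (hu.1 n).1, hM ⟨n, rfl⟩]

theorem powNorm_pos {h : ℝ} (hL : L.SidesAbove h) {q : ℝ} (hq : 2 ≤ q) {u : L.H1}
    (hu : Nontriv u) : 0 < powNorm q u := by
  refine ENNReal.toReal_pos ?_ (lpPow_lt_top hL u hq).ne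
  rw [nontriv_iff] at hu
  contrapose! hu
  rw [lpPow_comp, lintegral_eq_zero_iff'
    ((Lp.aestronglyMeasurable (u.comp 0)).enorm.pow_const _)] at hu
  rw [Lp.eq_zero_iff_ae_eq_zero]
  filter_upwards [hu] with x hx
  simpa [show ¬ q < 0 by linarith, show 0 < q by linarith] using hx

theorem powNorm_eq_zero {q : ℝ} (hq : 0 < q) {u : L.H1} (hu : ¬ Nontriv u) : powNorm q u = 0 := by
  rw [nontriv_iff, not_not] at hu
  rw [powNorm, lpPow_comp]
  have : ∫⁻ x, ‖u.comp 0 x‖ₑ ^ q ∂L.mu = 0 := by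
    rw [lintegral_eq_zero_iff' ((Lp.aestronglyMeasurable (u.comp 0)).enorm.pow_const _)]
    filter_upwards [Lp.eq_zero_iff_ae_eq_zero.1 hu] with x hx
    simp [hx, hq]
  rw [this, ENNReal.toReal_zero]

theorem integrable_rpow {h : ℝ} (hL : L.SidesAbove h) {q : ℝ} (hq : 2 ≤ q) (u : L.H1) :
    Integrable (fun x => ‖u.comp 0 x‖ ^ q) L.mu := by
  refine ⟨((Lp.aestronglyMeasurable (u.comp 0)).norm.aemeasurable.pow_const _).aestronglyMeasurable,
    ?_⟩
  have h1 := lpPow_lt_top hL u hq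
  rw [lpPow_comp] at h1
  refine lt_of_eq_of_lt (lintegral_congr fun x => ?_) h1
  rw [Real.enorm_rpow_of_nonneg (norm_nonneg _) (by linarith), enorm_norm]

theorem powNorm_eq_integral {q : ℝ} (hq : 0 ≤ q) (u : L.H1) :
    powNorm q u = ∫ x, ‖u.comp 0 x‖ ^ q ∂L.mu := by
  rw [powNorm, lpPow_comp, integral_eq_lintegral_of_nonneg_ae
    (Eventually.of_forall fun x => by positivity)
    ((Lp.aestronglyMeasurable (u.comp 0)).norm.aemeasurable.pow_const _).aestronglyMeasurable]
  congr 1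
  refine lintegral_congr fun x => ?_
  rw [← ENNReal.ofReal_rpow_of_nonneg (norm_nonneg _) hq, ofReal_norm]

/-- The Hilbert space counterpart of the Brezis-Lieb lemma: expanding the square leaves only inner
products with the weak limit. -/
theorem tendsto_norm_sq_sub {H : Type*} [NormedAddCommGroup H] [InnerProductSpace ℂ H]
    {x : ℕ → H} {y : H} (h : Tendsto (fun n => inner ℂ y (x n)) atTop (𝓝 (inner ℂ y y))) :
    Tendsto (fun n => ‖x n‖ ^ 2 - ‖x n - y‖ ^ 2) atTop (𝓝 (‖y‖ ^ 2)) := by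
  have h1 : ∀ n, ‖x n‖ ^ 2 - ‖x n - y‖ ^ 2 = 2 * (inner ℂ y (x n)).re - ‖y‖ ^ 2 := by
    intro n
    rw [norm_sub_sq (𝕜 := ℂ), ← inner_conj_symm]
    simp only [RCLike.re_to_complex, Complex.conj_re]
    ring
  simp only [h1]
  have h2 : ‖y‖ ^ 2 = 2 * (inner ℂ y y).re - ‖y‖ ^ 2 := by
    have := inner_self_eq_norm_sq (𝕜 := ℂ) y
    simp only [RCLike.re_to_complex] at this
    rw [this]; ring
  nth_rw 2 [h2]
  exact (((Complex.continuous_re.tendsto _).comp h).const_mul 2).sub_const _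

/-- Subtracting a weak limit: the splitting of the quadratic part. -/
theorem WeakConv.tendsto_quad_sub {u : ℕ → L.H1} {v : L.H1} (h : WeakConv u v) (ω : ℝ) :
    Tendsto (fun n => quad ω (u n) - quad ω (H1.comb 1 (-1) (u n) v)) atTop (𝓝 (quad ω v)) := by
  have h1 : ∀ i, Tendsto (fun n => ‖(u n).comp i‖ ^ 2 - ‖(H1.comb 1 (-1) (u n) v).comp i‖ ^ 2)
      atTop (𝓝 (‖v.comp i‖ ^ 2)) := by
    intro i
    have := tendsto_norm_sq_sub (h i (v.comp i))
    simpa [H1.comp_comb, sub_eq_add_neg] using this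
  have h2 := ((h1 1).add (h1 2)).add ((h1 0).const_mul ω)
  simp only [quad, gradSq_eq, massSq_eq]
  refine h2.congr fun n => ?_
  ring

/-- Used to see that a remainder with negative Nehari functional is not zero, hence is admissible.
-/
theorem not_nontriv_nehari_nonneg {c : ℝ} (hc : 0 < c) (hp : 1 < p)
    (hco : ∀ u : L.H1, MemH1D u → c * energy u ≤ quad ω u) {w : L.H1} (hw : MemH1D w)
    (h : ¬ Nontriv w) : 0 ≤ nehari p ω w := by
  rw [nehari_eq, powNorm_eq_zero (by linarith) h, sub_zero]
  exact le_trans (mul_nonneg hc.le (energy_nonneg w)) (hco w hw)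

/-- A nonzero weak limit of a minimizing sequence is a minimizer. -/
theorem IsMinimizing.weakConv {h : ℝ} (hL : L.SidesAbove h) (hp : 1 < p)
    (hω : -L.spectralBottom < ω) (hl : L.level p ω ≠ ⊤) {u : ℕ → L.H1} {v : L.H1}
    (hu : IsMinimizing p ω u) (huv : WeakConv u v) (hv : Nontriv v) :
    Admissible p ω v ∧ powNorm (p + 1) v ≤ L.realLevel p ω := by
  obtain ⟨c, hc, hco⟩ := exists_coercive hω
  obtain ⟨C, hC⟩ := hu.exists_energy_le hL hp hω hl
  have hC' : ∀ n i, ‖(u n).comp i‖ ≤ √C := fun n i => norm_comp_le_of_energy_le (hC n) i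
  have hvD : MemH1D v := memH1D_of_weakConv huv hC' fun n => (hu.1 n).1
  set w : ℕ → L.H1 := fun n => H1.comb 1 (-1) (u n) v
  have hwc : ∀ n i, (w n).comp i = (u n).comp i - v.comp i := by
    intro n i
    simp [w, H1.comp_comb, sub_eq_add_neg]
  have hwD : ∀ n, MemH1D (w n) := fun n => (hu.1 n).1.comb hvD _ _
  have hwn : ∀ n i, ‖(w n).comp i‖ ≤ √C + ∑ i, ‖v.comp i‖ := by
    intro n i
    rw [hwc]
    refine (norm_sub_le _ _).trans (add_le_add (hC' n i) ?_)
    exact Finset.single_le_sum (f := fun i => ‖v.comp i‖) (fun i _ => norm_nonneg _)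
      (Finset.mem_univ i)
  have hw0 : ∀ e, Tendsto (fun n => inner ℂ e ((w n).comp 0)) atTop (𝓝 0) := by
    intro e
    have := (huv 0 e).sub_const (inner ℂ e (v.comp 0))
    simpa [hwc, inner_sub_right] using this
  -- Passing to a further subsequence serves only to obtain the almost everywhere convergence
  -- required by Brezis-Lieb.
  obtain ⟨φ, hφ, hae⟩ := exists_subseq_ae_tendsto_zero hwn hw0
  have hpow := (hu.comp_strictMono hφ).tendsto_powNorm hL hp hl
  have hq : (2 : ℝ) ≤ p + 1 := by linarith
  have hcongr : ∀ n, ∫ x, ‖v.comp 0 x + (w n).comp 0 x‖ ^ (p + 1) ∂L.mu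
      = powNorm (p + 1) (u n) := by
    intro n
    rw [powNorm_eq_integral (by linarith)]
    refine integral_congr_ae ?_
    have := Lp.coeFn_sub ((u n).comp 0) (v.comp 0)
    rw [← hwc] at this
    filter_upwards [this] with x hx
    rw [hx]
    simp
  have hbound : ∃ M, ∀ n, powNorm (p + 1) (w n) ≤ M := by
    obtain ⟨D, m, hD, hS⟩ := exists_toReal_lpPow_le hL (q := p + 1) (by linarith) one_pos
    set R := √C + ∑ i, ‖v.comp i‖
    have hR : ∀ n, energy (w n) ≤ 3 * R ^ 2 := by
      intro n
      have h0 := pow_le_pow_left₀ (norm_nonneg _) (hwn n 0) 2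
      have h1 := pow_le_pow_left₀ (norm_nonneg _) (hwn n 1) 2
      have h2 := pow_le_pow_left₀ (norm_nonneg _) (hwn n 2) 2
      rw [energy]; linarith
    refine ⟨1 * (3 * R ^ 2) + D * (3 * R ^ 2) * (3 * R ^ 2) ^ (m + 1), fun n => ?_⟩
    refine (hS (w n) _ (energy_nonneg _) (pageMass_le_energy _)).trans ?_
    have := energy_nonneg (w n)
    gcongr <;> exact hR n
  obtain ⟨M, hM⟩ := hbound
  have hBL := brezis_lieb (q := p + 1) (by linarith) (f := v.comp 0)
    (w := fun n => (w (φ n)).comp 0) (M := M) (integrable_rpow hL hq v)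
    (fun n => integrable_rpow hL hq _) (fun n => by
      refine (integrable_rpow hL hq (u (φ n))).congr ?_
      have := Lp.coeFn_sub ((u (φ n)).comp 0) (v.comp 0)
      rw [← hwc] at this
      filter_upwards [this] with x hx
      rw [hx]
      simp)
    (fun n => by rw [← powNorm_eq_integral (by linarith)]; exact hM _) hae
  simp only [hcongr, ← powNorm_eq_integral (show (0 : ℝ) ≤ p + 1 by linarith)] at hBL
  have hPw : Tendsto (fun n => powNorm (p + 1) (w (φ n))) atTop
      (𝓝 (L.realLevel p ω - powNorm (p + 1) v)) := by
    refine (hpow.sub hBL).congr fun n => ?_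
    ring
  have hN : Tendsto (fun n => nehari p ω (u (φ n)) - nehari p ω (w (φ n))) atTop
      (𝓝 (nehari p ω v)) := by
    refine ((((huv.comp_strictMono hφ).tendsto_quad_sub ω)).sub hBL).congr fun n => ?_
    simp only [nehari_eq, w]
    ring
  have hle : powNorm (p + 1) v ≤ L.realLevel p ω := by
    have := ge_of_tendsto' hPw fun n => powNorm_nonneg _ _
    linarith
  refine ⟨⟨hvD, hv, ?_⟩, hle⟩
  by_contra! hpos
  -- If `I_ω(v) > 0`, then `I_ω(u n) ≤ 0` forces `I_ω(w n) < 0` eventually. So the remainders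
  -- compete for the level, yet their `L^{p+1}` terms tend to the infimum minus the positive term of
  -- `v`.
  have hev : ∀ᶠ n in atTop, L.realLevel p ω ≤ powNorm (p + 1) (w (φ n)) := by
    filter_upwards [hN.eventually (lt_mem_nhds hpos)] with n hn
    have h1 := (hu.1 (φ n)).2.2
    refine realLevel_le hL hp ⟨hwD _, ?_, by linarith⟩
    by_contra h2
    linarith [not_nontriv_nehari_nonneg hc hp hco (hwD _) h2]
  have h1 := ge_of_tendsto hPw hev
  linarith [powNorm_pos hL hq hv]

/-! ### Scaling to the Nehari manifold -/

theorem quad_comb (ω : ℝ) {t : ℝ} (v : L.H1) :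
    quad ω (H1.comb t 0 v v) = t ^ 2 * quad ω v := by
  simp only [quad, gradSq_eq, massSq_eq, H1.comp_comb, zero_smul, add_zero, norm_smul, mul_pow,
    Complex.norm_real, Real.norm_eq_abs, sq_abs]
  ring

theorem powNorm_comb {q : ℝ} (hq : 0 ≤ q) {t : ℝ} (ht : 0 ≤ t) (v : L.H1) :
    powNorm q (H1.comb t 0 v v) = t ^ q * powNorm q v := by
  rw [powNorm_eq_integral hq, powNorm_eq_integral hq, ← integral_const_mul]
  refine integral_congr_ae ?_
  rw [H1.comp_comb, zero_smul, add_zero]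
  filter_upwards [Lp.coeFn_smul (t : ℂ) (v.comp 0)] with x hx
  rw [hx, Pi.smul_apply, norm_smul, Complex.norm_real, Real.norm_of_nonneg ht,
    Real.mul_rpow ht (norm_nonneg _)]

theorem nontriv_comb {t : ℝ} (ht : t ≠ 0) {v : L.H1} (hv : Nontriv v) :
    Nontriv (H1.comb t 0 v v) := by
  rw [nontriv_iff] at hv ⊢
  rw [H1.comp_comb, zero_smul, add_zero]
  exact smul_ne_zero (by exact_mod_cast ht) hv

/-- Minimizers lie on the Nehari manifold. -/
theorem nehari_eq_zero_of_minimizer {h : ℝ} (hL : L.SidesAbove h) (hp : 1 < p)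
    (hω : -L.spectralBottom < ω) {v : L.H1} (hv : Admissible p ω v)
    (hle : powNorm (p + 1) v ≤ L.realLevel p ω) : nehari p ω v = 0 := by
  obtain ⟨c, hc, hco⟩ := exists_coercive hω
  refine le_antisymm hv.2.2 ?_
  by_contra! hneg
  have hP := powNorm_pos hL (q := p + 1) (by linarith) hv.2.1
  have hQ : 0 < quad ω v := lt_of_lt_of_le (mul_pos hc (energy_pos hv.2.1)) (hco v hv.1)
  rw [nehari_eq] at hneg
  set r := quad ω v / powNorm (p + 1) v
  have hr0 : 0 < r := div_pos hQ hP
  have hr1 : r < 1 := (div_lt_one hP).2 (by linarith)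
  -- The scaling for which `t ^ (p - 1)` is the quotient of the quadratic and the power term, so
  -- that `t v` lies on the Nehari manifold. As `t < 1`, it would undercut the infimum.
  set t := r ^ (1 / (p - 1))
  have ht0 : 0 < t := by positivity
  have ht1 : t < 1 := Real.rpow_lt_one hr0.le hr1 (by apply one_div_pos.2; linarith)
  have htp : t ^ (p + 1) = t ^ 2 * r := by
    have e1 : t ^ (p - 1) = r := by
      rw [← Real.rpow_mul hr0.le, one_div, inv_mul_cancel₀ (by linarith), Real.rpow_one]
    rw [← e1, ← Real.rpow_natCast, ← Real.rpow_add ht0]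
    norm_num
    ring_nf
  have hadm : Admissible p ω (H1.comb t 0 v v) := by
    refine ⟨hv.1.comb hv.1 _ _, nontriv_comb ht0.ne' hv.2.1, ?_⟩
    rw [nehari_eq, quad_comb, powNorm_comb (by linarith) ht0.le, htp, mul_assoc,
      div_mul_cancel₀ _ hP.ne', sub_self]
  have h1 := realLevel_le hL hp hadm
  rw [powNorm_comb (by linarith) ht0.le] at h1
  have h2 : t ^ (p + 1) < 1 := Real.rpow_lt_one ht0.le ht1 (by linarith)
  nlinarith

theorem action_eq_of_nehari_eq_zero (hp : 1 < p) {v : L.H1} (h : nehari p ω v = 0) :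
    action p ω v = (p - 1) / (2 * (p + 1)) * powNorm (p + 1) v := by
  rw [nehari_eq, quad, sub_eq_zero] at h
  have : action p ω v = 1 / 2 * (gradSq v + ω * massSq v) - 1 / (p + 1) * powNorm (p + 1) v := by
    rw [action, powNorm]; ring
  rw [this, h]
  have : p + 1 ≠ 0 := by linarith
  field_simp
  ring

/-- Minimizing sequences with a nonzero weak limit produce ground states. -/
theorem IsMinimizing.exists_isGroundState {h : ℝ} (hL : L.SidesAbove h) (hp : 1 < p)
    (hω : -L.spectralBottom < ω) (hl : L.level p ω ≠ ⊤) {u : ℕ → L.H1} {v : L.H1}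
    (hu : IsMinimizing p ω u) (huv : WeakConv u v) (hv : Nontriv v) :
    IsGroundState p ω v ∧ potential p v = L.level p ω ∧
      ENNReal.ofReal (action p ω v) = L.level p ω := by
  obtain ⟨h1, h2⟩ := hu.weakConv hL hp hω hl huv hv
  have h3 := nehari_eq_zero_of_minimizer hL hp hω h1 h2
  have h4 : powNorm (p + 1) v = L.realLevel p ω := le_antisymm h2 (realLevel_le hL hp h1)
  have h5 := action_eq_of_nehari_eq_zero hp h3
  refine ⟨⟨h1.1, hv, h3, fun w hw hw' hw0 => ?_⟩, ?_, ?_⟩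
  · rw [h5, action_eq_of_nehari_eq_zero hp hw0, h4]
    refine mul_le_mul_of_nonneg_left (realLevel_le hL hp ⟨hw, hw', hw0.le⟩)
      (div_nonneg (by linarith) (by linarith))
  · rw [potential_eq hL hp, h4, ofReal_realLevel hp hl]
  · rw [h5, h4, ofReal_realLevel hp hl]

/-! ### Finite books -/

theorem exists_ofReal_lt_sides (k : L.Page) :
    ∃ h > 0, ENNReal.ofReal h < L.width k ∧ ENNReal.ofReal h < L.height k := by
  obtain ⟨r, hr0, hr⟩ := ENNReal.lt_iff_exists_nnreal_btwn.1
    (lt_min (L.width_pos k) (L.height_pos k))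
  refine ⟨r, by exact_mod_cast hr0, ?_⟩
  rw [ENNReal.ofReal_coe_nnreal]
  exact lt_min_iff.1 hr

theorem IsFinite.exists_sidesAbove (hL : L.IsFinite) : ∃ h, L.SidesAbove h := by
  have := hL.1
  choose h h0 h1 h2 using exists_ofReal_lt_sides (L := L)
  rcases isEmpty_or_nonempty L.Page with hE | hE
  · exact ⟨1, one_pos, fun k => (hE.false k).elim⟩
  · obtain ⟨k₀, hk₀⟩ := Finite.exists_min h
    exact ⟨h k₀, h0 k₀, fun k => ⟨(ENNReal.ofReal_le_ofReal (hk₀ k)).trans_lt (h1 k),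
      (ENNReal.ofReal_le_ofReal (hk₀ k)).trans_lt (h2 k)⟩⟩

/-- Every test function integrates to zero against `v`, so the fundamental lemma of the calculus of
variations applies. -/
theorem ae_eq_zero_of_isWeakDeriv {Ω : Set (ℝ × ℝ)} (hΩ : IsOpen Ω) {e : ℝ × ℝ}
    {u v : ℝ × ℝ → ℂ} (h : IsWeakDeriv Ω e u v) (hu : u =ᵐ[volume.restrict Ω] 0)
    (hv : MemLp v 2 (volume.restrict Ω)) : v =ᵐ[volume.restrict Ω] 0 := by
  have hloc : LocallyIntegrableOn v Ω volume := by
    refine locallyIntegrableOn_of_locallyIntegrable_restrict ?_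
    exact hv.locallyIntegrable (by norm_num)
  have := hΩ.ae_eq_zero_of_integral_contDiff_smul_eq_zero (μ := volume) hloc
    (fun g hg1 hg2 hg3 => by
      have h1 := h g hg1 hg2 hg3
      have h2 : ∫ z in Ω, fderiv ℝ g z e • u z = 0 := by
        rw [integral_eq_zero_of_ae]
        filter_upwards [hu] with z hz
        simp [hz]
      rw [h2, eq_comm, neg_eq_zero] at h1
      rw [← h1, setIntegral_eq_integral_of_forall_compl_eq_zero]
      intro z hz
      have : g z = 0 := image_eq_zero_of_notMem_tsupport fun h => hz (hg3 h)
      simp [this])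
  rw [EventuallyEq, ae_restrict_iff' hΩ.measurableSet]
  exact this

/-- `Nontriv` looks only at the function, whereas weak convergence in `H¹` also involves the
gradient; a vanishing function must therefore be shown to have vanishing weak derivatives. -/
theorem comp_eq_zero_of_not_nontriv {v : L.H1} (hv : ¬ Nontriv v) (i : Fin 3) : v.comp i = 0 := by
  rw [nontriv_iff, not_not] at hv
  have h0 : ∀ k, v.part 0 k =ᵐ[volume.restrict (L.rect k)] 0 := by
    intro k
    have h1 := ae_mu_iff.1 (Lp.eq_zero_iff_ae_eq_zero.1 hv) k
    filter_upwards [h1, v.coeFn_comp_page 0 k] with z hz hz'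
    rw [← hz']
    exact hz
  have key : ∀ k, v.part i k =ᵐ[volume.restrict (L.rect k)] 0 := by
    intro k
    have ho : IsOpen (L.rect k) := isOpen_openRect _ _
    fin_cases i
    · exact h0 k
    · exact ae_eq_zero_of_isWeakDeriv ho (v.weak_dx k) (h0 k) (v.memLp_dx k)
    · exact ae_eq_zero_of_isWeakDeriv ho (v.weak_dy k) (h0 k) (v.memLp_dy k)
  rw [Lp.eq_zero_iff_ae_eq_zero, EventuallyEq, ae_mu_iff]
  intro k
  filter_upwards [key k, v.coeFn_comp_page i k] with z hz hz'
  rw [hz', hz]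
  rfl

/-- Below the level at infinity, minimizing sequences do not vanish weakly. -/
theorem exists_isGroundState_of_lt {h : ℝ} (hL : L.SidesAbove h) (hp : 1 < p)
    (hω : -L.spectralBottom < ω) (hlt : L.level p ω < L.levelAtInfinity p ω) :
    ∃ v : L.H1, IsGroundState p ω v ∧ potential p v = L.level p ω ∧
      ENNReal.ofReal (action p ω v) = L.level p ω := by
  have hl : L.level p ω ≠ ⊤ := hlt.ne_top
  obtain ⟨u, hu⟩ := exists_isMinimizing hl
  obtain ⟨C, hC⟩ := hu.exists_energy_le hL hp hω hl
  obtain ⟨v, φ, hφ, hv⟩ := exists_subseq_weakConv u fun n i => norm_comp_le_of_energy_le (hC n) i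
  have hu' := hu.comp_strictMono hφ
  by_cases hnt : Nontriv v
  · exact ⟨v, hu'.exists_isGroundState hL hp hω hl hv hnt⟩
  · exfalso
    -- With weak limit zero the minimizing sequence is a competitor for the level at infinity, which
    -- would then be at most the level.
    have hnull : WeaklyNull fun n => u (φ n) := by
      intro w
      simp only [h1Inner_eq]
      have : (0 : ℂ) = ∑ i : Fin 3, inner ℂ (w.comp i) (v.comp i) := by
        simp [comp_eq_zero_of_not_nontriv hnt]
      rw [this]
      exact tendsto_finsetSum _ fun i _ => hv i (w.comp i)
    have h1 : L.levelAtInfinity p ω ≤ liminf (fun n => potential p (u (φ n))) atTop :=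
      iInf₂_le (fun n => u (φ n)) ⟨hnull, hu'.1⟩
    rw [hu'.2.liminf_eq] at h1
    exact absurd hlt h1.not_gt

end OpenBook

end

noncomputable section

/-! ### Isometries between rectangles -/

open OpenBook (euclSq)

theorem mem_closedSeg_zero (a : ℝ≥0∞) : (0 : ℝ) ∈ closedSeg a := ⟨le_rfl, by simp⟩

theorem closedSeg_injective {a b : ℝ≥0∞} (h : closedSeg a = closedSeg b) : a = b := by
  have key : ∀ {a b : ℝ≥0∞}, closedSeg a = closedSeg b → a ≤ b := by
    intro a b h
    refine ENNReal.le_of_forall_nnreal_lt fun r hr => ?_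
    have h1 : (r : ℝ) ∈ closedSeg a := ⟨r.2, by rw [ENNReal.ofReal_coe_nnreal]; exact hr.le⟩
    rw [h] at h1
    simpa using h1.2
  exact le_antisymm (key h) (key h.symm)

/-- `f` restricts to an isometry from `[0, a] × [0, b]` onto `[0, a'] × [0, b']`. -/
structure IsRectIso (a b a' b' : ℝ≥0∞) (f : ℝ × ℝ → ℝ × ℝ) : Prop where
  mapsTo : ∀ z ∈ closedRect a b, f z ∈ closedRect a' b'
  surj : ∀ w ∈ closedRect a' b', ∃ z ∈ closedRect a b, f z = w
  euclSq_eq : ∀ z ∈ closedRect a b, ∀ w ∈ closedRect a b, euclSq (f z) (f w) = euclSq z w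

namespace IsRectIso

variable {a b a' b' : ℝ≥0∞} {f : ℝ × ℝ → ℝ × ℝ}

theorem zero_mem (a b : ℝ≥0∞) : (0 : ℝ × ℝ) ∈ closedRect a b :=
  ⟨mem_closedSeg_zero a, mem_closedSeg_zero b⟩

/-- The corner at the origin is not mapped into the interior of the horizontal range. -/
theorem fst_zero_notMem (h : IsRectIso a b a' b' f) : (f 0).1 ∉ openSeg a' := by
  rintro ⟨h0, h1⟩
  obtain ⟨r, hr1, hr2⟩ := ENNReal.lt_iff_exists_nnreal_btwn.1 h1
  have hr1' : (f 0).1 < r := by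
    rw [← ENNReal.ofReal_coe_nnreal] at hr1
    exact (ENNReal.ofReal_lt_ofReal_iff_of_nonneg h0.le).1 hr1
  set x := (f 0).1
  set ε := min x (r - x)
  have hε : 0 < ε := lt_min h0 (by linarith)
  have e1 : ε ≤ x := min_le_left _ _
  have e2 : ε ≤ r - x := min_le_right _ _
  have hmem : ∀ t : ℝ, |t| ≤ ε → ((x + t, (f 0).2) : ℝ × ℝ) ∈ closedRect a' b' := by
    intro t ht
    rw [abs_le] at ht
    refine ⟨⟨by simp only; linarith, ?_⟩, (h.mapsTo 0 (zero_mem a b)).2⟩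
    refine (ENNReal.ofReal_le_ofReal (show x + t ≤ r by linarith)).trans ?_
    rw [ENNReal.ofReal_coe_nnreal]
    exact hr2.le
  -- If the image of the corner had room on both sides, the points at distance `ε` to its right and
  -- left would be images of `p` and `m`. These lie in the closed quadrant, so their inner product
  -- is nonnegative; the isometry property makes it `-ε²`.
  obtain ⟨p, hp, hfp⟩ := h.surj _ (hmem ε (by rw [abs_of_pos hε]))
  obtain ⟨m, hm, hfm⟩ := h.surj _ (hmem (-ε) (by rw [abs_neg, abs_of_pos hε]))
  have q1 := h.euclSq_eq p hp 0 (zero_mem a b)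
  have q2 := h.euclSq_eq m hm 0 (zero_mem a b)
  have q3 := h.euclSq_eq p hp m hm
  rw [hfp] at q1 q3
  rw [hfm] at q2 q3
  simp only [euclSq, Prod.fst_zero, Prod.snd_zero] at q1 q2 q3
  have := mul_nonneg hp.1.1 hm.1.1
  have := mul_nonneg hp.2.1 hm.2.1
  have := mul_pos hε hε
  nlinarith

theorem comp_swap (h : IsRectIso a b a' b' f) : IsRectIso a b b' a' fun z => ((f z).2, (f z).1) where
  mapsTo z hz := ⟨(h.mapsTo z hz).2, (h.mapsTo z hz).1⟩
  surj w hw := by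
    obtain ⟨z, hz, e⟩ := h.surj (w.2, w.1) ⟨hw.2, hw.1⟩
    exact ⟨z, hz, by rw [e]⟩
  euclSq_eq z hz w hw := by
    rw [← h.euclSq_eq z hz w hw, euclSq, euclSq]
    ring

theorem comp_reflX (h : IsRectIso a b a' b' f) (ha : a' ≠ ⊤) :
    IsRectIso a b a' b' fun z => (a'.toReal - (f z).1, (f z).2) := by
  have hm : ∀ t, a'.toReal - t ∈ closedSeg a' ↔ t ∈ closedSeg a' := fun t => by
    simpa [flipIf] using flipIf_mem_closedSeg (r := true) (ℓ := a') (t := t) fun _ => ha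
  refine ⟨fun z hz => ⟨(hm _).2 (h.mapsTo z hz).1, (h.mapsTo z hz).2⟩, fun w hw => ?_,
    fun z hz w hw => ?_⟩
  · obtain ⟨z, hz, e⟩ := h.surj (a'.toReal - w.1, w.2) ⟨(hm _).2 hw.1, hw.2⟩
    exact ⟨z, hz, by rw [e]; simp⟩
  · rw [← h.euclSq_eq z hz w hw, euclSq, euclSq]
    ring

theorem exists_pos_mem {a b : ℝ≥0∞} (ha : 0 < a) (hb : 0 < b) :
    ∃ ε : ℝ, 0 < ε ∧ ε ∈ closedSeg a ∧ ε ∈ closedSeg b := by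
  obtain ⟨r, hr0, hr⟩ := ENNReal.lt_iff_exists_nnreal_btwn.1 (lt_min ha hb)
  have h0 : (0 : ℝ) < r := by exact_mod_cast hr0
  refine ⟨r, h0, ⟨h0.le, ?_⟩, h0.le, ?_⟩ <;> rw [ENNReal.ofReal_coe_nnreal]
  exacts [hr.le.trans (min_le_left _ _), hr.le.trans (min_le_right _ _)]

/-- An isometry fixing the corner at the origin is the identity or the exchange of coordinates. -/
theorem eq_id_or_swap (h : IsRectIso a b a' b' f) (ha : 0 < a) (hb : 0 < b) (h0 : f 0 = 0) :
    (∀ z ∈ closedRect a b, f z = z) ∨ ∀ z ∈ closedRect a b, f z = (z.2, z.1) := by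
  -- Polarization: an isometry that fixes the origin preserves inner products.
  have hinner : ∀ z ∈ closedRect a b, ∀ w ∈ closedRect a b,
      (f z).1 * (f w).1 + (f z).2 * (f w).2 = z.1 * w.1 + z.2 * w.2 := by
    intro z hz w hw
    have q1 := h.euclSq_eq z hz 0 (zero_mem a b)
    have q2 := h.euclSq_eq w hw 0 (zero_mem a b)
    have q3 := h.euclSq_eq z hz w hw
    rw [h0] at q1 q2
    simp only [euclSq, Prod.fst_zero, Prod.snd_zero] at q1 q2 q3
    linarith
  obtain ⟨ε, hε, hεa, hεb⟩ := exists_pos_mem ha hb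
  have m1 : ((ε, 0) : ℝ × ℝ) ∈ closedRect a b := ⟨hεa, mem_closedSeg_zero b⟩
  have m2 : ((0, ε) : ℝ × ℝ) ∈ closedRect a b := ⟨mem_closedSeg_zero a, hεb⟩
  have i11 := hinner _ m1 _ m1
  have i22 := hinner _ m2 _ m2
  have i12 := hinner _ m1 _ m2
  have p1 := (h.mapsTo _ m1).1.1
  have p2 := (h.mapsTo _ m1).2.1
  have p3 := (h.mapsTo _ m2).1.1
  have p4 := (h.mapsTo _ m2).2.1
  have hz1 := fun z hz => hinner z hz _ m1
  have hz2 := fun z hz => hinner z hz _ m2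
  set p := (f (ε, 0)).1
  set q := (f (ε, 0)).2
  set r := (f (0, ε)).1
  set s := (f (0, ε)).2
  simp only [mul_zero, zero_mul, add_zero, zero_add] at i11 i22 i12 hz1 hz2
  -- The images of the two axis vectors are orthogonal with nonnegative coordinates, so both
  -- products vanish and the images lie on different axes.
  have hpr : p * r = 0 := by nlinarith [mul_nonneg p1 p3, mul_nonneg p2 p4]
  have hqs : q * s = 0 := by nlinarith [mul_nonneg p1 p3, mul_nonneg p2 p4]
  rcases mul_eq_zero.1 hpr with hp | hr
  · right
    have hq : q = ε := by
      rw [hp] at i11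
      nlinarith
    have hs : s = 0 := (mul_eq_zero.1 hqs).resolve_left (by rw [hq]; exact hε.ne')
    have hr : r = ε := by
      rw [hs] at i22
      nlinarith
    intro z hz
    have e1 := hz1 z hz
    have e2 := hz2 z hz
    rw [hp, hq, mul_zero, zero_add] at e1
    rw [hr, hs, mul_zero, add_zero] at e2
    exact Prod.ext (mul_right_cancel₀ hε.ne' e2) (mul_right_cancel₀ hε.ne' e1)
  · left
    have hs : s = ε := by
      rw [hr] at i22
      nlinarith
    have hq : q = 0 := (mul_eq_zero.1 hqs).resolve_right (by rw [hs]; exact hε.ne')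
    have hp : p = ε := by
      rw [hq] at i11
      nlinarith
    intro z hz
    have e1 := hz1 z hz
    have e2 := hz2 z hz
    rw [hp, hq, mul_zero, add_zero] at e1
    rw [hr, hs, mul_zero, zero_add] at e2
    exact Prod.ext (mul_right_cancel₀ hε.ne' e1) (mul_right_cancel₀ hε.ne' e2)

theorem closedRect_injective (h : closedRect a b = closedRect a' b') : a = a' ∧ b = b' := by
  constructor <;> refine closedSeg_injective (Set.ext fun t => ?_)
  · have := Set.ext_iff.1 h (t, 0)
    simpa [closedRect, mem_closedSeg_zero] using this
  · have := Set.ext_iff.1 h (0, t)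
    simpa [closedRect, mem_closedSeg_zero] using this

theorem exists_pageSym_of_zero (h : IsRectIso a b a' b' f) (ha : 0 < a) (hb : 0 < b)
    (h0 : f 0 = 0) : ∃ S : PageSym a b a' b', ∀ z ∈ closedRect a b, f z = S.map z := by
  rcases h.eq_id_or_swap ha hb h0 with h1 | h1
  · have hR : closedRect a b = closedRect a' b' := by
      ext z
      constructor
      · intro hz
        rw [← h1 z hz]
        exact h.mapsTo z hz
      · intro hz
        obtain ⟨w, hw, rfl⟩ := h.surj z hz
        rwa [h1 w hw]
    obtain ⟨rfl, rfl⟩ := closedRect_injective hR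
    exact ⟨PageSym.refl a b, h1⟩
  · have hR : closedRect b a = closedRect a' b' := by
      ext z
      constructor
      · intro hz
        have := h.mapsTo (z.2, z.1) ⟨hz.2, hz.1⟩
        rwa [h1 (z.2, z.1) ⟨hz.2, hz.1⟩] at this
      · intro hz
        obtain ⟨w, hw, rfl⟩ := h.surj z hz
        rw [h1 w hw]
        exact ⟨hw.2, hw.1⟩
    obtain ⟨rfl, rfl⟩ := closedRect_injective hR
    exact ⟨PageSym.swap a b, h1⟩

theorem eq_zero_or_of_notMem {a : ℝ≥0∞} {t : ℝ} (h : t ∈ closedSeg a) (h' : t ∉ openSeg a) :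
    t = 0 ∨ a ≠ ⊤ ∧ t = a.toReal := by
  rcases h.1.eq_or_lt with h0 | h0
  · exact Or.inl h0.symm
  · right
    have h1 : ENNReal.ofReal t = a := le_antisymm h.2 (not_lt.1 fun h2 => h' ⟨h0, h2⟩)
    rw [← h1]
    exact ⟨ENNReal.ofReal_ne_top, by rw [ENNReal.toReal_ofReal h.1]⟩

/-- If the origin goes to the upper corner, a reflection of the target brings it back to the origin;
the reflection is an involution and is undone afterwards. -/
theorem exists_pageSym_of_fst (h : IsRectIso a b a' b' f) (ha : 0 < a) (hb : 0 < b)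
    (h0 : (f 0).1 = 0) : ∃ S : PageSym a b a' b', ∀ z ∈ closedRect a b, f z = S.map z := by
  have hm := h.mapsTo 0 (zero_mem a b)
  rcases eq_zero_or_of_notMem hm.2 h.comp_swap.fst_zero_notMem with h2 | ⟨hb', h2⟩
  · exact h.exists_pageSym_of_zero ha hb (Prod.ext h0 h2)
  · obtain ⟨S, hS⟩ := ((h.comp_swap.comp_reflX hb').comp_swap).exists_pageSym_of_zero ha hb
      (by simp [h0, h2])
    refine ⟨(PageSym.reflY a' b' hb').comp S, fun z hz => ?_⟩
    change f z = (PageSym.reflY a' b' hb').map (S.map z)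
    rw [← hS z hz]
    simp [PageSym.reflY, PageSym.comp, PageSym.swap, PageSym.reflX]

/-- Isometries between rectangles are symmetries. -/
theorem exists_pageSym (h : IsRectIso a b a' b' f) (ha : 0 < a) (hb : 0 < b) :
    ∃ S : PageSym a b a' b', ∀ z ∈ closedRect a b, f z = S.map z := by
  have hm := h.mapsTo 0 (zero_mem a b)
  rcases eq_zero_or_of_notMem hm.1 h.fst_zero_notMem with h1 | ⟨ha', h1⟩
  · exact h.exists_pageSym_of_fst ha hb h1
  · obtain ⟨S, hS⟩ := (h.comp_reflX ha').exists_pageSym_of_fst ha hb (by simp [h1])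
    refine ⟨(PageSym.reflX a' b' ha').comp S, fun z hz => ?_⟩
    change f z = (PageSym.reflX a' b' ha').map (S.map z)
    rw [← hS z hz]
    simp [PageSym.reflX]

end IsRectIso

theorem exists_pageSym_of_equiv {a b a' b' : ℝ≥0∞} (ha : 0 < a) (hb : 0 < b)
    (φ : closedRect a b ≃ closedRect a' b') (hφ : ∀ z w, euclSq (φ z) (φ w) = euclSq z w) :
    ∃ S : PageSym a b a' b', ∀ z : closedRect a b, (φ z : ℝ × ℝ) = S.map z := by
  classical
  set f : ℝ × ℝ → ℝ × ℝ := fun z => if h : z ∈ closedRect a b then φ ⟨z, h⟩ else 0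
  have hf : ∀ z : closedRect a b, f z = φ z := fun z => dif_pos z.2
  have h : IsRectIso a b a' b' f := by
    refine ⟨fun z hz => ?_, fun w hw => ?_, fun z hz w hw => ?_⟩
    · rw [hf ⟨z, hz⟩]; exact (φ ⟨z, hz⟩).2
    · exact ⟨φ.symm ⟨w, hw⟩, (φ.symm ⟨w, hw⟩).2, by rw [hf]; simp⟩
    · rw [hf ⟨z, hz⟩, hf ⟨w, hw⟩, hφ]
  obtain ⟨S, hS⟩ := h.exists_pageSym ha hb
  exact ⟨S, fun z => by rw [← hf, hS z z.2]⟩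

end

noncomputable section

/-! ### Symmetries of a book -/

namespace OpenBook

/-- A symmetry of a book: pages are mapped to pages by symmetries of rectangles, compatibly with
the parametrizations of the bindings. -/
structure Sym (L : OpenBook) where
  page : L.Page ≃ L.Page
  sym : ∀ k, PageSym (L.width k) (L.height k) (L.width (page k)) (L.height (page k))
  binding : L.Binding → L.Binding
  reparam : L.Binding → ℝ → ℝ
  attach_eq : ∀ k (s : L.Sides k),
    L.attach (page k) ⟨(sym k).side s.1, (sym k).present _ s.2⟩ = binding (L.attach k s)
  coord_eq : ∀ k (s : L.Sides k), ∀ t ∈ openSeg (s.1.length (L.width k) (L.height k)),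
    L.coord (page k) ⟨(sym k).side s.1, (sym k).present _ s.2⟩
      (flipIf ((sym k).rev s.1) (s.1.length (L.width k) (L.height k)) t) =
    reparam (L.attach k s) (L.coord k s t)

namespace Sym

variable {L : OpenBook} (T : L.Sym)

/-- The components of the pull back of an `H¹` function. -/
def pullPart (u : L.H1) (i : Fin 3) (k : L.Page) : ℝ × ℝ → ℂ :=
  (T.sym k).pull (fun i => u.part i (T.page k)) i

theorem lintegral_pullPart_zero (u : L.H1) (k : L.Page) (F : ℂ → ℝ≥0∞) :
    ∫⁻ z in L.rect k, F (T.pullPart u 0 k z) =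
      ∫⁻ z in L.rect (T.page k), F (u.part 0 (T.page k) z) :=
  (T.sym k).setLIntegral_comp fun z => F (u.part 0 (T.page k) z)

theorem lpPow_pullPart_zero (u : L.H1) (q : ℝ) :
    L.lpPow q (T.pullPart u 0) = L.lpPow q (u.part 0) := by
  rw [lpPow, lpPow, ← T.page.tsum_eq fun k => ∫⁻ z in L.rect k, ‖u.part 0 k z‖ₑ ^ q]
  exact tsum_congr fun k => T.lintegral_pullPart_zero u k fun w => ‖w‖ₑ ^ q

theorem aestronglyMeasurable_pullPart (u : L.H1) (i : Fin 3) (k : L.Page) :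
    AEStronglyMeasurable (T.pullPart u i k) (volume.restrict (L.rect k)) :=
  (T.sym k).aestronglyMeasurable_pull
    (fun i => (u.memLp_part_page i (T.page k)).aestronglyMeasurable) i

theorem lpPow_pullPart_grad (u : L.H1) :
    L.lpPow 2 (T.pullPart u 1) + L.lpPow 2 (T.pullPart u 2) =
      L.lpPow 2 (u.part 1) + L.lpPow 2 (u.part 2) := by
  simp only [lpPow]
  rw [← ENNReal.tsum_add, ← ENNReal.tsum_add, ← T.page.tsum_eq fun k =>
    (∫⁻ z in L.rect k, ‖u.part 1 k z‖ₑ ^ (2 : ℝ)) + ∫⁻ z in L.rect k, ‖u.part 2 k z‖ₑ ^ (2 : ℝ)]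
  refine tsum_congr fun k => ?_
  rw [← lintegral_add_left' ((T.aestronglyMeasurable_pullPart u 1 k).enorm.pow_const _),
    ← lintegral_add_left' ((u.memLp_part_page 1 _).aestronglyMeasurable.enorm.pow_const _)]
  refine Eq.trans (lintegral_congr fun z => (T.sym k).grad_pull _ z) ?_
  exact (T.sym k).setLIntegral_comp fun z =>
    ‖u.part 1 (T.page k) z‖ₑ ^ (2 : ℝ) + ‖u.part 2 (T.page k) z‖ₑ ^ (2 : ℝ)

theorem memLp_pullPart (u : L.H1) (i : Fin 3) :
    MemLp (fun x : L.Page × (ℝ × ℝ) => T.pullPart u i x.1 x.2) 2 L.mu := by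
  have h : L.lpPow 2 (T.pullPart u i) < ⊤ := by
    have hg : L.lpPow 2 (T.pullPart u 1) + L.lpPow 2 (T.pullPart u 2) < ⊤ := by
      rw [lpPow_pullPart_grad]
      exact ENNReal.add_lt_top.2 ⟨u.lpPow_dx_lt, u.lpPow_dy_lt⟩
    fin_cases i
    · change L.lpPow 2 (T.pullPart u 0) < ⊤
      rw [lpPow_pullPart_zero]
      exact u.lpPow_lt
    · exact (ENNReal.add_lt_top.1 hg).1
    · exact (ENNReal.add_lt_top.1 hg).2
  rw [memLp_two_iff, aestronglyMeasurable_mu_iff, ← lpPow_eq]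
  exact ⟨fun k => T.aestronglyMeasurable_pullPart u i k, h⟩

theorem isWeakDeriv_pullPart (u : L.H1) (k : L.Page) (i : Bool) :
    IsWeakDeriv (L.rect k) (axisDir i) (T.pullPart u 0 k)
      (fun z => (T.sym k).sgn i • PageSym.gradComp (fun i => u.part i (T.page k))
        ((T.sym k).idx i) ((T.sym k).map z)) := by
  refine (T.sym k).isWeakDeriv_pull (u := u.part 0 (T.page k)) ?_
  cases (T.sym k).idx i
  · exact u.weak_dx (T.page k)
  · exact u.weak_dy (T.page k)

/-- The pull back of an `H¹` function under a symmetry. -/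
def pull (u : L.H1) : L.H1 :=
  H1.ofParts (T.pullPart u) (T.memLp_pullPart u) (fun k => T.isWeakDeriv_pullPart u k false)
    (fun k => T.isWeakDeriv_pullPart u k true)

theorem lpPow_pull (q : ℝ) (u : L.H1) : L.lpPow q (T.pull u).toFun = L.lpPow q u.toFun :=
  T.lpPow_pullPart_zero u q

theorem gradSq_pull (u : L.H1) : gradSq (T.pull u) = gradSq u :=
  congrArg ENNReal.toReal (T.lpPow_pullPart_grad u)

theorem massSq_pull (u : L.H1) : massSq (T.pull u) = massSq u :=
  congrArg ENNReal.toReal (T.lpPow_pull 2 u)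

theorem pageMass_pull (u : L.H1) (k : L.Page) : pageMass (T.pull u) k = pageMass u (T.page k) :=
  T.lintegral_pullPart_zero u k fun w => ‖w‖ₑ ^ 2

theorem memH1D_pull {u : L.H1} (hu : MemH1D u) : MemH1D (T.pull u) := by
  intro j
  obtain ⟨G, hG⟩ := hu (T.binding j)
  refine ⟨fun τ => G (T.reparam j τ), ?_⟩
  rintro k s rfl
  have h1 := hG (T.page k) ⟨(T.sym k).side s.1, (T.sym k).present _ s.2⟩ (T.attach_eq k s)
  have h2 := (T.sym k).isTrace_pull (U := fun i => u.part i (T.page k)) s.2 h1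
  refine h2.congr EventuallyEq.rfl EventuallyEq.rfl EventuallyEq.rfl ?_
  refine (ae_restrict_iff' (measurableSet_openSeg _)).2 (Eventually.of_forall fun t ht => ?_)
  simp only
  rw [T.coord_eq k s t ht]

theorem nontriv_pull {u : L.H1} (hu : Nontriv u) : Nontriv (T.pull u) := by
  rwa [Nontriv, lpPow_pull]

theorem nehari_pull (p ω : ℝ) (u : L.H1) : nehari p ω (T.pull u) = nehari p ω u := by
  rw [nehari, nehari, gradSq_pull, massSq_pull, lpPow_pull]

theorem potential_pull (p : ℝ) (u : L.H1) : potential p (T.pull u) = potential p u := by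
  rw [potential, potential, lpPow_pull]

theorem admissible_pull {p ω : ℝ} {u : L.H1} (hu : Admissible p ω u) :
    Admissible p ω (T.pull u) :=
  ⟨T.memH1D_pull hu.1, T.nontriv_pull hu.2.1, by rw [nehari_pull]; exact hu.2.2⟩

end Sym

/-! ### Ground states on books with finitely many pages up to symmetry -/

variable {L : OpenBook}

/-- Sequences without vanishing carry a fixed amount of mass on some page. -/
theorem exists_lt_pageMass {h : ℝ} (hL : L.SidesAbove h) {q : ℝ} (hq : 2 < q) {C ε : ℝ}
    (hC : 0 ≤ C) (hε : 0 < ε) : ∃ δ > 0, ∀ u : L.H1, energy u ≤ C → ε ≤ powNorm q u →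
      ∃ k, ENNReal.ofReal δ < pageMass u k := by
  obtain ⟨D, n, hD, hS⟩ := exists_toReal_lpPow_le hL hq (ε := ε / (4 * (C + 1))) (by positivity)
  -- Both terms of the interpolated Sobolev inequality become at most `ε / 4` if no page carries
  -- mass above this value. The summands `1` avoid division by zero.
  refine ⟨ε / (4 * (D * C ^ (n + 1) + 1)), by positivity, fun u hu hP => ?_⟩
  by_contra! hcon
  set δ := ε / (4 * (D * C ^ (n + 1) + 1))
  have hδ : 0 < δ := by positivity
  have h1 := hS u δ hδ.le hcon
  have hE := energy_nonneg u
  have h2 : ε / (4 * (C + 1)) * energy u ≤ ε / (4 * (C + 1)) * (C + 1) := by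
    gcongr; linarith
  have h3 : D * δ * energy u ^ (n + 1) ≤ D * δ * C ^ (n + 1) := by gcongr
  have h4 : D * δ * C ^ (n + 1) ≤ δ * (D * C ^ (n + 1) + 1) := by nlinarith
  have h5 : ε / (4 * (C + 1)) * (C + 1) = ε / 4 := by field_simp
  have h6 : δ * (D * C ^ (n + 1) + 1) = ε / 4 := by simp only [δ]; field_simp
  change powNorm q u ≤ _ at h1
  linarith

theorem exists_frequently_eq {α : Type*} {F : Finset α} {k : ℕ → α} (hk : ∀ n, k n ∈ F) :
    ∃ k₀, ∃ᶠ n in atTop, k n = k₀ := by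
  by_contra! hcon
  have h1 : ∀ᶠ n in atTop, ∀ k₀ ∈ F, k n ≠ k₀ :=
    (Filter.eventually_all_finset F).2 fun k₀ _ => hcon k₀
  obtain ⟨n, hn⟩ := h1.exists
  exact hn _ (hk n) rfl

variable {p ω : ℝ}

/-- Each member of a minimizing sequence has a fixed amount of mass on some page; pulling back by a
symmetry moves this mass to one of finitely many pages and keeps the sequence minimizing. By the
pigeonhole principle the page may be assumed constant. -/
theorem exists_isGroundState_of_sym {h : ℝ} (hL : L.SidesAbove h) (hp : 1 < p)
    (hω : -L.spectralBottom < ω) (hl : L.level p ω ≠ ⊤)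
    (hfin : ∀ k, L.width k ≠ ⊤ ∧ L.height k ≠ ⊤) (F : Finset L.Page)
    (hF : ∀ k, ∃ T : L.Sym, ∃ k₀ ∈ F, T.page k₀ = k) :
    ∃ v : L.H1, IsGroundState p ω v ∧ potential p v = L.level p ω ∧
      ENNReal.ofReal (action p ω v) = L.level p ω := by
  obtain ⟨u, hu⟩ := exists_isMinimizing hl
  obtain ⟨C, hC⟩ := hu.exists_energy_le hL hp hω hl
  obtain ⟨c, hc, hco⟩ := exists_coercive hω
  obtain ⟨ε, hε, hP⟩ := exists_le_powNorm hL hp hc hco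
  obtain ⟨δ, hδ, hk⟩ := exists_lt_pageMass hL (q := p + 1) (by linarith)
    ((energy_nonneg _).trans (hC 0)) hε
  choose k hk using fun n => hk (u n) (hC n) (hP _ (hu.1 n))
  choose T k₀ hk₀ hT using fun n => hF (k n)
  obtain ⟨k₁, hk₁⟩ := exists_frequently_eq hk₀
  obtain ⟨φ, hφ, hφk⟩ := extraction_of_frequently_atTop hk₁
  set v : ℕ → L.H1 := fun n => (T (φ n)).pull (u (φ n))
  have hv : IsMinimizing p ω v := by
    refine ⟨fun n => (T _).admissible_pull (hu.1 _), ?_⟩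
    simp only [v, Sym.potential_pull]
    exact (hu.comp_strictMono hφ).2
  have hvm : ∀ n, ENNReal.ofReal δ < pageMass (v n) k₁ := by
    intro n
    have := hk (φ n)
    rwa [← hT, hφk n, ← Sym.pageMass_pull] at this
  obtain ⟨C', hC'⟩ := hv.exists_energy_le hL hp hω hl
  have hb : ∀ n i, ‖(v n).comp i‖ ≤ √C' := fun n i => norm_comp_le_of_energy_le (hC' n) i
  obtain ⟨w, ψ, hψ, hw⟩ := exists_subseq_weakConv v hb
  refine ⟨w, (hv.comp_strictMono hψ).exists_isGroundState hL hp hω hl hw ?_⟩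
  by_contra hnt
  -- A zero weak limit would, by Rellich's theorem on the whole bounded page `k₁`, contradict the
  -- lower bound for the mass there.
  have h0 : ∀ e, Tendsto (fun n => inner ℂ e ((v (ψ n)).comp 0)) atTop (𝓝 0) := by
    intro e
    have := hw 0 e
    rwa [comp_eq_zero_of_not_nontriv hnt, inner_zero_right] at this
  have h1 := tendsto_lintegral_of_weakly_null (fun n => hb (ψ n)) h0 k₁ le_rfl le_rfl
    (hfin k₁).1 (hfin k₁).2
  have h2 := ge_of_tendsto' h1 fun n => (hvm (ψ n)).le
  exact absurd h2 (not_le.2 (ENNReal.ofReal_pos.2 hδ))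

end OpenBook

end

noncomputable section

/-! ### Points of a book -/

theorem openRect_subset_closedRect (a b : ℝ≥0∞) : openRect a b ⊆ closedRect a b :=
  fun _ hz => ⟨⟨hz.1.1.le, hz.1.2.le⟩, hz.2.1.le, hz.2.2.le⟩

theorem openSeg_nonempty {a : ℝ≥0∞} (ha : 0 < a) : (openSeg a).Nonempty := by
  obtain ⟨r, hr0, hr⟩ := ENNReal.lt_iff_exists_nnreal_btwn.1 ha
  exact ⟨r, by exact_mod_cast hr0, by rwa [ENNReal.ofReal_coe_nnreal]⟩

theorem toReal_notMem_openSeg {a : ℝ≥0∞} (ha : a ≠ ⊤) : a.toReal ∉ openSeg a := by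
  rintro ⟨-, h⟩
  rw [ENNReal.ofReal_toReal ha] at h
  exact lt_irrefl _ h

theorem zero_notMem_openSeg (a : ℝ≥0∞) : (0 : ℝ) ∉ openSeg a := fun h => lt_irrefl _ h.1

namespace PageSide

variable {a b : ℝ≥0∞}

theorem point_notMem_openRect {s : PageSide} (hs : s.Present a b) (t : ℝ) :
    s.point a b t ∉ openRect a b := by
  rintro ⟨h1, h2⟩
  cases s
  · exact zero_notMem_openSeg a h1
  · exact toReal_notMem_openSeg hs h1
  · exact zero_notMem_openSeg b h2
  · exact toReal_notMem_openSeg hs h2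

theorem point_inj (ha : 0 < a) (hb : 0 < b) {s s' : PageSide} (hs : s.Present a b)
    (hs' : s'.Present a b) {t t' : ℝ} (ht' : t' ∈ openSeg (s'.length a b))
    (h : s.point a b t = s'.point a b t') : s = s' ∧ t = t' := by
  have hpos : ∀ {c : ℝ≥0∞}, 0 < c → c ≠ ⊤ → 0 ≠ c.toReal := fun h0 h1 =>
    (ENNReal.toReal_pos h0.ne' h1).ne
  rw [Prod.ext_iff] at h
  cases s <;> cases s' <;> simp only [point, length, Present] at h ht' hs hs'
  · exact ⟨rfl, h.2⟩
  · exact absurd h.1 (hpos ha hs')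
  · exact absurd (h.1 ▸ ht') (zero_notMem_openSeg a)
  · exact absurd (h.1 ▸ ht') (zero_notMem_openSeg a)
  · exact absurd h.1.symm (hpos ha hs)
  · exact ⟨rfl, h.2⟩
  · exact absurd (h.1 ▸ ht') (toReal_notMem_openSeg hs)
  · exact absurd (h.1 ▸ ht') (toReal_notMem_openSeg hs)
  · exact absurd (h.2 ▸ ht') (zero_notMem_openSeg b)
  · exact absurd (h.2 ▸ ht') (zero_notMem_openSeg b)
  · exact ⟨rfl, h.1⟩
  · exact absurd h.2 (hpos hb hs')
  · exact absurd (h.2 ▸ ht') (toReal_notMem_openSeg hs)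
  · exact absurd (h.2 ▸ ht') (toReal_notMem_openSeg hs)
  · exact absurd h.2.symm (hpos hb hs)
  · exact ⟨rfl, h.1⟩

theorem segBump_point {s : PageSide} (hs : s.Present a b) (t : ℝ) :
    segBump a (s.point a b t).1 * segBump b (s.point a b t).2 = 0 := by
  cases s <;> simp_all [point, Present, segBump]

theorem point_mem_closedRect {s : PageSide} (hs : s.Present a b) {t : ℝ}
    (ht : t ∈ openSeg (s.length a b)) : s.point a b t ∈ closedRect a b := by
  have h1 : ∀ {c : ℝ≥0∞} {t : ℝ}, t ∈ openSeg c → t ∈ closedSeg c := fun h => ⟨h.1.le, h.2.le⟩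
  have h2 : ∀ {c : ℝ≥0∞}, c ≠ ⊤ → c.toReal ∈ closedSeg c := fun h =>
    ⟨ENNReal.toReal_nonneg, by rw [ENNReal.ofReal_toReal h]⟩
  cases s
  · exact ⟨mem_closedSeg_zero a, h1 ht⟩
  · exact ⟨h2 hs, h1 ht⟩
  · exact ⟨h1 ht, mem_closedSeg_zero b⟩
  · exact ⟨h1 ht, h2 hs⟩

end PageSide

theorem continuous_segBump (a : ℝ≥0∞) : Continuous (segBump a) := by
  unfold segBump
  split_ifs <;> fun_prop

theorem segBump_pos {a : ℝ≥0∞} {x : ℝ} (hx : x ∈ openSeg a) : 0 < segBump a x := by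
  unfold segBump
  split_ifs with h
  · exact hx.1
  · have := (openSeg_of_ne_top h ▸ hx : x ∈ Set.Ioo 0 a.toReal)
    exact mul_pos this.1 (by linarith [this.2])

namespace OpenBook

variable {L : OpenBook}

/-- The interior page point at a given point, if there is one. -/
def pagePoints (L : OpenBook) : L.Point → Set (L.Page × (ℝ × ℝ)) :=
  Quot.lift (Sum.elim (fun x => {y | x.2.1 ∈ L.rect x.1 ∧ y = (x.1, x.2.1)}) fun _ => ∅) (by
    rintro _ _ ⟨k, s, t, hz, ht⟩
    ext y
    simp only [Sum.elim_inl, Sum.elim_inr, Set.mem_ofPred_eq, Set.mem_empty_iff_false, iff_false]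
    exact fun h => PageSide.point_notMem_openRect s.2 t h.1)

/-- No gluing takes place in the interior of a page, so `pagePoints` is well defined on the quotient
and recovers the page of an interior point. -/
theorem eq_of_ofPage_eq {k k' : L.Page} {z : closedRect (L.width k) (L.height k)}
    {z' : closedRect (L.width k') (L.height k')} (h : L.ofPage k z = L.ofPage k' z')
    (hz : z.1 ∈ L.rect k) : k = k' ∧ z'.1 ∈ L.rect k' := by
  have h1 : (k, z.1) ∈ L.pagePoints (L.ofPage k z) := ⟨hz, rfl⟩
  rw [h] at h1
  exact ⟨congrArg Prod.fst h1.2, h1.1⟩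

theorem coord_mem_openSeg {k : L.Page} {s : L.Sides k} {t : ℝ} :
    L.coord k s t ∈ openSeg (L.bindingLength (L.attach k s)) ↔
      t ∈ openSeg (s.1.length (L.width k) (L.height k)) := by
  rw [coord_eq_flipIf rfl, flipIf_mem_openSeg (L.reversed_finite k s), L.attach_length]

/-- The interior binding point at a given point, if there is one. -/
def bindingPoints (L : OpenBook) : L.Point → Set (L.Binding × ℝ) :=
  Quot.lift (Sum.elim
    (fun x => {y | ∃ (s : L.Sides x.1) (t : ℝ),
      t ∈ openSeg (s.1.length (L.width x.1) (L.height x.1)) ∧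
      x.2.1 = s.1.point (L.width x.1) (L.height x.1) t ∧ y = (L.attach x.1 s, L.coord x.1 s t)})
    fun x => {y | x.2.1 ∈ openSeg (L.bindingLength x.1) ∧ y = (x.1, x.2.1)}) (by
    rintro _ _ ⟨k, s, t, hz, ht⟩
    ext y
    simp only [Sum.elim_inl, Sum.elim_inr, Set.mem_ofPred_eq]
    constructor
    · rintro ⟨s', t', ht', e, rfl⟩
      obtain ⟨e1, rfl⟩ := PageSide.point_inj (L.width_pos k) (L.height_pos k) s.2 s'.2 ht' e
      obtain rfl : s = s' := Subtype.ext e1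
      exact ⟨coord_mem_openSeg.2 ht', rfl⟩
    · rintro ⟨h1, rfl⟩
      exact ⟨s, t, coord_mem_openSeg.1 h1, rfl, rfl⟩)

/-- Away from the corners, a point of a binding is glued only to side points with the same binding
coordinate, and a side point that is not a corner determines its side. Hence the binding and the
coordinate can be read off from the glued point. -/
theorem eq_of_ofBinding_eq {j j' : L.Binding} {t : closedSeg (L.bindingLength j)}
    {t' : closedSeg (L.bindingLength j')} (h : L.ofBinding j t = L.ofBinding j' t')
    (ht : t.1 ∈ openSeg (L.bindingLength j)) : j = j' ∧ t.1 = t'.1 := by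
  have h1 : (j, t.1) ∈ L.bindingPoints (L.ofBinding j t) := ⟨ht, rfl⟩
  rw [h] at h1
  exact ⟨congrArg Prod.fst h1.2, congrArg Prod.snd h1.2⟩

theorem openSeg_subset_closedSeg (a : ℝ≥0∞) : openSeg a ⊆ closedSeg a :=
  fun _ h => ⟨h.1.le, h.2.le⟩

theorem ofPage_point {k : L.Page} {s : L.Sides k} {t : ℝ}
    (ht : t ∈ openSeg (s.1.length (L.width k) (L.height k))) :
    L.ofPage k ⟨s.1.point (L.width k) (L.height k) t, PageSide.point_mem_closedRect s.2 ht⟩ =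
      L.ofBinding (L.attach k s) ⟨L.coord k s t,
        openSeg_subset_closedSeg _ (coord_mem_openSeg.2 ht)⟩ :=
  Quot.sound (Glue.mk k s t _ _)

/-- A continuous function on the book that is positive inside the pages with `0 < c k` and vanishes
on the bindings. -/
def bump (L : OpenBook) (c : L.Page → ℝ) : L.Point → ℝ :=
  Quot.lift (Sum.elim
    (fun x => c x.1 * (segBump (L.width x.1) x.2.1.1 * segBump (L.height x.1) x.2.1.2))
    fun _ => 0) (by
    rintro _ _ ⟨k, s, t, hz, ht⟩
    simp only [Sum.elim_inl, Sum.elim_inr]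
    rw [PageSide.segBump_point s.2, mul_zero])

theorem bump_ofPage (c : L.Page → ℝ) (k : L.Page) (z : closedRect (L.width k) (L.height k)) :
    L.bump c (L.ofPage k z) = c k * (segBump (L.width k) z.1.1 * segBump (L.height k) z.1.2) := rfl

theorem bump_ofBinding (c : L.Page → ℝ) (j : L.Binding) (t : closedSeg (L.bindingLength j)) :
    L.bump c (L.ofBinding j t) = 0 := rfl

theorem continuous_bump (c : L.Page → ℝ) : Continuous (L.bump c) := by
  refine continuous_quot_lift _ (continuous_sum_dom.2 ⟨continuous_sigma fun k => ?_, ?_⟩)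
  · have h1 := continuous_segBump (L.width k)
    have h2 := continuous_segBump (L.height k)
    change Continuous fun z : closedRect (L.width k) (L.height k) =>
      c k * (segBump (L.width k) z.1.1 * segBump (L.height k) z.1.2)
    fun_prop
  · exact continuous_const

theorem exists_mem_rect (k : L.Page) : ∃ z, z ∈ L.rect k := by
  obtain ⟨x, hx⟩ := openSeg_nonempty (L.width_pos k)
  obtain ⟨y, hy⟩ := openSeg_nonempty (L.height_pos k)
  exact ⟨(x, y), hx, hy⟩

theorem bump_pos {k : L.Page} {z : ℝ × ℝ} (hz : z ∈ L.rect k) :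
    0 < segBump (L.width k) z.1 * segBump (L.height k) z.2 :=
  mul_pos (segBump_pos hz.1) (segBump_pos hz.2)

/-! ### Periodic books -/

/-- `T` describes the map `f` on points. -/
def Sym.Describes (T : L.Sym) (f : L.Point → L.Point) : Prop :=
  ∀ (k : L.Page) (z : closedRect (L.width k) (L.height k)),
    ∃ hz : (T.sym k).map z ∈ closedRect (L.width (T.page k)) (L.height (T.page k)),
      f (L.ofPage k z) = L.ofPage (T.page k) ⟨(T.sym k).map z, hz⟩

/-- A bijection that maps pages isometrically to pages and bindings isometrically to bindings is
described by a symmetry. -/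
theorem exists_sym_describes (f : L.Point ≃ L.Point)
    (hp : ∀ k : L.Page, ∃ (k' : L.Page)
      (φ : closedRect (L.width k) (L.height k) ≃ closedRect (L.width k') (L.height k')),
      (∀ z w, euclSq (φ z) (φ w) = euclSq z w) ∧ ∀ z, f (L.ofPage k z) = L.ofPage k' (φ z))
    (hp' : ∀ k : L.Page, ∃ (k' : L.Page)
      (φ : closedRect (L.width k) (L.height k) ≃ closedRect (L.width k') (L.height k')),
      (∀ z w, euclSq (φ z) (φ w) = euclSq z w) ∧ ∀ z, f.symm (L.ofPage k z) = L.ofPage k' (φ z))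
    (hb : ∀ j : L.Binding, ∃ (j' : L.Binding)
      (ψ : closedSeg (L.bindingLength j) → closedSeg (L.bindingLength j')),
      ∀ t, f (L.ofBinding j t) = L.ofBinding j' (ψ t)) :
    ∃ T : L.Sym, T.Describes f := by
  classical
  choose σ φ hφ hfσ using hp
  choose τ ψ hψ hfτ using hp'
  choose β θ hθ using hb
  choose S hS using fun k => exists_pageSym_of_equiv (L.width_pos k) (L.height_pos k) (φ k) (hφ k)
  choose R hR using fun k => exists_pageSym_of_equiv (L.width_pos k) (L.height_pos k) (ψ k) (hψ k)
  -- An interior point of a page determines its page; following one through the map and its inverse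
  -- shows that the page maps are mutually inverse.
  have hleft : ∀ k, τ (σ k) = k := by
    intro k
    obtain ⟨z, hz⟩ := exists_mem_rect k
    have h1 := hfσ k ⟨z, openRect_subset_closedRect _ _ hz⟩
    have h2 := hfτ (σ k) (φ k ⟨z, openRect_subset_closedRect _ _ hz⟩)
    rw [← h1, Equiv.symm_apply_apply] at h2
    exact (eq_of_ofPage_eq h2 hz).1.symm
  have hright : ∀ k, σ (τ k) = k := by
    intro k
    obtain ⟨z, hz⟩ := exists_mem_rect k
    have h1 := hfτ k ⟨z, openRect_subset_closedRect _ _ hz⟩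
    have h2 := hfσ (τ k) (ψ k ⟨z, openRect_subset_closedRect _ _ hz⟩)
    rw [← h1, Equiv.apply_symm_apply] at h2
    exact (eq_of_ofPage_eq h2 hz).1.symm
  have hdesc : ∀ (k : L.Page) (z : closedRect (L.width k) (L.height k)),
      ∃ hz : (S k).map z ∈ closedRect (L.width (σ k)) (L.height (σ k)),
        f (L.ofPage k z) = L.ofPage (σ k) ⟨(S k).map z, hz⟩ := by
    intro k z
    refine ⟨by rw [← hS]; exact (φ k z).2, ?_⟩
    rw [hfσ]
    congr 1
    exact Subtype.ext (hS k z)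
  -- The image of a point on a side is computed twice, through the page and through the binding. It
  -- is not an endpoint of its binding, so the two descriptions have the same binding and the same
  -- coordinate.
  have hside : ∀ (k : L.Page) (s : L.Sides k),
      ∀ t, ∀ ht : t ∈ openSeg (s.1.length (L.width k) (L.height k)),
      L.attach (σ k) ⟨(S k).side s.1, (S k).present _ s.2⟩ = β (L.attach k s) ∧
      L.coord (σ k) ⟨(S k).side s.1, (S k).present _ s.2⟩
        (flipIf ((S k).rev s.1) (s.1.length (L.width k) (L.height k)) t) =
      θ (L.attach k s) ⟨L.coord k s t, openSeg_subset_closedSeg _ (coord_mem_openSeg.2 ht)⟩ := by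
    intro k s t ht
    set s' : L.Sides (σ k) := ⟨(S k).side s.1, (S k).present _ s.2⟩
    set t' := flipIf ((S k).rev s.1) (s.1.length (L.width k) (L.height k)) t
    have ht' : t' ∈ openSeg (s'.1.length (L.width (σ k)) (L.height (σ k))) := by
      rw [(S k).length_eq]
      exact (flipIf_mem_openSeg ((S k).rev_finite s.1)).2 ht
    obtain ⟨hz, h1⟩ := hdesc k ⟨_, PageSide.point_mem_closedRect s.2 ht⟩
    rw [ofPage_point ht, hθ] at h1
    have h2 := ofPage_point ht'
    have h3 : (⟨(S k).map (s.1.point (L.width k) (L.height k) t), hz⟩ :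
        closedRect (L.width (σ k)) (L.height (σ k))) =
        ⟨s'.1.point (L.width (σ k)) (L.height (σ k)) t', PageSide.point_mem_closedRect s'.2 ht'⟩ :=
      Subtype.ext ((S k).point_eq s.1 t s.2)
    rw [h3, h2] at h1
    exact eq_of_ofBinding_eq h1.symm (coord_mem_openSeg.2 ht')
  refine ⟨⟨⟨σ, τ, hleft, hright⟩, S, β,
    fun j t => if h : t ∈ closedSeg (L.bindingLength j) then θ j ⟨t, h⟩ else 0,
    fun k s => ?_, fun k s t ht => ?_⟩, hdesc⟩
  · have hlen : 0 < s.1.length (L.width k) (L.height k) := by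
      rw [← L.attach_length]; exact L.bindingLength_pos _
    obtain ⟨t, ht⟩ := openSeg_nonempty hlen
    exact (hside k s t ht).1
  · refine (hside k s t ht).2.trans ?_
    rw [dif_pos]

/-- The pages of a periodic book are bounded, and finitely many up to symmetry. -/
theorem IsPeriodic.exists_finset (hL : L.IsPeriodic) :
    (∀ k, L.width k ≠ ⊤ ∧ L.height k ≠ ⊤) ∧
    ∃ F : Finset L.Page, ∀ k, ∃ T : L.Sym, ∃ k₀ ∈ F, T.page k₀ = k := by
  classical
  obtain ⟨n, act, hpage, hbind, -, -, Q, hQ, hcov⟩ := hL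
  have hsym : ∀ g : Fin n → ℤ, ∃ T : L.Sym, T.Describes fun x => g +ᵥ x := by
    intro g
    refine exists_sym_describes (AddAction.toPerm g) (hpage g) (fun k => ?_) fun j => ?_
    · obtain ⟨k', φ, h1, h2⟩ := hpage (-g) k
      exact ⟨k', φ, h1, h2⟩
    · obtain ⟨j', ψ, h⟩ := hbind g j
      exact ⟨j', ψ, h⟩
  have hbound : ∀ c : L.Page → ℝ, ∃ M, ∀ x ∈ Q, L.bump c x ≤ M := by
    intro c
    obtain ⟨M, hM⟩ := (hQ.image (continuous_bump c)).bddAbove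
    exact ⟨M, fun x hx => hM ⟨x, hx, rfl⟩⟩
  -- The function `bump` with all coefficients one is invariant under the group and bounded on the
  -- compact set, hence bounded on the whole book. On a page with an infinite side it would be
  -- unbounded.
  have hinv : ∀ (g : Fin n → ℤ) (x : L.Point),
      L.bump (fun _ => 1) (g +ᵥ x) = L.bump (fun _ => 1) x := by
    intro g x
    induction x using Quot.ind with
    | mk x =>
      rcases x with ⟨k, z⟩ | ⟨j, t⟩
      · obtain ⟨T, hT⟩ := hsym g
        obtain ⟨hz, h1⟩ := hT k z
        change L.bump _ (g +ᵥ L.ofPage k z) = L.bump _ (L.ofPage k z)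
        refine (congrArg (L.bump _) h1).trans ?_
        rw [bump_ofPage, bump_ofPage, (T.sym k).bump_eq]
      · obtain ⟨j', ψ, h⟩ := hbind g j
        change L.bump _ (g +ᵥ L.ofBinding j t) = L.bump _ (L.ofBinding j t)
        rw [h, bump_ofBinding, bump_ofBinding]
  obtain ⟨M, hM⟩ := hbound fun _ => 1
  have hall : ∀ x, L.bump (fun _ => 1) x ≤ M := by
    intro x
    obtain ⟨g, y, hy, rfl⟩ := hcov x
    rw [hinv]
    exact hM y hy
  have hunb : ∀ {y : ℝ} (_ : 0 < y), ∃ x : ℝ, 0 < x ∧ M < x * y := by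
    intro y hy
    refine ⟨(|M| + 1) / y, by positivity, ?_⟩
    rw [div_mul_cancel₀ _ hy.ne']
    linarith [le_abs_self M]
  refine ⟨fun k => ⟨fun htop => ?_, fun htop => ?_⟩, ?_⟩
  · obtain ⟨y, hy⟩ := openSeg_nonempty (L.height_pos k)
    obtain ⟨x, hx0, hx⟩ := hunb (segBump_pos hy)
    have h1 := hall (L.ofPage k ⟨(x, y), ⟨hx0.le, by simp [htop]⟩, openSeg_subset_closedSeg _ hy⟩)
    have h2 : segBump (L.width k) x = x := if_pos htop
    rw [bump_ofPage, one_mul, h2] at h1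
    exact absurd hx h1.not_gt
  · obtain ⟨y, hy⟩ := openSeg_nonempty (L.width_pos k)
    obtain ⟨x, hx0, hx⟩ := hunb (segBump_pos hy)
    have h1 := hall (L.ofPage k ⟨(y, x), openSeg_subset_closedSeg _ hy, ⟨hx0.le, by simp [htop]⟩⟩)
    have h2 : segBump (L.height k) x = x := if_pos htop
    rw [bump_ofPage, one_mul, h2, mul_comm] at h1
    exact absurd hx h1.not_gt
  · set A : Set L.Page := {k | ∃ z, ∃ hz : z ∈ L.rect k,
      L.ofPage k ⟨z, openRect_subset_closedRect _ _ hz⟩ ∈ Q}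
    -- Pages whose interior meets `Q` are numbered injectively by `N`. The coefficients below give
    -- `bump` the value `N k` at a chosen interior point in `Q` of each such page `k`; boundedness
    -- on `Q` leaves only finitely many.
    have hA : A.Finite := by
      obtain ⟨N, hN⟩ := Countable.exists_injective_nat L.Page
      set z : L.Page → ℝ × ℝ := fun k => if h : k ∈ A then h.choose else (exists_mem_rect k).choose
      have hz : ∀ k, z k ∈ L.rect k := by
        intro k
        by_cases h : k ∈ A
        · simp only [z, dif_pos h]; exact h.choose_spec.choose
        · simp only [z, dif_neg h]; exact (exists_mem_rect k).choose_spec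
      have hzQ : ∀ k ∈ A, L.ofPage k ⟨z k, openRect_subset_closedRect _ _ (hz k)⟩ ∈ Q := by
        intro k h
        have h1 := h.choose_spec.choose_spec
        convert h1 using 3
        simp only [z, dif_pos h]
      obtain ⟨M', hM'⟩ := hbound fun k =>
        N k / (segBump (L.width k) (z k).1 * segBump (L.height k) (z k).2)
      refine Set.Finite.subset ((Set.finite_Iic ⌊M'⌋₊).preimage hN.injOn) fun k hk => ?_
      have h1 := hM' _ (hzQ k hk)
      rw [bump_ofPage, div_mul_cancel₀ _ (bump_pos (hz k)).ne'] at h1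
      exact Nat.le_floor h1
    refine ⟨hA.toFinset, fun k => ?_⟩
    obtain ⟨z, hz⟩ := exists_mem_rect k
    -- An interior point of the page `k` is moved into `Q` by `-g` and remains interior to a page,
    -- which therefore belongs to the finite set; `g` leads back to `k`.
    obtain ⟨g, y, hy, hgy⟩ := hcov (L.ofPage k ⟨z, openRect_subset_closedRect _ _ hz⟩)
    obtain ⟨T, hT⟩ := hsym g
    obtain ⟨T', hT'⟩ := hsym (-g)
    obtain ⟨hz', h1⟩ := hT' k ⟨z, openRect_subset_closedRect _ _ hz⟩
    simp only [← hgy, neg_vadd_vadd] at h1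
    have hmem : (T'.sym k).map z ∈ L.rect (T'.page k) := ((T'.sym k).mem_iff z).2 hz
    refine ⟨T, T'.page k, ?_, ?_⟩
    · rw [Set.Finite.mem_toFinset]
      exact ⟨_, hmem, h1 ▸ hy⟩
    · obtain ⟨hz'', h2⟩ := hT (T'.page k) ⟨(T'.sym k).map z, hz'⟩
      simp only [← h1, hgy] at h2
      exact (eq_of_ofPage_eq h2 hz).1.symm

theorem Sym.dims_eq (T : L.Sym) (k : L.Page) :
    (L.width (T.page k) = L.width k ∧ L.height (T.page k) = L.height k) ∨
    (L.width (T.page k) = L.height k ∧ L.height (T.page k) = L.width k) :=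
  (T.sym k).dims

theorem exists_sidesAbove_of_sym (F : Finset L.Page)
    (hF : ∀ k, ∃ T : L.Sym, ∃ k₀ ∈ F, T.page k₀ = k) : ∃ h, L.SidesAbove h := by
  choose h h0 h1 h2 using exists_ofReal_lt_sides (L := L)
  rcases F.eq_empty_or_nonempty with rfl | hne
  · refine ⟨1, one_pos, fun k => ?_⟩
    obtain ⟨T, k₀, h, -⟩ := hF k
    simp at h
  · obtain ⟨k₁, -, hk₁⟩ := F.exists_min_image h hne
    refine ⟨h k₁, h0 k₁, fun k => ?_⟩
    obtain ⟨T, k₀, hk₀, rfl⟩ := hF k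
    have e1 := (ENNReal.ofReal_le_ofReal (hk₁ k₀ hk₀)).trans_lt (h1 k₀)
    have e2 := (ENNReal.ofReal_le_ofReal (hk₁ k₀ hk₀)).trans_lt (h2 k₀)
    rcases T.dims_eq k₀ with ⟨d1, d2⟩ | ⟨d1, d2⟩ <;> rw [d1, d2]
    exacts [⟨e1, e2⟩, ⟨e2, e1⟩]

end OpenBook

end

noncomputable section

/-! ### Admissible functions exist -/

/-- As `f` vanishes near the boundary of `Ω`, this is integration by parts on the whole plane. The
test function need not be supported in `Ω`, which is what makes the traces of `f` vanish. -/
theorem green_of_tsupport_subset {Ω : Set (ℝ × ℝ)} {f φ : ℝ × ℝ → ℝ} (hf : ContDiff ℝ (⊤ : ℕ∞) f)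
    (hfc : HasCompactSupport f) (hfΩ : tsupport f ⊆ Ω) (hφ : ContDiff ℝ (⊤ : ℕ∞) φ)
    (hφc : HasCompactSupport φ) (e : ℝ × ℝ) :
    ∫ z in Ω, fderiv ℝ φ z e • (f z : ℂ) = - ∫ z in Ω, φ z • ((fderiv ℝ f z e : ℝ) : ℂ) := by
  have hf0 : ∀ z, z ∉ Ω → f z = 0 := fun z hz =>
    image_eq_zero_of_notMem_tsupport fun h => hz (hfΩ h)
  have hf0' : ∀ z, z ∉ Ω → fderiv ℝ f z = 0 := fun z hz =>
    fderiv_of_notMem_tsupport ℝ fun h => hz (hfΩ h)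
  rw [setIntegral_eq_integral_of_forall_compl_eq_zero fun z hz => by simp [hf0 z hz],
    setIntegral_eq_integral_of_forall_compl_eq_zero fun z hz => by simp [hf0' z hz]]
  have hcf : Continuous fun z => fderiv ℝ f z e :=
    (hf.continuous_fderiv (by simp)).clm_apply continuous_const
  have hcφ : Continuous fun z => fderiv ℝ φ z e :=
    (hφ.continuous_fderiv (by simp)).clm_apply continuous_const
  have h := integral_mul_fderiv_eq_neg_fderiv_mul_of_integrable (μ := volume) (f := φ) (g := f)
    (v := e) ((hcφ.mul hf.continuous).integrable_of_hasCompactSupport hfc.mul_left)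
    ((hφ.continuous.mul hcf).integrable_of_hasCompactSupport hφc.mul_right)
    ((hφ.continuous.mul hf.continuous).integrable_of_hasCompactSupport hfc.mul_left)
    (fun x _ => hφ.differentiable (by simp) x) (fun x _ => hf.differentiable (by simp) x)
  have e1 : ∫ z, fderiv ℝ φ z e • (f z : ℂ) = ((∫ z, fderiv ℝ φ z e * f z : ℝ) : ℂ) := by
    rw [← integral_complex_ofReal]
    simp
  have e2 : ∫ z, φ z • ((fderiv ℝ f z e : ℝ) : ℂ) = ((∫ z, φ z * fderiv ℝ f z e : ℝ) : ℂ) := by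
    rw [← integral_complex_ofReal]
    simp
  rw [e1, e2, h]
  simp

namespace OpenBook

variable {L : OpenBook}

theorem isTrace_zero {a b : ℝ≥0∞} {U : Fin 3 → ℝ × ℝ → ℂ}
    (hU : ∀ i, MemLp (U i) 2 (volume.restrict (openRect a b)))
    (h : ∀ (i : Bool) (φ : ℝ × ℝ → ℝ), ContDiff ℝ (⊤ : ℕ∞) φ → HasCompactSupport φ →
      ∫ z in openRect a b, fderiv ℝ φ z (axisDir i) • U 0 z =
        - ∫ z in openRect a b, φ z • PageSym.gradComp U i z) (s : PageSide) :
    IsTrace a b (U 0) (U 1) (U 2) s fun _ => 0 := by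
  refine ⟨MemLp.zero, fun φ h1 h2 _ => ⟨?_, ?_⟩⟩
  · have := h false φ h1 h2
    rw [green_integrable (hU 0) (hU 1) h1 h2]
    simpa [eq_neg_iff_add_eq_zero, axisDir, PageSym.gradComp] using this
  · have := h true φ h1 h2
    rw [green_integrable (hU 0) (hU 2) h1 h2]
    simpa [eq_neg_iff_add_eq_zero, axisDir, PageSym.gradComp] using this

/-- A smooth bump inside one page, extended by zero to the other pages, has zero traces everywhere
and so meets the matching conditions. -/
theorem exists_memH1D_nontriv (k : L.Page) : ∃ u : L.H1, MemH1D u ∧ Nontriv u := by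
  classical
  obtain ⟨x, hx⟩ := exists_mem_rect k
  have ho : IsOpen (L.rect k) := isOpen_openRect _ _
  obtain ⟨f, hfs, hfc, hf, -, hfx⟩ := exists_contDiff_tsupport_subset (n := ⊤) (ho.mem_nhds hx)
  set V : Fin 3 → ℝ × ℝ → ℂ := ![fun z => f z, fun z => (fderiv ℝ f z (1, 0) : ℝ),
    fun z => (fderiv ℝ f z (0, 1) : ℝ)]
  set U : Fin 3 → L.Page → ℝ × ℝ → ℂ := fun i k' => if k' = k then V i else 0
  have hV : ∀ i, MemLp (V i) 2 (volume.restrict (L.rect k)) := by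
    intro i
    fin_cases i
    · exact (memLp_of_contDiff hf hfc _).ofReal
    · exact (memLp_fderiv_of_contDiff hf hfc (1, 0) _).ofReal
    · exact (memLp_fderiv_of_contDiff hf hfc (0, 1) _).ofReal
  have hUk : ∀ i k', MemLp (U i k') 2 (volume.restrict (L.rect k')) := by
    intro i k'
    by_cases h : k' = k
    · subst h; simpa only [U, if_true] using hV i
    · simp only [U, h, if_false]; exact MemLp.zero
  have hU : ∀ i, MemLp (fun x : L.Page × (ℝ × ℝ) => U i x.1 x.2) 2 L.mu := by
    intro i
    rw [memLp_mu_iff]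
    refine ⟨hUk i, ?_⟩
    rw [lpPow, tsum_eq_single k fun k' h => by simp [U, h]]
    exact (memLp_two_iff.1 (hUk i k)).2
  have hgreen : ∀ (k' : L.Page) (i : Bool) (φ : ℝ × ℝ → ℝ), ContDiff ℝ (⊤ : ℕ∞) φ →
      HasCompactSupport φ → ∫ z in L.rect k', fderiv ℝ φ z (axisDir i) • U 0 k' z =
        - ∫ z in L.rect k', φ z • PageSym.gradComp (fun i => U i k') i z := by
    intro k' i φ h1 h2
    by_cases h : k' = k
    · subst h
      simp only [U, if_true]
      cases i
      · exact green_of_tsupport_subset hf hfc hfs h1 h2 _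
      · exact green_of_tsupport_subset hf hfc hfs h1 h2 _
    · cases i <;> simp [U, h, PageSym.gradComp]
  set u : L.H1 := H1.ofParts U hU (fun k' φ h1 h2 _ => hgreen k' false φ h1 h2)
    (fun k' φ h1 h2 _ => hgreen k' true φ h1 h2)
  refine ⟨u, fun j => ⟨fun _ => 0, fun k' s _ => ?_⟩, ?_⟩
  · exact isTrace_zero (U := fun i => U i k') (fun i => hUk i k') (hgreen k') s.1
  · rw [Nontriv]
    have hle : ∫⁻ z in L.rect k, ‖U 0 k z‖ₑ ^ (2 : ℝ) ≤ L.lpPow 2 u.toFun :=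
      ENNReal.le_tsum (f := fun k => ∫⁻ z in L.rect k, ‖U 0 k z‖ₑ ^ (2 : ℝ)) k
    refine ne_of_gt (lt_of_lt_of_le ?_ hle)
    have hc : Continuous fun z => ‖U 0 k z‖ₑ ^ (2 : ℝ) := by
      simp only [U, if_true]
      have := hf.continuous
      exact ENNReal.continuous_rpow_const.comp
        (continuous_enorm.comp (Complex.continuous_ofReal.comp this))
    have hset : IsOpen (L.rect k ∩ {z | 0 < ‖U 0 k z‖ₑ ^ (2 : ℝ)}) :=
      ho.inter (isOpen_lt continuous_const hc)
    rw [lintegral_pos_iff_support hc.measurable, Measure.restrict_apply' ho.measurableSet,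
      Set.inter_comm]
    refine lt_of_lt_of_le (hset.measure_pos volume ⟨x, hx, ?_⟩)
      (measure_mono fun z hz => ⟨hz.1, hz.2.ne'⟩)
    simp [U, V, hfx]

theorem level_ne_top {h : ℝ} (hL : L.SidesAbove h) {p ω : ℝ} (hp : 1 < p) (k : L.Page) :
    L.level p ω ≠ ⊤ := by
  obtain ⟨u, hu, hn⟩ := exists_memH1D_nontriv k
  have hP := powNorm_pos hL (q := p + 1) (by linarith) hn
  -- Under scaling the power term outgrows the quadratic one. The absolute value and the summand `1`
  -- make `r` positive and `r` times the power term at least the quadratic term, whatever the sign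
  -- of the latter.
  set r := |quad ω u| / powNorm (p + 1) u + 1
  have hr : 0 < r := by positivity
  set t := r ^ (1 / (p - 1))
  have ht0 : 0 < t := by positivity
  have htp : t ^ (p + 1) = t ^ 2 * r := by
    have e1 : t ^ (p - 1) = r := by
      rw [← Real.rpow_mul hr.le, one_div, inv_mul_cancel₀ (by linarith), Real.rpow_one]
    rw [← e1, ← Real.rpow_natCast, ← Real.rpow_add ht0]
    norm_num
    ring_nf
  have hadm : Admissible p ω (H1.comb t 0 u u) := by
    refine ⟨hu.comb hu _ _, nontriv_comb ht0.ne' hn, ?_⟩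
    have e : r * powNorm (p + 1) u = |quad ω u| + powNorm (p + 1) u := by
      simp only [r]; field_simp
    rw [nehari_eq, quad_comb, powNorm_comb (by linarith) ht0.le, htp, mul_assoc, e, ← mul_sub]
    refine mul_nonpos_of_nonneg_of_nonpos (by positivity) ?_
    linarith [le_abs_self (quad ω u)]
  refine ne_top_of_le_ne_top ?_ (level_le hadm)
  rw [potential_eq hL hp]
  exact ENNReal.ofReal_ne_top

end OpenBook

end

/-! ### The theorem for finite and periodic books -/

theorem theorem1 (L : OpenBook) (hconn : L.IsConnected) (htype : L.IsFinite ∨ L.IsPeriodic)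
    (p : ℝ) (hp : 1 < p) (ω : ℝ) (hω : -L.spectralBottom < ω)
    (hfin : L.IsFinite → L.level p ω < L.levelAtInfinity p ω) :
    0 < L.level p ω ∧
    ∃ u : L.H1, OpenBook.IsGroundState p ω u ∧
      OpenBook.potential p u = L.level p ω ∧
      ENNReal.ofReal (OpenBook.action p ω u) = L.level p ω := by
  rcases htype with hF | hP
  · obtain ⟨h, hL⟩ := hF.exists_sidesAbove
    exact ⟨OpenBook.level_pos hL hp hω,
      OpenBook.exists_isGroundState_of_lt hL hp hω (hfin hF)⟩
  · obtain ⟨hb, F, hF⟩ := hP.exists_finset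
    obtain ⟨h, hL⟩ := OpenBook.exists_sidesAbove_of_sym F hF
    obtain ⟨k⟩ := hconn.1
    exact ⟨OpenBook.level_pos hL hp hω, OpenBook.exists_isGroundState_of_sym hL hp hω
      (OpenBook.level_ne_top hL hp k) hb F hF⟩
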